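/- **Setting.** Let $m$ be the number of miners, $\mathsf{ID}$ a finite set of user identities, $\mathbb F$ a finite field with distinct nonzero points $x_1,\dots,x_m$ (all fixed independently of the security parameter $\lambda$), and let $t=\lceil m/2\rceil$. Efficient algorithms and adversaries are non-uniform probabilistic polynomial time (PPT: families of polynomial-size Boolean circuits with uniformly random input bits), $\equiv_c$ is indistinguishability by non-uniform PPT distinguishers, and "negligible" means $O(\lambda^{-c})$ for every $c$. The network is synchronous with authenticated private channels and a broadcast channel. *Secret sharing.* A $t$-out-of-$m$ Shamir sharing of $s\in\mathbb F$ consists of the values at $x_1,\dots,x_m$ of $s+\sum_{k=1}^{t-1}a_kx^k$ with uniform $a_k\in\mathbb F$; reconstruction from shares with index set $I$ returns the value at $0$ of the polynomial of degree $<t$ through them, and fails if $|I|<t$ or there is no such polynomial. *Commitments.* $\mathsf{comm}(X,r)$ is computable in polynomial time, with $X\in\{0,1\}^{\ell(\lambda)}$, $r\in\{0,1\}^\lambda$; elements of $\mathbb F$ are injectively encoded as messages. It is perfectly binding if $\mathsf{comm}(X,r)\ne\mathsf{comm}(X',r')$ whenever $X\neq X'$, and computationally hiding if for all sequences $X,X'$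 of messages, $\mathsf{comm}(X,r)\equiv_c\mathsf{comm}(X',r)$ for uniform $r$. *NIZK.* A multi-CRS NIZK for a relation $\mathcal R$ with $m$ contributors consists of PPT algorithms $\mathsf K(1^\lambda)$ (CRS generation), $\mathsf P(\mathrm{CRS},\mathsf{stmt},w)$, a deterministic polynomial-time verifier $\mathsf V(\mathrm{CRS},\mathsf{stmt},\pi)\in\{0,1\}$, and PPT simulators $\widetilde{\mathsf K}(1^\lambda)$ (outputs a CRS and a trapdoor) and $\widetilde{\mathsf P}(\mathrm{CRS},\vec\tau,\mathsf{stmt})$, where $\mathrm{CRS}=(\mathsf{crs}_j)_{j\in[m]}$. In the games below the adversary makes polynomially many calls to a generation oracle and then fixes a CRS vector; it is *minority-constrained* if at least $\lfloor m/2\rfloor+1$ entries of this vector are always among the oracle's CRSes; $\vec\tau$ (resp. $\overrightarrow{\mathsf{ek}}$) consists of the trapdoors (resp. extraction keys) of those entries that the oracle generated. - *Completeness (honest majority):* if at least $\lfloor m/2\rfloor+1$ entries of $\mathrm{CRS}$ lie in the support of $\mathsf K(1^\lambda)$ and $\mathcal R(\mathsf{stmt},w)=1$, then $\mathsf V(\mathrm{CRS},\mathsf{stmt},\mathsf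 P(\mathrm{CRS},\mathsf{stmt},w))=1$ with probability $1$. - *Zero-knowledge:* the CRSes output by $\mathsf K$ and $\widetilde{\mathsf K}$ are computationally indistinguishable; and for every minority-constrained non-uniform PPT $\mathcal A$, which calls $\widetilde{\mathsf K}$ (receiving CRSes and trapdoors), outputs $\mathrm{CRS},\mathsf{stmt},w$, and receives $\pi$, the probabilities that $\mathcal R(\mathsf{stmt},w)=1$ and $\mathcal A$ outputs $1$ differ negligibly between $\pi\leftarrow\mathsf P(\mathrm{CRS},\mathsf{stmt},w)$ and $\pi\leftarrow\widetilde{\mathsf P}(\mathrm{CRS},\vec\tau,\mathsf{stmt})$. - *Simulation sound extractability:* there are PPT $\widetilde{\mathsf K}_0$, which outputs triples $(\mathsf{crs},\tau,\mathsf{ek})$ whose first two components are distributed as $\widetilde{\mathsf K}(1^\lambda)$, and $\mathcal E$ such that every minority-constrained non-uniform PPT $\mathcal A$ that calls $\widetilde{\mathsf K}_0$ (receiving $\mathsf{crs},\mathsf{ek}$), fixes $\mathrm{CRS}$, adaptively obtains polynomially many proofs $\widetilde{\mathsf P}(\mathrm{CRS},\vec\tau,\cdot)$ of statements of its choice, and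 outputs $(\mathsf{stmt},\pi)$, has only negligible probability that $(\mathsf{stmt},\pi)$ is not one of the pairs obtained, $\mathsf V(\mathrm{CRS},\mathsf{stmt},\pi)=1$, and $\mathcal R(\mathsf{stmt},w)=0$ for $w\leftarrow\mathcal E(\mathrm{CRS},\overrightarrow{\mathsf{ek}},\mathsf{stmt},\pi)$. *Mechanism and $\mathcal F_{\rm MPC}$.* A transaction fee mechanism is a randomized polynomial-time map from bid vectors $\mathbf b\in\mathbb F^{\mathsf{ID}}$ to outcomes (which bids are confirmed, the payments, with payment $0$ for unconfirmed bids, and the total miner revenue). $\mathcal F_{\rm MPC}$ receives one bid from each identity, runs the mechanism and sends the outcome to everyone. *Protocol $\Pi_{\rm MPC}$.* Identity $i$ has bid $b_i\in\mathbb F$; $\mathcal C$ is initially empty. (1) Each miner $j$ broadcasts $\mathsf{crs}_j\leftarrow\mathsf K(1^\lambda)$ (replaced by $0$ if missing). (2) Each identity $i$ splits $b_i$ into Shamir shares $X_{i,j}$ and broadcasts $\widehat X_{i,j}=\mathsf{comm}(X_{i,j},r_{i,j})$, $j\in[m]$, with fresh $r_{i,j}$. (3) Identity $i$ broadcasts a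 NIZK proof, for the statement $(i,(\widehat X_{i,j})_j)$ with witness $(b_i,(X_{i,j},r_{i,j})_j)$, that every $(X_{i,j},r_{i,j})$ opens $\widehat X_{i,j}$ and $(X_{i,j})_j$ is a valid $t$-out-of-$m$ sharing of $b_i$. (4) Identities that did not broadcast their commitments or an accepted proof are put into $\mathcal C$. (5) Identity $i$ sends $(X_{i,j},r_{i,j})$ privately to each miner $j$. (6) Each miner $j$ broadcasts, for every $i\in\mathsf{ID}\setminus\mathcal C$, "ok" if it received a correct opening of $\widehat X_{i,j}$ (which it records), and a complaint otherwise. (7) Identity $i$ broadcasts the opening $(X_{i,j},r_{i,j})$ for every miner $j$ that complained about $i$; miners record correct openings. (8) Identities with a complaint not answered by a correct opening are put into $\mathcal C$. (9) The miners send their recorded openings to the ideal functionality $\mathcal F_{\rm TFM}$, which discards incorrect openings, reconstructs $b_i$ for $i\in\mathsf{ID}\setminus\mathcal C$ from the correct ones ($0$ if this fails), sets $b_i=0$ for $i\in\mathcal C$, runs the mechanism on $\mathbf b$ and sends the outcome to every miner. Miners output the outcome and announce it to the identities; an identity outputs the value announced by more than half of the miners. **Theorem.** Assume that $\mathsf{comm}$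 is perfectly binding and computationally hiding, and that the multi-CRS NIZK satisfies completeness, zero-knowledge and simulation sound extractability for the relation proved in step (3). Then $\Pi_{\rm MPC}$ securely realizes $\mathcal F_{\rm MPC}$ in the $\mathcal F_{\rm TFM}$-hybrid model against every coalition with fewer than $m/2$ miners. That is: for every set of corrupted miners of size less than $m/2$, every set of corrupted identities, and every non-uniform PPT adversary $\mathcal A$ that controls them in the protocol (malicious, static, rushing, with polynomially long auxiliary input), there is a non-uniform PPT simulator $\mathcal S$, which gets the same auxiliary input, chooses the corrupted identities' bids to $\mathcal F_{\rm MPC}$, receives the outcome and outputs a simulated view, such that for all sequences of honest bids and of auxiliary inputs, the joint distribution of the honest parties' outputs and $\mathcal A$'s view (auxiliary input, random coins, received messages) in the protocol is computationally indistinguishable from the joint distribution of the honest parties' outputs and $\mathcal S$'s output in the ideal world. -/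

import Mathlib

noncomputable section

namespace MPCAuction

open scoped Classical

/-! ## Bit strings, Boolean circuits, non-uniform probabilistic polynomial time -/

/-- Bit strings of length `k`. -/
abbrev Bits (k : ℕ) : Type := Fin k → Bool

/-- The all-zero bit string. -/
def zeroBits (k : ℕ) : Bits k := fun _ => false

/-- A fixed-length binary encoding of a type: every element is written injectively on a
finite set of wires. -/
class BitCode (α : Type) where
  Wire : Type
  [fin : Fintype Wire]
  bits : α → Wire → Bool
  bits_injective : Function.Injective bits

attribute [reducible, instance] BitCode.fin

instance : BitCode Bool where
  Wire := Unit
  bits b _ := b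
  bits_injective := fun _ _ h => congrFun h ()

/-- Elements of `Fin k` are encoded by their indicator vector. -/
instance (k : ℕ) : BitCode (Fin k) where
  Wire := Fin k
  bits a w := decide (a = w)
  bits_injective := fun a b h => by
    have := congrFun h b
    simpa using this

instance {α β : Type} [BitCode α] [BitCode β] : BitCode (α × β) where
  Wire := BitCode.Wire α ⊕ BitCode.Wire β
  bits x := Sum.elim (BitCode.bits x.1) (BitCode.bits x.2)
  bits_injective := fun x y h => by
    refine Prod.ext (BitCode.bits_injective ?_) (BitCode.bits_injective ?_)
    · funext w
      exact congrFun h (Sum.inl w)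
    · funext w
      exact congrFun h (Sum.inr w)

/-- A tuple is encoded entry by entry. -/
instance {k : ℕ} {α : Type} [BitCode α] : BitCode (Fin k → α) where
  Wire := Fin k × BitCode.Wire α
  bits x w := BitCode.bits (x w.1) w.2
  bits_injective := fun x y h => by
    funext i
    refine BitCode.bits_injective ?_
    funext w
    exact congrFun h (i, w)

/-- A possibly missing message: one presence bit, and the bits of the message. -/
instance {α : Type} [BitCode α] : BitCode (Option α) where
  Wire := Option (BitCode.Wire α)
  bits x w := match x, w with
    | none, _ => false
    | some _, none => true
    | some a, some w => BitCode.bits a w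
  bits_injective := fun x y h => by
    cases x with
    | none =>
      cases y with
      | none => rfl
      | some b => exact absurd (congrFun h none) (by simp)
    | some a =>
      cases y with
      | none => exact absurd (congrFun h none) (by simp)
      | some b =>
        refine congrArg some (BitCode.bits_injective ?_)
        funext w
        exact congrFun h (some w)

/-- Boolean circuits with output wires `W` over a set of input wires, as straight-line programs:
every gate (a constant or a NAND of two wires) adds one wire to the available ones. -/
inductive Circuit (W : Type) : Type → Type 1
  | out {V : Type} (o : W → V) : Circuit W V
  | const {V : Type} (b : Bool) (rest : Circuit W (Option V)) : Circuit W V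
  | nand {V : Type} (u v : V) (rest : Circuit W (Option V)) : Circuit W V

/-- The value of a circuit on an input. -/
def Circuit.eval {W : Type} : {V : Type} → Circuit W V → (V → Bool) → W → Bool
  | _, .out o, x => fun w => x (o w)
  | _, .const b rest, x => rest.eval (fun v => v.elim b x)
  | _, .nand u v rest, x => rest.eval (fun w => w.elim (!(x u && x v)) x)

/-- The number of gates. -/
def Circuit.size {W : Type} : {V : Type} → Circuit W V → ℕ
  | _, .out _ => 0
  | _, .const _ rest => rest.size + 1
  | _, .nand _ _ rest => rest.size + 1

/-- `f` is computed, on encodings, by a circuit with at most `s` gates. -/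
def ComputableInSize {α β : Type} [BitCode α] [BitCode β] (f : α → β) (s : ℕ) : Prop :=
  ∃ C : Circuit (BitCode.Wire β) (BitCode.Wire α),
    C.size ≤ s ∧ ∀ a, C.eval (BitCode.bits a) = BitCode.bits (f a)

/-- Bounded by a polynomial in the security parameter. -/
def PolyBounded (s : ℕ → ℕ) : Prop := ∃ p : Polynomial ℕ, ∀ n, s n ≤ p.eval n

/-- The elements of the types `α n` have encodings of polynomial length. -/
def PolyLength (α : ℕ → Type) [∀ n, BitCode (α n)] : Prop :=
  PolyBounded fun n => Fintype.card (BitCode.Wire (α n))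

/-- Non-uniform deterministic polynomial time: polynomial-size circuit families. -/
def PolyTime {α β : ℕ → Type} [∀ n, BitCode (α n)] [∀ n, BitCode (β n)]
    (f : ∀ n, α n → β n) : Prop :=
  ∃ p : Polynomial ℕ, ∀ n, ComputableInSize (f n) (p.eval n)

/-- Non-uniform probabilistic polynomial time: polynomial-size circuit families that receive
polynomially many uniformly random bits besides their input. -/
def PPT {α β : ℕ → Type} [∀ n, BitCode (α n)] [∀ n, BitCode (β n)]
    (f : ∀ n, α n → PMF (β n)) : Prop :=
  ∃ p : Polynomial ℕ, ∀ n, ∃ (r : ℕ) (g : α n × Bits r → β n),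
    r ≤ p.eval n ∧ ComputableInSize g (p.eval n) ∧
      ∀ a, f n a = (PMF.uniformOfFintype (Bits r)).map fun ω => g (a, ω)

/-- A probabilistic polynomial time algorithm with no input besides the security parameter. -/
def PPTSampler {β : ℕ → Type} [∀ n, BitCode (β n)] (f : ∀ n, PMF (β n)) : Prop :=
  PPT (α := fun _ => Fin 0 → Bool) fun n _ => f n

/-- Negligible functions of the security parameter. -/
def Negligible (f : ℕ → ℝ) : Prop :=
  Asymptotics.SuperpolynomialDecay Filter.atTop (fun n : ℕ => (n : ℝ)) f

/-- The probability that an experiment returns `true`. -/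
def prTrue (p : PMF Bool) : ℝ := (p true).toReal

/-- Computational indistinguishability of two ensembles, against non-uniform PPT
distinguishers. -/
def CompIndist {α : ℕ → Type} [∀ n, BitCode (α n)] (p q : ∀ n, PMF (α n)) : Prop :=
  ∀ D : ∀ n, α n → PMF Bool, PPT D →
    Negligible fun n => |prTrue ((p n).bind (D n)) - prTrue ((q n).bind (D n))|

/-- Independent samples, the `i`-th one from `p i`. -/
def indep {α : Type} : {k : ℕ} → (Fin k → PMF α) → PMF (Fin k → α)
  | 0, _ => PMF.pure Fin.elim0
  | _ + 1, p => (p 0).bind fun a => (indep fun i => p i.succ).map fun f => Fin.cons a f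

/-! ## Commitments -/

/-- A non-interactive commitment scheme with message space `{0,1}^ℓ(n)` and coins `{0,1}^n`,
where `n` is the security parameter. -/
structure CommitmentScheme where
  msgLen : ℕ → ℕ
  comLen : ℕ → ℕ
  msgLen_poly : PolyBounded msgLen
  comLen_poly : PolyBounded comLen
  commit : ∀ n, Bits (msgLen n) → Bits n → Bits (comLen n)
  commit_poly : PolyTime (α := fun n => Bits (msgLen n) × Bits n) (β := fun n => Bits (comLen n))
    fun n x => commit n x.1 x.2

def CommitmentScheme.PerfectlyBinding (cs : CommitmentScheme) : Prop :=
  ∀ n (X X' : Bits (cs.msgLen n)) (r r' : Bits n), X ≠ X' → cs.commit n X r ≠ cs.commit n X' r'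

def CommitmentScheme.ComputationallyHiding (cs : CommitmentScheme) : Prop :=
  ∀ X X' : ∀ n, Bits (cs.msgLen n),
    CompIndist (α := fun n => Bits (cs.comLen n))
      (fun n => (PMF.uniformOfFintype (Bits n)).map (cs.commit n (X n)))
      (fun n => (PMF.uniformOfFintype (Bits n)).map (cs.commit n (X' n)))

/-! ## Shamir secret sharing

`pt j` is the (nonzero) evaluation point of the `j`-th share. -/

section Shamir

variable {F : Type} [Field F] {m : ℕ}

/-- The `t`-out-of-`m` sharing of `s`: the values at the points `pt j` of the polynomial
`s + a 0 * x + ⋯ + a (t-2) * x ^ (t-1)` with uniformly random coefficients. -/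
def share [Fintype F] (t : ℕ) (pt : Fin m → F) (s : F) : PMF (Fin m → F) :=
  (PMF.uniformOfFintype (Fin (t - 1) → F)).map fun a j =>
    s + ∑ k : Fin (t - 1), a k * pt j ^ (k.val + 1)

/-- `X` is a valid `t`-out-of-`m` sharing of `s`. -/
def IsSharing (t : ℕ) (pt : Fin m → F) (s : F) (X : Fin m → F) : Prop :=
  ∃ p : Polynomial F, p.degree < t ∧ p.eval 0 = s ∧ ∀ j, p.eval (pt j) = X j

/-- Reconstruction from the shares with index in `I`, by interpolation; it fails if there are
fewer than `t` shares or if they lie on no polynomial of degree less than `t`. -/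
def reconstruct (t : ℕ) (pt : Fin m → F) (I : Finset (Fin m)) (X : Fin m → F) : Option F :=
  if t ≤ I.card ∧ (Lagrange.interpolate I pt X).degree < t then
    some ((Lagrange.interpolate I pt X).eval 0)
  else none

end Shamir

/-! ## Multi-CRS non-interactive zero-knowledge proofs -/

/-- The algorithms of a multi-CRS NIZK with `m` contributors: CRS generation `K`, prover `P`,
verifier `V`, simulated CRS generation `simK` (with trapdoor) and simulated prover `simP`, which
gets the trapdoors of those CRSes whose trapdoor is known. -/
structure NIZK (m : ℕ) (Stmt Wit : ℕ → Type) [∀ n, BitCode (Stmt n)] [∀ n, BitCode (Wit n)] where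
  crsLen : ℕ → ℕ
  proofLen : ℕ → ℕ
  trapLen : ℕ → ℕ
  crsLen_poly : PolyBounded crsLen
  proofLen_poly : PolyBounded proofLen
  trapLen_poly : PolyBounded trapLen
  K : ∀ n, PMF (Bits (crsLen n))
  P : ∀ n, (Fin m → Bits (crsLen n)) × Stmt n × Wit n → PMF (Bits (proofLen n))
  V : ∀ n, (Fin m → Bits (crsLen n)) × Stmt n × Bits (proofLen n) → Bool
  simK : ∀ n, PMF (Bits (crsLen n) × Bits (trapLen n))
  simP : ∀ n, (Fin m → Bits (crsLen n)) × (Fin m → Option (Bits (trapLen n))) × Stmt n →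
    PMF (Bits (proofLen n))
  K_ppt : PPTSampler K
  P_ppt : PPT P
  V_poly : PolyTime V
  simK_ppt : PPTSampler simK
  simP_ppt : PPT simP

/-- At least `⌊m/2⌋ + 1` of the entries of `crs` occur among the generated ones. -/
def MajorityGenerated {m q : ℕ} {C : Type} (gen : Fin q → C) (crs : Fin m → C) : Prop :=
  m / 2 + 1 ≤ (Finset.univ.filter fun j => ∃ k, gen k = crs j).card

/-- The vector of the keys that belong to those entries of `crs` that were generated. -/
def keysOf {m q : ℕ} {C T : Type} (gen : Fin q → C × T) (crs : Fin m → C) : Fin m → Option T :=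
  fun j => ((List.ofFn gen).find? fun g => decide (g.1 = crs j)).map Prod.snd

namespace NIZK

variable {m : ℕ} {Stmt Wit : ℕ → Type} [∀ n, BitCode (Stmt n)] [∀ n, BitCode (Wit n)]

abbrev CRS (Z : NIZK m Stmt Wit) (n : ℕ) : Type := Bits (Z.crsLen n)
abbrev Proof (Z : NIZK m Stmt Wit) (n : ℕ) : Type := Bits (Z.proofLen n)
abbrev Trap (Z : NIZK m Stmt Wit) (n : ℕ) : Type := Bits (Z.trapLen n)

/-- Perfect completeness with an honest majority: honest proofs are accepted as soon as at least
`⌊m/2⌋ + 1` of the CRSes lie in the support of `K`. -/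
def Complete (Z : NIZK m Stmt Wit) (R : ∀ n, Stmt n → Wit n → Prop) : Prop :=
  ∀ n (crs : Fin m → Z.CRS n),
    m / 2 + 1 ≤ (Finset.univ.filter fun j => crs j ∈ (Z.K n).support).card →
    ∀ x w, R n x w → ∀ π ∈ (Z.P n (crs, x, w)).support, Z.V n (crs, x, π) = true

/-- A non-uniform PPT adversary against zero knowledge. As the oracle for simulated CRSes takes no
input, the answers to its `queries n` calls, trapdoors included, are handed over at once. -/
structure ZKAdversary (Z : NIZK m Stmt Wit) where
  State : ℕ → Type
  [code : ∀ n, BitCode (State n)]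
  state_poly : PolyLength State
  queries : ℕ → ℕ
  queries_poly : PolyBounded queries
  choose : ∀ n, (Fin (queries n) → Z.CRS n × Z.Trap n) →
    PMF ((Fin m → Z.CRS n) × Stmt n × Wit n × State n)
  guess : ∀ n, State n × Z.Proof n → PMF Bool
  choose_ppt : PPT choose
  guess_ppt : PPT guess

/-- Whatever it receives, the adversary outputs a CRS vector the majority of which was generated
by the oracle. -/
def ZKAdversary.MinorityConstrained {Z : NIZK m Stmt Wit} (A : Z.ZKAdversary) : Prop :=
  ∀ n gen, ∀ o ∈ (A.choose n gen).support, MajorityGenerated (fun k => (gen k).1) o.1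

/-- The zero-knowledge experiment, with a real or a simulated proof. It returns `true` when the
adversary outputs 1 and its statement and witness are in the relation. -/
def zkGame (Z : NIZK m Stmt Wit) (R : ∀ n, Stmt n → Wit n → Prop) (A : Z.ZKAdversary)
    (simulated : Bool) (n : ℕ) : PMF Bool := do
  let gen ← indep fun _ : Fin (A.queries n) => Z.simK n
  let (crs, x, w, st) ← A.choose n gen
  let π ← if simulated then Z.simP n (crs, keysOf gen crs, x) else Z.P n (crs, x, w)
  let g ← A.guess n (st, π)
  return g && decide (R n x w)

def ZeroKnowledge (Z : NIZK m Stmt Wit) (R : ∀ n, Stmt n → Wit n → Prop) : Prop :=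
  CompIndist (α := Z.CRS) Z.K (fun n => (Z.simK n).map Prod.fst) ∧
  ∀ A : Z.ZKAdversary, A.MinorityConstrained →
    Negligible fun n => |prTrue (Z.zkGame R A false n) - prTrue (Z.zkGame R A true n)|

/-- A non-uniform PPT adversary against simulation sound extractability. It gets generated CRSes
with extraction keys, fixes a CRS vector, asks adaptively for `proofs n` simulated proofs, and
finally outputs a statement and a proof. -/
structure SSEAdversary (Z : NIZK m Stmt Wit) (ekLen : ℕ → ℕ) where
  State : ℕ → Type
  [code : ∀ n, BitCode (State n)]
  state_poly : PolyLength State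
  queries : ℕ → ℕ
  queries_poly : PolyBounded queries
  proofs : ℕ → ℕ
  proofs_poly : PolyBounded proofs
  choose : ∀ n, (Fin (queries n) → Z.CRS n × Bits (ekLen n)) → PMF ((Fin m → Z.CRS n) × State n)
  ask : ∀ n, State n → PMF (Stmt n × State n)
  receive : ∀ n, State n × Z.Proof n → PMF (State n)
  finish : ∀ n, State n → PMF (Stmt n × Z.Proof n)
  choose_ppt : PPT choose
  ask_ppt : PPT ask
  receive_ppt : PPT receive
  finish_ppt : PPT finish

def SSEAdversary.MinorityConstrained {Z : NIZK m Stmt Wit} {ekLen : ℕ → ℕ}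
    (A : Z.SSEAdversary ekLen) : Prop :=
  ∀ n gen, ∀ o ∈ (A.choose n gen).support, MajorityGenerated (fun k => (gen k).1) o.1

/-- `k` calls of the adversary to the simulated prover; the pairs of statements and proofs are
recorded. -/
def proveLoop (Z : NIZK m Stmt Wit) {ekLen : ℕ → ℕ} (A : Z.SSEAdversary ekLen) (n : ℕ)
    (crs : Fin m → Z.CRS n) (trap : Fin m → Option (Z.Trap n)) :
    ℕ → A.State n → List (Stmt n × Z.Proof n) → PMF (A.State n × List (Stmt n × Z.Proof n))
  | 0, st, log => PMF.pure (st, log)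
  | k + 1, st, log => do
    let (x, st) ← A.ask n st
    let π ← Z.simP n (crs, trap, x)
    let st ← A.receive n (st, π)
    proveLoop Z A n crs trap k st ((x, π) :: log)

/-- The extraction experiment; `true` means that the adversary wins: its fresh proof is accepted,
but the extractor fails to find a witness. -/
def sseGame (Z : NIZK m Stmt Wit) (R : ∀ n, Stmt n → Wit n → Prop) {ekLen : ℕ → ℕ}
    (K₀ : ∀ n, PMF (Z.CRS n × Z.Trap n × Bits (ekLen n)))
    (E : ∀ n, (Fin m → Z.CRS n) × (Fin m → Option (Bits (ekLen n))) × Stmt n × Z.Proof n →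
      PMF (Wit n))
    (A : Z.SSEAdversary ekLen) (n : ℕ) : PMF Bool := do
  let gen ← indep fun _ : Fin (A.queries n) => K₀ n
  let (crs, st) ← A.choose n fun k => ((gen k).1, (gen k).2.2)
  let trap := keysOf (fun k => ((gen k).1, (gen k).2.1)) crs
  let ek := keysOf (fun k => ((gen k).1, (gen k).2.2)) crs
  let (st, log) ← Z.proveLoop A n crs trap (A.proofs n) st []
  let (x, π) ← A.finish n st
  let w ← E n (crs, ek, x, π)
  return decide ((x, π) ∉ log ∧ ¬ R n x w ∧ Z.V n (crs, x, π) = true)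

def SimulationSoundExtractable (Z : NIZK m Stmt Wit) (R : ∀ n, Stmt n → Wit n → Prop) : Prop :=
  ∃ (ekLen : ℕ → ℕ) (K₀ : ∀ n, PMF (Z.CRS n × Z.Trap n × Bits (ekLen n)))
    (E : ∀ n, (Fin m → Z.CRS n) × (Fin m → Option (Bits (ekLen n))) × Stmt n × Z.Proof n →
      PMF (Wit n)),
    PolyBounded ekLen ∧ PPTSampler K₀ ∧ PPT E ∧
    (∀ n, (K₀ n).map (fun s => (s.1, s.2.1)) = Z.simK n) ∧
    ∀ A : Z.SSEAdversary ekLen, A.MinorityConstrained →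
      Negligible fun n => prTrue (Z.sseGame R K₀ E A n)

end NIZK

attribute [instance] NIZK.ZKAdversary.code NIZK.SSEAdversary.code

/-! ## Transaction fee mechanisms -/

/-- The result of an auction with `N` bids: which bids are confirmed, the payments, and the total
miner revenue; amounts are binary strings of length `v`. -/
abbrev Outcome (N v : ℕ) : Type := (Fin N → Bool) × (Fin N → Bits v) × Bits v

/-- A randomized polynomial-time transaction fee mechanism: the joint law of the outputs of the
allocation, payment and miner revenue rules; unconfirmed bids pay 0. -/
structure Mechanism (F : Type) [BitCode F] (N : ℕ) where
  amountLen : ℕ → ℕ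
  amountLen_poly : PolyBounded amountLen
  rule : ∀ n, (Fin N → F) → PMF (Outcome N (amountLen n))
  rule_ppt : PPT (α := fun _ => Fin N → F) rule
  unconfirmed_pay_zero : ∀ n b, ∀ o ∈ (rule n b).support, ∀ i, o.1 i = false →
    o.2.1 i = zeroBits (amountLen n)

/-! ## The protocol -/

/-- The reconstruction threshold `⌈m/2⌉`. -/
def threshold (m : ℕ) : ℕ := (m + 1) / 2

/-- An opening of a committed share: the share and the coins of the commitment. -/
abbrev Opening (F : Type) (n : ℕ) : Type := F × Bits n

/-- What an identity proves: its name and the commitments to its shares. -/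
abbrev ShareStmt (N m : ℕ) (cs : CommitmentScheme) (n : ℕ) : Type :=
  Fin N × (Fin m → Bits (cs.comLen n))

/-- The witness: the bid, and the openings of the commitments. -/
abbrev ShareWit (F : Type) (m n : ℕ) : Type := F × (Fin m → Opening F n)

/-- The building blocks of the protocol for `m` miners and `N` identities with bids in `F`. Shares
are written as bit strings by `enc` before they are committed to. -/
structure Protocol (F : Type) [Field F] [BitCode F] (m N : ℕ) where
  cs : CommitmentScheme
  enc : ∀ n, F → Bits (cs.msgLen n)
  enc_injective : ∀ n, Function.Injective (enc n)
  pt : Fin m → F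
  pt_injective : Function.Injective pt
  pt_ne_zero : ∀ j, pt j ≠ 0
  nizk : NIZK m (ShareStmt N m cs) (ShareWit F m)
  mech : Mechanism F N

/-- Only the entries with index in `S`. -/
def restrict {ι α : Type} (S : Finset ι) (f : ι → α) : ι → Option α :=
  fun i => if i ∈ S then some (f i) else none

/-- The value announced by more than half of the miners, if there is one. -/
def majorityValue {m : ℕ} {α : Type} (a : Fin m → Option α) : Option α :=
  if h : ∃ v, m < 2 * (Finset.univ.filter fun j => a j = some v).card then some h.choose else none

namespace Protocol

variable {F : Type} [Field F] [BitCode F] {m N : ℕ}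

abbrev CRS (T : Protocol F m N) (n : ℕ) : Type := T.nizk.CRS n
abbrev Com (T : Protocol F m N) (n : ℕ) : Type := Bits (T.cs.comLen n)
abbrev Proof (T : Protocol F m N) (n : ℕ) : Type := T.nizk.Proof n
abbrev Out (T : Protocol F m N) (n : ℕ) : Type := Outcome N (T.mech.amountLen n)

/-- The commitment with the given opening. -/
def commitTo (T : Protocol F m N) (n : ℕ) (o : Opening F n) : T.Com n :=
  T.cs.commit n (T.enc n o.1) o.2

/-- The relation of the proofs: the openings are correct, and the shares form a valid sharing of
the bid. -/
def Rel (T : Protocol F m N) (n : ℕ) (x : ShareStmt N m T.cs n) (w : ShareWit F m n) : Prop :=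
  (∀ j, T.commitTo n (w.2 j) = x.2 j) ∧
    IsSharing (threshold m) T.pt w.1 fun j => (w.2 j).1

/-- `o` is a correct opening of the `j`-th of the broadcast commitments `c`. -/
def Opens (T : Protocol F m N) {n : ℕ} (c : Option (Fin m → T.Com n)) (j : Fin m)
    (o : Option (Opening F n)) : Prop :=
  ∃ c' o', c = some c' ∧ o = some o' ∧ T.commitTo n o' = c' j

/-- The ideal functionality that the protocol realizes. -/
def FMPC (T : Protocol F m N) (n : ℕ) (b : Fin N → F) : PMF (T.Out n) := T.mech.rule n b

/-- The bid of one identity that the hybrid functionality reconstructs from the correct ones among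
the openings `inp j` sent by the miners `j`. -/
def reconstructBid (T : Protocol F m N) (n : ℕ) (c : Option (Fin m → T.Com n))
    (inp : Fin m → Option (Opening F n)) : F :=
  (reconstruct (threshold m) T.pt (Finset.univ.filter fun j => T.Opens c j (inp j))
    (fun j => (inp j).elim 0 Prod.fst)).getD 0

/-- The hybrid functionality with the set `bad` of excluded identities and the commitments `com`;
`inp j i` is the opening that miner `j` sends for identity `i`. -/
def FTFM (T : Protocol F m N) (n : ℕ) (bad : Finset (Fin N))
    (com : Fin N → Option (Fin m → T.Com n)) (inp : Fin m → Fin N → Option (Opening F n)) :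
    PMF (T.Out n) :=
  T.mech.rule n fun i => if i ∈ bad then 0 else T.reconstructBid n (com i) fun j => inp j i

/-! ### The adversary

The view grows round by round: auxiliary input and random coins, then the honest parties' messages
of each round that are broadcast or sent to corrupted parties. Because the adversary is rushing,
its messages of a round are computed from a view that contains the honest messages of that round. -/

abbrev View₀ (_T : Protocol F m N) (aux coins : ℕ → ℕ) (n : ℕ) : Type :=
  Bits (aux n) × Bits (coins n)

/-- adds the CRSes of the honest miners -/
abbrev View₁ (T : Protocol F m N) (aux coins : ℕ → ℕ) (n : ℕ) : Type :=
  T.View₀ aux coins n × (Fin m → Option (T.CRS n))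

/-- adds the commitments of the honest identities -/
abbrev View₂ (T : Protocol F m N) (aux coins : ℕ → ℕ) (n : ℕ) : Type :=
  T.View₁ aux coins n × (Fin N → Option (Fin m → T.Com n))

/-- adds the proofs of the honest identities -/
abbrev View₃ (T : Protocol F m N) (aux coins : ℕ → ℕ) (n : ℕ) : Type :=
  T.View₂ aux coins n × (Fin N → Option (T.Proof n))

/-- adds the openings sent by honest identities to corrupted miners -/
abbrev View₄ (T : Protocol F m N) (aux coins : ℕ → ℕ) (n : ℕ) : Type :=
  T.View₃ aux coins n × (Fin N → Fin m → Option (Opening F n))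

/-- adds the votes of the honest miners on the identities -/
abbrev View₅ (T : Protocol F m N) (aux coins : ℕ → ℕ) (n : ℕ) : Type :=
  T.View₄ aux coins n × (Fin m → Fin N → Option Bool)

/-- adds the openings broadcast by honest identities in reply to complaints -/
abbrev View₆ (T : Protocol F m N) (aux coins : ℕ → ℕ) (n : ℕ) : Type :=
  T.View₅ aux coins n × (Fin N → Fin m → Option (Opening F n))

/-- adds the outcome, which the hybrid functionality sends to the miners -/
abbrev View (T : Protocol F m N) (aux coins : ℕ → ℕ) (n : ℕ) : Type :=
  T.View₆ aux coins n × T.Out n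

/-- A non-uniform PPT adversary in the hybrid model, with auxiliary input of length `aux n`. In
each round it chooses the messages of all corrupted parties (entries that belong to honest parties
are ignored); `none` stands for a party that sends nothing valid. -/
structure Adversary (T : Protocol F m N) (aux : ℕ → ℕ) where
  coins : ℕ → ℕ
  coins_poly : PolyBounded coins
  crs : ∀ n, T.View₁ aux coins n → (Fin m → Option (T.CRS n))
  com : ∀ n, T.View₂ aux coins n → (Fin N → Option (Fin m → T.Com n))
  proof : ∀ n, T.View₃ aux coins n → (Fin N → Option (T.Proof n))
  opening : ∀ n, T.View₄ aux coins n → (Fin N → Fin m → Option (Opening F n))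
  vote : ∀ n, T.View₅ aux coins n → (Fin m → Fin N → Option Bool)
  reply : ∀ n, T.View₆ aux coins n → (Fin N → Fin m → Option (Opening F n))
  input : ∀ n, T.View₆ aux coins n → (Fin m → Fin N → Option (Opening F n))
  announce : ∀ n, T.View aux coins n → (Fin m → Option (T.Out n))
  crs_poly : PolyTime crs
  com_poly : PolyTime com
  proof_poly : PolyTime proof
  opening_poly : PolyTime opening
  vote_poly : PolyTime vote
  reply_poly : PolyTime reply
  input_poly : PolyTime input
  announce_poly : PolyTime announce

/-- The outputs of the honest miners and of the honest identities. -/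
abbrev HonestOut (T : Protocol F m N) (n : ℕ) : Type :=
  (Fin m → Option (Option (T.Out n))) × (Fin N → Option (Option (T.Out n)))

/-- The execution of the protocol with corrupted miners `Km` and corrupted identities `Ki`, honest
bids `b` and auxiliary input `z`: the joint law of the honest parties' outputs and of the
adversary's view. (Sampled values that belong to corrupted parties are never used.) -/
def real [Fintype F] (T : Protocol F m N) (Km : Finset (Fin m)) (Ki : Finset (Fin N))
    {aux : ℕ → ℕ} (A : T.Adversary aux) (n : ℕ) (b : Fin N → F) (z : Bits (aux n)) :
    PMF (T.HonestOut n × T.View aux A.coins n) := do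
  let ω ← PMF.uniformOfFintype (Bits (A.coins n))
  let v₀ : T.View₀ aux A.coins n := (z, ω)
  -- the miners broadcast CRSes; a missing one is replaced by 0
  let hcrs ← indep fun _ : Fin m => T.nizk.K n
  let v₁ : T.View₁ aux A.coins n := (v₀, restrict Kmᶜ hcrs)
  let crs : Fin m → T.CRS n := fun j =>
    if j ∈ Km then (A.crs n v₁ j).getD (zeroBits _) else hcrs j
  -- the identities share their bids and broadcast commitments to the shares
  let shares ← indep fun i : Fin N => share (threshold m) T.pt (b i)
  let r ← PMF.uniformOfFintype (Fin N → Fin m → Bits n)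
  let hop : Fin N → Fin m → Opening F n := fun i j => (shares i j, r i j)
  let hcom : Fin N → Fin m → T.Com n := fun i j => T.commitTo n (hop i j)
  let v₂ : T.View₂ aux A.coins n := (v₁, restrict Kiᶜ hcom)
  let com : Fin N → Option (Fin m → T.Com n) := fun i =>
    if i ∈ Ki then A.com n v₂ i else some (hcom i)
  -- the identities broadcast proofs
  let hproof ← indep fun i : Fin N => T.nizk.P n (crs, (i, hcom i), (b i, hop i))
  let v₃ : T.View₃ aux A.coins n := (v₂, restrict Kiᶜ hproof)
  let proof : Fin N → Option (T.Proof n) := fun i =>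
    if i ∈ Ki then A.proof n v₃ i else some (hproof i)
  -- identities without commitments or without an accepted proof are excluded
  let bad₁ : Finset (Fin N) := Finset.univ.filter fun i =>
    ¬ ∃ c π, com i = some c ∧ proof i = some π ∧ T.nizk.V n (crs, (i, c), π) = true
  -- the identities send the openings to the miners
  let v₄ : T.View₄ aux A.coins n :=
    (v₃, fun i j => if i ∉ Ki ∧ j ∈ Km then some (hop i j) else none)
  let opening : Fin N → Fin m → Option (Opening F n) := fun i j =>
    if i ∈ Ki then A.opening n v₄ i j else some (hop i j)
  -- the miners broadcast votes on the identities: `some true` is a complaint, `some false` is ok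
  let hvote : Fin m → Fin N → Option Bool := fun j i =>
    if i ∈ bad₁ then none else some (decide (¬ T.Opens (com i) j (opening i j)))
  let v₅ : T.View₅ aux A.coins n := (v₄, fun j i => if j ∈ Km then none else hvote j i)
  let vote : Fin m → Fin N → Option Bool := fun j i =>
    if j ∈ Km then A.vote n v₅ j i else hvote j i
  -- the identities reply to complaints by broadcasting the openings in question
  let hreply : Fin N → Fin m → Option (Opening F n) := fun i j =>
    if vote j i = some true then some (hop i j) else none
  let v₆ : T.View₆ aux A.coins n := (v₅, fun i j => if i ∈ Ki then none else hreply i j)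
  let reply : Fin N → Fin m → Option (Opening F n) := fun i j =>
    if i ∈ Ki then A.reply n v₆ i j else hreply i j
  -- identities that did not answer a complaint correctly are excluded
  let bad₂ : Finset (Fin N) := bad₁ ∪ Finset.univ.filter fun i =>
    ∃ j, vote j i = some true ∧ ¬ T.Opens (com i) j (reply i j)
  -- the miners send the correct openings that they recorded to the hybrid functionality
  let input : Fin m → Fin N → Option (Opening F n) := fun j i =>
    if j ∈ Km then A.input n v₆ j i
    else if T.Opens (com i) j (opening i j) then opening i j
    else if T.Opens (com i) j (reply i j) then reply i j
    else none
  let out ← T.FTFM n bad₂ com input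
  -- the miners output the outcome and announce it; the identities output the majority value
  let v : T.View aux A.coins n := (v₆, out)
  let ann : Fin m → Option (T.Out n) := fun j => if j ∈ Km then A.announce n v j else some out
  return ((restrict Kmᶜ fun _ => some out, restrict Kiᶜ fun _ => majorityValue ann), v)

/-! ### The ideal world -/

/-- A non-uniform PPT ideal-world adversary: it chooses the bids of the corrupted identities, then
receives the outcome and outputs a view. -/
structure Simulator (T : Protocol F m N) (aux coins : ℕ → ℕ) where
  State : ℕ → Type
  [code : ∀ n, BitCode (State n)]
  state_poly : PolyLength State
  bids : ∀ n, Bits (aux n) → PMF ((Fin N → F) × State n)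
  view : ∀ n, State n × T.Out n → PMF (T.View aux coins n)
  bids_ppt : PPT bids
  view_ppt : PPT view

attribute [instance] Simulator.code

/-- The ideal execution: the functionality gets the bids of the honest identities and those that
the simulator chose for the corrupted ones, and sends the outcome to everyone. -/
def ideal (T : Protocol F m N) (Km : Finset (Fin m)) (Ki : Finset (Fin N))
    {aux coins : ℕ → ℕ} (S : T.Simulator aux coins) (n : ℕ) (b : Fin N → F) (z : Bits (aux n)) :
    PMF (T.HonestOut n × T.View aux coins n) := do
  let (c, st) ← S.bids n z
  let out ← T.FMPC n fun i => if i ∈ Ki then c i else b i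
  let v ← S.view n (st, out)
  return ((restrict Kmᶜ fun _ => some out, restrict Kiᶜ fun _ => some out), v)

/-- The protocol, in the hybrid model, securely realizes the ideal functionality against the static
malicious corruption of the miners `Km` and the identities `Ki`. -/
def SecurelyRealizes [Fintype F] (T : Protocol F m N) (Km : Finset (Fin m)) (Ki : Finset (Fin N)) :
    Prop :=
  ∀ aux : ℕ → ℕ, PolyBounded aux → ∀ A : T.Adversary aux, ∃ S : T.Simulator aux A.coins,
    ∀ (b : ℕ → Fin N → F) (z : ∀ n, Bits (aux n)),
      CompIndist (α := fun n => T.HonestOut n × T.View aux A.coins n)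
        (fun n => T.real Km Ki A n (b n) (z n)) (fun n => T.ideal Km Ki S n (b n) (z n))

end Protocol

end MPCAuction

end

/-!
The proof is a chain of hybrids between the protocol and the ideal world.

* By completeness and the honest majority, honest identities are never excluded, so the experiments
  need not verify their proofs.
* The reference strings of the honest miners are replaced by simulated ones, and then the proofs of
  the honest identities by simulated ones, one identity at a time.
* If a corrupted identity is not excluded, every honest miner has a correct opening of its
  commitment. If a valid witness is extracted from its proof, then by perfect binding these openings
  are shares of the extracted bid, and since at least `threshold m` miners are honest,
  reconstruction returns this bid. As the statement of a corrupted identity carries its own name, it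
  differs from the statements with simulated proofs; so by simulation sound extractability,
  extraction fails with negligible probability only.
* The commitments to the shares of honest miners are never opened, so by hiding they may be replaced
  by commitments to `0`. Then the experiment depends on the bids of the honest identities only
  through the shares of the corrupted miners. These are fewer than `threshold m` and hence
  distributed like shares of `0`.
-/

noncomputable section

namespace MPCAuction

open scoped Classical

/-! ### Circuit size -/

/-- The circuit `C` reading its inputs through the renaming `f` of wires. -/
def Circuit.rename {W : Type} : {V V' : Type} → (V → V') → Circuit W V → Circuit W V'
  | _, _, f, .out o => .out (f ∘ o)
  | _, _, f, .const b rest => .const b (rest.rename (Option.map f))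
  | _, _, f, .nand u v rest => .nand (f u) (f v) (rest.rename (Option.map f))

theorem Circuit.size_rename {W V : Type} (C : Circuit W V) :
    ∀ {V' : Type} (f : V → V'), (C.rename f).size = C.size := by
  induction C with
  | out o => exact fun _ => rfl
  | const _ rest ih => exact fun f => congrArg (· + 1) (ih (Option.map f))
  | nand _ _ rest ih => exact fun f => congrArg (· + 1) (ih (Option.map f))

theorem Circuit.eval_rename {W V : Type} (C : Circuit W V) :
    ∀ {V' : Type} (f : V → V') (x : V' → Bool), (C.rename f).eval x = C.eval (x ∘ f) := by
  induction C with
  | out o => exact fun _ _ => rfl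
  | const b rest ih =>
    intro V' f x
    simp only [rename, eval, ih]
    exact congrArg rest.eval (funext fun v => by cases v <;> rfl)
  | nand u v rest ih =>
    intro V' f x
    simp only [rename, eval, ih]
    exact congrArg rest.eval (funext fun v => by cases v <;> rfl)

/-- `g` is computed by a circuit with at most `s` gates. In contrast to `ComputableInSize`, inputs
and outputs are wire assignments, not elements of encoded types. -/
def HasCircuit {V W : Type} (g : (V → Bool) → W → Bool) (s : ℕ) : Prop :=
  ∃ C : Circuit W V, C.size ≤ s ∧ C.eval = g

/-- `p` is computed by a circuit with a single output wire and at most `s` gates. -/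
abbrev HasBitCircuit {V : Type} (p : (V → Bool) → Bool) (s : ℕ) : Prop :=
  HasCircuit (fun x (_ : Unit) => p x) s

namespace HasCircuit

variable {V W W' U : Type} {s t : ℕ}

theorem mono {g : (V → Bool) → W → Bool} (h : HasCircuit g s) (hst : s ≤ t) : HasCircuit g t := by
  obtain ⟨C, hC, hg⟩ := h
  exact ⟨C, hC.trans hst, hg⟩

theorem of_eq {f g : (V → Bool) → W → Bool} (h : HasCircuit f s) (hfg : ∀ x w, f x w = g x w) :
    HasCircuit g s := by
  rwa [← show f = g from funext₂ hfg]

theorem wires (o : W → V) : HasCircuit (fun x w => x (o w)) 0 :=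
  ⟨.out o, le_rfl, rfl⟩

theorem comp {g : (W → Bool) → U → Bool} {f : (V → Bool) → W → Bool} (hg : HasCircuit g t)
    (hf : HasCircuit f s) : HasCircuit (fun x => g (f x)) (s + t) := by
  obtain ⟨C, hC, rfl⟩ := hf
  obtain ⟨D, hD, rfl⟩ := hg
  suffices h : HasCircuit (fun x => D.eval (C.eval x)) (C.size + D.size) from h.mono (by omega)
  clear hC hD
  induction C with
  | out o =>
    exact ⟨D.rename o, by simp [Circuit.size_rename, Circuit.size],
      funext fun x => D.eval_rename o x⟩
  | const b rest ih =>
    obtain ⟨E, hE, heval⟩ := ih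
    refine ⟨.const b E, by simp only [Circuit.size]; omega, ?_⟩
    simp only [Circuit.eval, heval]
  | nand u v rest ih =>
    obtain ⟨E, hE, heval⟩ := ih
    refine ⟨.nand u v E, by simp only [Circuit.size]; omega, ?_⟩
    simp only [Circuit.eval, heval]

theorem map_outputs {g : (V → Bool) → W → Bool} (hg : HasCircuit g s) (o : U → W) :
    HasCircuit (fun x u => g x (o u)) s :=
  (wires o).comp hg

theorem map_inputs {g : (V → Bool) → W → Bool} (hg : HasCircuit g s) (o : V → U) :
    HasCircuit (fun x => g (x ∘ o)) s :=
  (hg.comp (wires o)).mono (by omega)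

theorem sumElim_input {g : (V → Bool) → W → Bool} (hg : HasCircuit g s) :
    HasCircuit (fun x => Sum.elim (g x) x) s := by
  obtain ⟨C, hC, rfl⟩ := hg
  refine mono (s := C.size) ?_ hC
  clear hC
  induction C with
  | out o => exact ⟨.out (Sum.elim o id), le_rfl, funext₂ fun x w => by cases w <;> rfl⟩
  | @const V b rest ih =>
    obtain ⟨E, hE, heval⟩ := ih.map_outputs (Sum.map id some : W ⊕ V → W ⊕ Option V)
    refine ⟨.const b E, by simp only [Circuit.size]; omega, funext₂ fun x w => ?_⟩
    simp only [Circuit.eval, heval]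
    cases w <;> rfl
  | @nand V u v rest ih =>
    obtain ⟨E, hE, heval⟩ := ih.map_outputs (Sum.map id some : W ⊕ V → W ⊕ Option V)
    refine ⟨.nand u v E, by simp only [Circuit.size]; omega, funext₂ fun x w => ?_⟩
    simp only [Circuit.eval, heval]
    cases w <;> rfl

theorem sumElim {f : (V → Bool) → W → Bool} {g : (V → Bool) → W' → Bool} (hf : HasCircuit f s)
    (hg : HasCircuit g t) : HasCircuit (fun x => Sum.elim (f x) (g x)) (s + t) := by
  have h := ((hf.map_inputs Sum.inr).sumElim_input.map_outputs
    (Sum.elim Sum.inl fun w : W' => Sum.inr (Sum.inl w))).comp hg.sumElim_input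
  exact (h.of_eq fun x w => by cases w <;> rfl).mono (by omega)

theorem const (b : W → Bool) : HasCircuit (fun _ : V → Bool => b) 2 := by
  refine ⟨.const false (.const true (.out fun w => if b w then none else some none)), le_rfl,
    funext₂ fun x w => ?_⟩
  simp only [Circuit.eval]
  cases b w <;> rfl

theorem family_fin :
    ∀ {k : ℕ} {g : (V → Bool) → Fin k → Bool}, (∀ i, HasBitCircuit (g · i) s) →
      HasCircuit g (k * s)
  | 0, _, _ => ⟨.out Fin.elim0, by simp [Circuit.size], funext₂ fun _ i => i.elim0⟩
  | k + 1, g, hg => by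
    have h := ((hg 0).sumElim (family_fin fun i : Fin k => hg i.succ)).map_outputs
      (Fin.cases (Sum.inl ()) Sum.inr)
    refine (h.of_eq fun x i => ?_).mono (by ring_nf; omega)
    cases i using Fin.cases <;> rfl

theorem family [Fintype W] {g : (V → Bool) → W → Bool} (hg : ∀ w, HasBitCircuit (g · w) s) :
    HasCircuit g (Fintype.card W * s) :=
  ((family_fin fun i => hg ((Fintype.equivFin W).symm i)).map_outputs
    (Fintype.equivFin W)).of_eq fun x w => by simp

end HasCircuit

namespace HasBitCircuit

variable {V W : Type} {r s t : ℕ} {c p q : (V → Bool) → Bool}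

theorem wire (v : V) : HasBitCircuit (fun x => x v) 0 := HasCircuit.wires fun _ => v

theorem nand (hp : HasBitCircuit p s) (hq : HasBitCircuit q t) :
    HasBitCircuit (fun x => !(p x && q x)) (s + t + 1) := by
  have gate : HasBitCircuit (fun x : Unit ⊕ Unit → Bool => !(x (.inl ()) && x (.inr ()))) 1 :=
    ⟨.nand (.inl ()) (.inr ()) (.out fun _ => none), le_rfl, rfl⟩
  exact gate.comp (hp.sumElim hq)

theorem not (hp : HasBitCircuit p s) : HasBitCircuit (fun x => !p x) (s + 3) :=
  (hp.nand (HasCircuit.const fun _ => true)).of_eq fun x _ => by simp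

theorem and (hp : HasBitCircuit p s) (hq : HasBitCircuit q t) :
    HasBitCircuit (fun x => p x && q x) (s + t + 4) :=
  ((hp.nand hq).not.of_eq fun x _ => by simp).mono (by omega)

theorem ite (hc : HasBitCircuit c r) (hp : HasBitCircuit p s) (hq : HasBitCircuit q t) :
    HasBitCircuit (fun x => if c x then p x else q x) (2 * r + s + t + 6) := by
  have h := (hc.nand hp).nand (hc.not.nand hq)
  exact (h.of_eq fun x _ => by cases hx : c x <;> simp [hx]).mono (by omega)

theorem forall_fin : ∀ k : ℕ, HasBitCircuit (fun x : Fin k → Bool => ∀ i, x i) (4 * k + 2)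
  | 0 => (HasCircuit.const fun _ => true).of_eq fun x _ => by simp
  | k + 1 => by
    have h := (wire (0 : Fin (k + 1))).and ((forall_fin k).map_inputs Fin.succ)
    refine (h.of_eq fun x _ => ?_).mono (by omega)
    simp [Fin.forall_fin_succ, Function.comp_apply]

theorem forall_wire [Fintype W] {g : (V → Bool) → W → Bool} (hg : HasCircuit g s) :
    HasBitCircuit (fun x => ∀ w, g x w) (s + 4 * Fintype.card W + 2) := by
  have h := (forall_fin (Fintype.card W)).comp (hg.map_outputs (Fintype.equivFin W).symm)
  refine (h.of_eq fun x _ => ?_).mono (by omega)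
  exact decide_eq_decide.2
    ((Fintype.equivFin W).symm.forall_congr_right (q := fun w => g x w = true))

theorem exists_of_fin : ∀ {k : ℕ} (p : (Fin k → Bool) → Bool), ∃ s, HasBitCircuit p s
  | 0, p => ⟨2, (HasCircuit.const fun _ => p Fin.elim0).of_eq fun _ _ =>
      congrArg p (Subsingleton.elim _ _)⟩
  | k + 1, p => by
    -- Shannon expansion along the first input
    obtain ⟨s, hs⟩ := exists_of_fin fun x : Fin k → Bool => p (Fin.cons true x)
    obtain ⟨t, ht⟩ := exists_of_fin fun x : Fin k → Bool => p (Fin.cons false x)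
    refine ⟨_, ((wire 0).ite (hs.map_inputs Fin.succ) (ht.map_inputs Fin.succ)).of_eq
      fun x _ => ?_⟩
    have hx : Fin.cons (x 0) (x ∘ Fin.succ) = x := Fin.cons_self_tail x
    cases h0 : x 0 <;> rw [h0] at hx <;> simp [h0, hx]

theorem exists_of_finite [Finite V] (p : (V → Bool) → Bool) : ∃ s, HasBitCircuit p s := by
  obtain ⟨k, ⟨e⟩⟩ := Finite.exists_equiv_fin V
  obtain ⟨s, hs⟩ := exists_of_fin fun x : Fin k → Bool => p (x ∘ e)
  exact ⟨s, (hs.map_inputs e.symm).of_eq fun x _ => congrArg p (funext fun v => by simp)⟩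

end HasBitCircuit

namespace ComputableInSize

variable {α β γ : Type} [BitCode α] [BitCode β] [BitCode γ] {f : α → β} {s t : ℕ}

theorem iff_hasCircuit :
    ComputableInSize f s ↔ ∃ g : (BitCode.Wire α → Bool) → BitCode.Wire β → Bool,
      HasCircuit g s ∧ ∀ a, g (BitCode.bits a) = BitCode.bits (f a) := by
  constructor
  · rintro ⟨C, hC, hf⟩
    exact ⟨_, ⟨C, hC, rfl⟩, hf⟩
  · rintro ⟨_, ⟨C, hC, rfl⟩, hf⟩
    exact ⟨C, hC, hf⟩

theorem mono (h : ComputableInSize f s) (hst : s ≤ t) : ComputableInSize f t := by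
  obtain ⟨C, hC, hf⟩ := h
  exact ⟨C, hC.trans hst, hf⟩

theorem comp {g : β → γ} (hg : ComputableInSize g t) (hf : ComputableInSize f s) :
    ComputableInSize (fun a => g (f a)) (s + t) := by
  obtain ⟨f', hf', hf⟩ := iff_hasCircuit.1 hf
  obtain ⟨g', hg', hg⟩ := iff_hasCircuit.1 hg
  exact iff_hasCircuit.2 ⟨_, hg'.comp hf', fun a => by rw [hf, hg]⟩

theorem pair {g : α → γ} (hf : ComputableInSize f s) (hg : ComputableInSize g t) :
    ComputableInSize (fun a => (f a, g a)) (s + t) := by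
  obtain ⟨f', hf', hf⟩ := iff_hasCircuit.1 hf
  obtain ⟨g', hg', hg⟩ := iff_hasCircuit.1 hg
  exact iff_hasCircuit.2 ⟨_, hf'.sumElim hg', fun a => by rw [hf, hg]; rfl⟩

theorem of_wires (o : BitCode.Wire β → BitCode.Wire α)
    (h : ∀ a w, BitCode.bits (f a) w = BitCode.bits a (o w)) : ComputableInSize f 0 :=
  iff_hasCircuit.2 ⟨_, HasCircuit.wires o, fun a => funext fun w => (h a w).symm⟩

end ComputableInSize

theorem exists_hasBitCircuit_of_bits {α : Type} [BitCode α] (p : α → Bool) :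
    ∃ (g : (BitCode.Wire α → Bool) → Bool) (s : ℕ), HasBitCircuit g s ∧
      ∀ a, g (BitCode.bits a) = p a := by
  let g : (BitCode.Wire α → Bool) → Bool := Function.extend BitCode.bits p fun _ => false
  obtain ⟨s, hs⟩ := HasBitCircuit.exists_of_finite g
  exact ⟨g, s, hs, fun a => BitCode.bits_injective.extend_apply _ _ a⟩

theorem exists_size_forall_hasBitCircuit (α : Type) [BitCode α] [Finite α] :
    ∃ s, ∀ p : α → Bool, ∃ g : (BitCode.Wire α → Bool) → Bool,
      HasBitCircuit g s ∧ ∀ a, g (BitCode.bits a) = p a := by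
  choose g s hg hp using exists_hasBitCircuit_of_bits (α := α)
  have := Fintype.ofFinite α
  exact ⟨∑ p, s p, fun p => ⟨g p,
    (hg p).mono (Finset.single_le_sum (fun _ _ => Nat.zero_le _) (Finset.mem_univ p)), hp p⟩⟩

theorem ComputableInSize.exists_forall (α β : Type) [BitCode α] [Finite α] [BitCode β] :
    ∃ s, ∀ f : α → β, ComputableInSize f s := by
  obtain ⟨s, hs⟩ := exists_size_forall_hasBitCircuit α
  refine ⟨Fintype.card (BitCode.Wire β) * s, fun f => iff_hasCircuit.2 ?_⟩
  choose g hg hgf using fun w => hs fun a => BitCode.bits (f a) w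
  exact ⟨_, .family (g := fun x w => g w x) hg, fun a => funext fun w => hgf w a⟩

/-! ### Polynomial time -/

namespace PolyBounded

variable {f g : ℕ → ℕ}

theorem const (c : ℕ) : PolyBounded fun _ => c := ⟨Polynomial.C c, fun n => by simp⟩

theorem id : PolyBounded fun n => n := ⟨Polynomial.X, fun n => by simp⟩

theorem mono (hg : PolyBounded g) (h : ∀ n, f n ≤ g n) : PolyBounded f := by
  obtain ⟨p, hp⟩ := hg
  exact ⟨p, fun n => (h n).trans (hp n)⟩

theorem add (hf : PolyBounded f) (hg : PolyBounded g) : PolyBounded fun n => f n + g n := by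
  obtain ⟨p, hp⟩ := hf
  obtain ⟨q, hq⟩ := hg
  exact ⟨p + q, fun n => by simpa using add_le_add (hp n) (hq n)⟩

theorem mul (hf : PolyBounded f) (hg : PolyBounded g) : PolyBounded fun n => f n * g n := by
  obtain ⟨p, hp⟩ := hf
  obtain ⟨q, hq⟩ := hg
  exact ⟨p * q, fun n => by simpa using Nat.mul_le_mul (hp n) (hq n)⟩

end PolyBounded

namespace PolyLength

variable {α β : ℕ → Type} [∀ n, BitCode (α n)] [∀ n, BitCode (β n)]

theorem const (α : Type) [BitCode α] : PolyLength fun _ => α := PolyBounded.const _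

theorem bits {k : ℕ → ℕ} (hk : PolyBounded k) : PolyLength fun n => Bits (k n) :=
  hk.mono fun n => (show Fintype.card (Fin (k n) × Unit) = k n by simp).le

theorem prod (hα : PolyLength α) (hβ : PolyLength β) : PolyLength fun n => α n × β n :=
  (PolyBounded.add hα hβ).mono fun n =>
    (Fintype.card_sum (α := BitCode.Wire (α n)) (β := BitCode.Wire (β n))).le

theorem pi (k : ℕ) (hα : PolyLength α) : PolyLength fun n => Fin k → α n :=
  ((PolyBounded.const k).mul hα).mono fun n =>
    ((Fintype.card_prod (Fin k) (BitCode.Wire (α n))).trans (by simp)).le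

theorem option (hα : PolyLength α) : PolyLength fun n => Option (α n) :=
  (PolyBounded.add hα (PolyBounded.const 1)).mono fun n =>
    (Fintype.card_option (α := BitCode.Wire (α n))).le

end PolyLength

namespace PolyTime

variable {α β γ : ℕ → Type} [∀ n, BitCode (α n)] [∀ n, BitCode (β n)] [∀ n, BitCode (γ n)]

theorem iff_polyBounded {f : ∀ n, α n → β n} :
    PolyTime f ↔ ∃ s : ℕ → ℕ, PolyBounded s ∧ ∀ n, ComputableInSize (f n) (s n) := by
  constructor
  · rintro ⟨p, hp⟩
    exact ⟨fun n => p.eval n, ⟨p, fun n => le_rfl⟩, hp⟩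
  · rintro ⟨s, ⟨p, hp⟩, h⟩
    exact ⟨p, fun n => (h n).mono (hp n)⟩

theorem of_eq {f g : ∀ n, α n → β n} (hf : PolyTime f) (h : ∀ n a, f n a = g n a) :
    PolyTime g := by
  rwa [← show f = g from funext₂ h]

theorem comp {g : ∀ n, β n → γ n} {f : ∀ n, α n → β n} (hg : PolyTime g) (hf : PolyTime f) :
    PolyTime fun n a => g n (f n a) := by
  obtain ⟨s, hs, hgs⟩ := iff_polyBounded.1 hg
  obtain ⟨t, ht, hft⟩ := iff_polyBounded.1 hf
  exact iff_polyBounded.2 ⟨_, ht.add hs, fun n => (hgs n).comp (hft n)⟩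

theorem pair {f : ∀ n, α n → β n} {g : ∀ n, α n → γ n} (hf : PolyTime f) (hg : PolyTime g) :
    PolyTime fun n a => (f n a, g n a) := by
  obtain ⟨s, hs, hfs⟩ := iff_polyBounded.1 hf
  obtain ⟨t, ht, hgt⟩ := iff_polyBounded.1 hg
  exact iff_polyBounded.2 ⟨_, hs.add ht, fun n => (hfs n).pair (hgt n)⟩

theorem of_wires {f : ∀ n, α n → β n} (o : ∀ n, BitCode.Wire (β n) → BitCode.Wire (α n))
    (h : ∀ n a w, BitCode.bits (f n a) w = BitCode.bits a (o n w)) : PolyTime f :=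
  iff_polyBounded.2 ⟨_, PolyBounded.const 0, fun n => .of_wires (o n) (h n)⟩

theorem of_bits {f : ∀ n, α n → β n}
    {g : ∀ n, (BitCode.Wire (α n) → Bool) → BitCode.Wire (β n) → Bool} {c : ℕ}
    (hβ : PolyLength β) (hg : ∀ n w, HasBitCircuit (g n · w) c)
    (hf : ∀ n a, g n (BitCode.bits a) = BitCode.bits (f n a)) : PolyTime f :=
  iff_polyBounded.2 ⟨_, PolyBounded.mul hβ (PolyBounded.const c), fun n =>
    ComputableInSize.iff_hasCircuit.2 ⟨_, .family (hg n), hf n⟩⟩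

protected theorem id : PolyTime fun n (a : α n) => a := of_wires (fun _ => id) fun _ _ _ => rfl

theorem const (b : ∀ n, β n) : PolyTime fun n (_ : α n) => b n :=
  iff_polyBounded.2 ⟨_, PolyBounded.const 2, fun n =>
    ComputableInSize.iff_hasCircuit.2 ⟨_, HasCircuit.const (BitCode.bits (b n)), fun _ => rfl⟩⟩

theorem fst {f : ∀ n, α n → β n × γ n} (hf : PolyTime f) : PolyTime fun n a => (f n a).1 :=
  comp (g := fun n (x : β n × γ n) => x.1) (of_wires (fun _ => Sum.inl) fun _ _ _ => rfl) hf

theorem snd {f : ∀ n, α n → β n × γ n} (hf : PolyTime f) : PolyTime fun n a => (f n a).2 :=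
  comp (g := fun n (x : β n × γ n) => x.2) (of_wires (fun _ => Sum.inr) fun _ _ _ => rfl) hf

theorem apply {k : ℕ} {f : ∀ n, α n → Fin k → β n} (hf : PolyTime f) (i : Fin k) :
    PolyTime fun n a => f n a i :=
  comp (g := fun n (x : Fin k → β n) => x i) (of_wires (fun _ w => (i, w)) fun _ _ _ => rfl) hf

theorem cons {k : ℕ} {f : ∀ n, α n → β n} {g : ∀ n, α n → Fin k → β n} (hf : PolyTime f)
    (hg : PolyTime g) :
    PolyTime (β := fun n => Fin (k + 1) → β n) fun n a => Fin.cons (f n a) (g n a) := by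
  refine comp (g := fun n (x : β n × (Fin k → β n)) => (Fin.cons x.1 x.2 : Fin (k + 1) → β n))
    (of_wires (fun n w => Fin.cases (motive := fun _ => BitCode.Wire (β n × (Fin k → β n)))
      (Sum.inl w.2) (fun i => Sum.inr (i, w.2)) w.1) ?_) (hf.pair hg)
  rintro n x ⟨i, w⟩
  cases i using Fin.cases <;> rfl

theorem pi : ∀ {k : ℕ} {f : Fin k → ∀ n, α n → β n}, (∀ i, PolyTime (f i)) →
    PolyTime fun n a i => f i n a
  | 0, _, _ => of_wires (fun _ w => w.1.elim0) fun _ _ w => w.1.elim0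
  | _ + 1, _, hf => ((hf 0).cons (pi fun i => hf i.succ)).of_eq fun _ _ =>
      funext fun i => by cases i using Fin.cases <;> rfl

theorem of_finite {X : Type} [BitCode X] [Finite X] (hβ : PolyLength β) (g : ∀ n, X → β n)
    {f : ∀ n, α n → X} (hf : PolyTime f) : PolyTime fun n a => g n (f n a) := by
  obtain ⟨c, hc⟩ := exists_size_forall_hasBitCircuit X
  choose G hG hGg using fun n w => hc fun x => BitCode.bits (g n x) w
  exact comp (β := fun _ => X) (g := g)
    (of_bits hβ (g := fun n x w => G n w x) hG fun n x => funext fun w => hGg n w x) hf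

theorem some {f : ∀ n, α n → β n} (hf : PolyTime f) : PolyTime fun n a => some (f n a) := by
  refine comp (g := fun n (b : β n) => Option.some b) ?_ hf
  have h n := ((HasCircuit.const (V := BitCode.Wire (β n)) (W := Unit) fun _ => true).sumElim
    (HasCircuit.wires id)).map_outputs
      fun w : Option (BitCode.Wire (β n)) => w.elim (Sum.inl ()) Sum.inr
  exact iff_polyBounded.2 ⟨_, PolyBounded.const 2, fun n =>
    ComputableInSize.iff_hasCircuit.2 ⟨_, h n, fun b => funext fun w => by cases w <;> rfl⟩⟩

theorem isSome {f : ∀ n, α n → Option (β n)} (hf : PolyTime f) :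
    PolyTime (β := fun _ => Bool) fun n a => (f n a).isSome :=
  comp (g := fun n (b : Option (β n)) => b.isSome)
    (of_wires (fun _ _ => none) fun _ a _ => by cases a <;> rfl) hf

theorem getD {f : ∀ n, α n → Option (β n)} {d : ∀ n, α n → β n} (hβ : PolyLength β)
    (hf : PolyTime f) (hd : PolyTime d) : PolyTime fun n a => (f n a).getD (d n a) := by
  refine comp (β := fun n => Option (β n) × β n) (g := fun n x => x.1.getD x.2)
    (of_bits hβ (g := fun n x w => if x (.inl none) then x (.inl (.some w)) else x (.inr w))
      (fun n w => (HasBitCircuit.wire _).ite (.wire _) (.wire _)) ?_) (hf.pair hd)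
  rintro n ⟨_ | _, _⟩ <;> rfl

theorem cond {c : ∀ n, α n → Bool} {f g : ∀ n, α n → β n} (hβ : PolyLength β)
    (hc : PolyTime (β := fun _ => Bool) c) (hf : PolyTime f) (hg : PolyTime g) :
    PolyTime fun n a => cond (c n a) (f n a) (g n a) := by
  refine comp (β := fun n => Bool × β n × β n) (g := fun n x => bif x.1 then x.2.1 else x.2.2)
    (of_bits hβ (g := fun n x w =>
        if x (.inl ()) then x (.inr (.inl w)) else x (.inr (.inr w)))
      (fun n w => (HasBitCircuit.wire _).ite (.wire _) (.wire _)) ?_) (hc.pair (hf.pair hg))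
  rintro n ⟨_ | _, _, _⟩ <;> rfl

theorem decide_eq {f g : ∀ n, α n → β n} (hβ : PolyLength β) (hf : PolyTime f) (hg : PolyTime g) :
    PolyTime (β := fun _ => Bool) fun n a => decide (f n a = g n a) := by
  refine comp (β := fun n => β n × β n) (γ := fun _ => Bool) (g := fun n x => decide (x.1 = x.2))
    ?_ (hf.pair hg)
  obtain ⟨s, hs⟩ := HasBitCircuit.exists_of_finite fun x : Bool → Bool => x false == x true
  have hwire n (w : BitCode.Wire (β n)) : HasBitCircuit
      (fun x : BitCode.Wire (β n) ⊕ BitCode.Wire (β n) → Bool => x (.inl w) == x (.inr w)) s :=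
    hs.map_inputs fun b => bif b then Sum.inr w else Sum.inl w
  refine iff_polyBounded.2 ⟨_, ((PolyBounded.mul hβ (PolyBounded.const s)).add
    ((PolyBounded.const 4).mul hβ)).add (PolyBounded.const 2), fun n =>
      ComputableInSize.iff_hasCircuit.2
        ⟨_, HasBitCircuit.forall_wire (HasCircuit.family (hwire n)), ?_⟩⟩
  rintro ⟨x, y⟩
  funext _
  change decide (∀ w, (BitCode.bits x w == BitCode.bits y w) = true) = decide (x = y)
  simp only [decide_eq_decide, beq_iff_eq, ← funext_iff]
  exact BitCode.bits_injective.eq_iff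

theorem select {k : ℕ} {i : ∀ n, α n → Fin k} {f : ∀ n, α n → Fin k → β n}
    (hβ : PolyLength β) (hi : PolyTime (β := fun _ => Fin k) i) (hf : PolyTime f) :
    PolyTime fun n a => f n a (i n a) := by
  obtain ⟨s, hs⟩ := ComputableInSize.exists_forall (Fin k × (Fin k → Bool)) Bool
  obtain ⟨G, hG, hGbits⟩ := ComputableInSize.iff_hasCircuit.1 (hs fun x => x.2 x.1)
  let entryWire (n : ℕ) (w : BitCode.Wire (β n)) :
      Fin k ⊕ Fin k × Unit → Fin k ⊕ Fin k × BitCode.Wire (β n) :=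
    Sum.map id fun p => (p.1, w)
  refine comp (β := fun n => Fin k × (Fin k → β n)) (g := fun n x => x.2 x.1)
    (of_bits hβ (g := fun n x w => G (x ∘ entryWire n w) ())
      (fun n w => hG.map_inputs (entryWire n w)) ?_) (hi.pair hf)
  rintro n ⟨j, y⟩
  funext w
  refine Eq.trans ?_ (congrFun (hGbits (j, fun i => BitCode.bits (y i) w)) ())
  congr 1
  funext v
  rcases v with v | v <;> rfl

theorem restrict {k : ℕ} {f : Fin k → ∀ n, α n → β n} (S : Finset (Fin k))
    (hf : ∀ i, PolyTime (f i)) :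
    PolyTime (β := fun n => Fin k → Option (β n)) fun n a => restrict S fun i => f i n a := by
  refine pi (β := fun n => Option (β n))
    (f := fun i n a => MPCAuction.restrict S (fun i => f i n a) i) fun i => ?_
  unfold MPCAuction.restrict
  by_cases h : i ∈ S
  · simpa only [if_pos h] using (hf i).some
  · simpa only [if_neg h] using const (β := fun n => Option (β n)) fun _ => none

end PolyTime

/-- Predicates on encoded types that are decided by polynomial-size circuits. -/
def PolyPred {α : ℕ → Type} [∀ n, BitCode (α n)] (p : ∀ n, α n → Prop) : Prop :=
  PolyTime (β := fun _ => Bool) fun n a => decide (p n a)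

namespace PolyPred

variable {α β : ℕ → Type} [∀ n, BitCode (α n)] [∀ n, BitCode (β n)] {p q : ∀ n, α n → Prop}

protected theorem decide [∀ n a, Decidable (p n a)] (hp : PolyPred p) :
    PolyTime (β := fun _ => Bool) fun n a => decide (p n a) :=
  PolyTime.of_eq hp fun _ _ => by congr

theorem of_finite {X : Type} [BitCode X] [Finite X] (P : X → Prop) {f : ∀ n, α n → X}
    (hf : PolyTime f) : PolyPred fun n a => P (f n a) :=
  PolyTime.of_finite (PolyLength.const Bool) (fun _ x => decide (P x)) hf

theorem const (P : Prop) : PolyPred fun n (_ : α n) => P :=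
  PolyTime.const (β := fun _ => Bool) _

theorem not (hp : PolyPred p) : PolyPred fun n a => ¬ p n a := by
  simpa using of_finite (fun b => b = false) hp

theorem and (hp : PolyPred p) (hq : PolyPred q) : PolyPred fun n a => p n a ∧ q n a := by
  simpa using of_finite (fun b : Bool × Bool => b.1 = true ∧ b.2 = true) (hp.pair hq)

theorem or (hp : PolyPred p) (hq : PolyPred q) : PolyPred fun n a => p n a ∨ q n a := by
  simpa using of_finite (fun b : Bool × Bool => b.1 = true ∨ b.2 = true) (hp.pair hq)

theorem exists_fin {k : ℕ} {p : Fin k → ∀ n, α n → Prop} (hp : ∀ i, PolyPred (p i)) :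
    PolyPred fun n a => ∃ i, p i n a := by
  simpa using of_finite (fun b : Fin k → Bool => ∃ i, b i = true) (PolyTime.pi hp)

theorem eq {f g : ∀ n, α n → β n} (hβ : PolyLength β) (hf : PolyTime f) (hg : PolyTime g) :
    PolyPred fun n a => f n a = g n a :=
  PolyTime.decide_eq hβ hf hg

theorem polyTime_ite [∀ n a, Decidable (p n a)] {f g : ∀ n, α n → β n} (hp : PolyPred p)
    (hβ : PolyLength β) (hf : PolyTime f) (hg : PolyTime g) :
    PolyTime fun n a => if p n a then f n a else g n a :=
  (PolyTime.cond hβ hp.decide hf hg).of_eq fun _ _ => Bool.cond_decide ..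

end PolyPred

theorem PolyTime.update {α β : ℕ → Type} [∀ n, BitCode (α n)] [∀ n, BitCode (β n)] {k : ℕ}
    {i : ∀ n, α n → Fin k} {f : ∀ n, α n → Fin k → β n} {b : ∀ n, α n → β n} (hβ : PolyLength β)
    (hi : PolyTime (β := fun _ => Fin k) i) (hf : PolyTime f) (hb : PolyTime b) :
    PolyTime fun n a => Function.update (f n a) (i n a) (b n a) := by
  refine PolyTime.pi (f := fun j n a => Function.update (f n a) (i n a) (b n a) j) fun j => ?_
  simp only [Function.update_apply]
  exact (PolyPred.of_finite (fun l => j = l) hi).polyTime_ite hβ hb (hf.apply j)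

/-! ### Finite probability -/

section PMF

variable {α β : Type}

theorem bind_congr_of_mem_support {p : PMF α} {f g : α → PMF β}
    (h : ∀ a ∈ p.support, f a = g a) : p.bind f = p.bind g := by
  ext b
  simp only [PMF.bind_apply]
  refine tsum_congr fun a => ?_
  by_cases ha : p a = 0
  · simp [ha]
  · rw [h a ((p.mem_support_iff a).2 ha)]

theorem map_uniformOfFintype_equiv [Fintype α] [Nonempty α] [Fintype β] [Nonempty β]
    (e : α ≃ β) : (PMF.uniformOfFintype α).map e = PMF.uniformOfFintype β := by
  ext b
  rw [PMF.map_apply, tsum_eq_single (e.symm b)]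
  · simp [Fintype.card_congr e]
  · exact fun a ha => if_neg fun hb => ha (by simp [hb])

theorem uniformOfFintype_prod [Fintype α] [Nonempty α] [Fintype β] [Nonempty β] :
    PMF.uniformOfFintype (α × β) =
      (PMF.uniformOfFintype α).bind fun a => (PMF.uniformOfFintype β).map fun b => (a, b) := by
  ext ⟨x, y⟩
  rw [PMF.bind_apply, tsum_eq_single x, PMF.map_apply, tsum_eq_single y]
  · simp only [PMF.uniformOfFintype_apply, if_true, Fintype.card_prod, Nat.cast_mul]
    rw [ENNReal.mul_inv] <;> simp
  · intro b hb
    simpa using hb.symm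
  · intro a ha
    rw [PMF.map_apply, ENNReal.tsum_eq_zero.2, mul_zero]
    exact fun b => if_neg fun h => ha (congrArg Prod.fst h).symm

theorem uniformOfFintype_fin_succ {k : ℕ} [Fintype α] [Nonempty α] :
    PMF.uniformOfFintype (Fin (k + 1) → α) = (PMF.uniformOfFintype α).bind fun a =>
      (PMF.uniformOfFintype (Fin k → α)).map fun f => Fin.cons (α := fun _ => α) a f := by
  rw [← map_uniformOfFintype_equiv (Fin.consEquiv fun _ : Fin (k + 1) => α),
    uniformOfFintype_prod, PMF.map_bind]
  simp only [PMF.map_comp]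
  rfl

theorem map_uniformOfFintype_bits_add (r s : ℕ) :
    (PMF.uniformOfFintype (Bits (r + s))).map
        (fun ω => ((fun i => ω (Fin.castAdd s i) : Bits r), (fun i => ω (Fin.natAdd r i) : Bits s)))
      = (PMF.uniformOfFintype (Bits r)).bind fun a =>
        (PMF.uniformOfFintype (Bits s)).map fun b => (a, b) := by
  rw [← uniformOfFintype_prod, ← map_uniformOfFintype_equiv (Fin.appendEquiv r s), PMF.map_comp]
  convert PMF.map_id _
  funext ⟨a, b⟩
  simp [Fin.appendEquiv]

end PMF

section Indep

variable {α β : Type} {k : ℕ}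

theorem uniformOfFintype_eq_indep [Fintype α] [Nonempty α] :
    PMF.uniformOfFintype (Fin k → α) = indep fun _ => PMF.uniformOfFintype α := by
  induction k with
  | zero =>
    ext f
    simp [indep, Subsingleton.elim f Fin.elim0, PMF.pure_apply]
  | succ k ih =>
    rw [uniformOfFintype_fin_succ, ih]
    rfl

theorem indep_map (p : Fin k → PMF α) (f : Fin k → α → β) :
    indep (fun i => (p i).map (f i)) = (indep p).map fun x i => f i (x i) := by
  induction k with
  | zero =>
    simp only [indep, PMF.pure_map]
    exact congrArg _ (Subsingleton.elim _ _)
  | succ k ih =>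
    simp only [indep, PMF.map_bind, PMF.bind_map, PMF.map_comp]
    refine congrArg _ (funext fun a => ?_)
    simp only [Function.comp_apply, ih (fun i => p i.succ) fun i => f i.succ, PMF.map_comp]
    congr 1
    funext x i
    cases i using Fin.cases <;> rfl

theorem mem_support_indep {p : Fin k → PMF α} {x : Fin k → α} (hx : x ∈ (indep p).support)
    (i : Fin k) : x i ∈ (p i).support := by
  induction k with
  | zero => exact i.elim0
  | succ k ih =>
    simp only [indep, PMF.mem_support_bind_iff, PMF.mem_support_map_iff] at hx
    obtain ⟨a, ha, f, hf, rfl⟩ := hx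
    cases i using Fin.cases with
    | zero => exact ha
    | succ i => exact ih hf i

theorem indep_update (p : Fin k → PMF α) (i : Fin k) (q : PMF α) :
    indep (Function.update p i q) =
      q.bind fun a => (indep p).map fun f => Function.update f i a := by
  induction k with
  | zero => exact i.elim0
  | succ k ih =>
    cases i using Fin.cases with
    | zero =>
      simp only [indep, Function.update_self, PMF.map_bind, PMF.map_comp, Function.comp_def,
        Fin.update_cons_zero, PMF.bind_const]
      rfl
    | succ j =>
      have hzero : Function.update p j.succ q 0 = p 0 :=
        Function.update_of_ne (Fin.succ_ne_zero j).symm _ _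
      have hsucc : (fun l => Function.update p j.succ q (Fin.succ l)) =
          Function.update (fun l => p (Fin.succ l)) j q :=
        Function.update_comp_eq_of_injective p (Fin.succ_injective k) j q
      simp only [indep, hzero, hsucc, ih, PMF.map_bind, PMF.map_comp, Function.comp_def,
        Fin.cons_update]
      exact PMF.bind_comm _ _ _

theorem indep_eq_bind (p : Fin k → PMF α) (i : Fin k) :
    indep p = (p i).bind fun a => (indep p).map fun f => Function.update f i a := by
  rw [← indep_update, Function.update_eq_self]

theorem indep_map_apply (p : Fin k → PMF α) (i : Fin k) : (indep p).map (fun f => f i) = p i := by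
  rw [indep_eq_bind p i]
  simp only [PMF.map_bind, PMF.map_comp, Function.comp_def, Function.update_self]
  exact (congrArg _ (funext fun a => PMF.map_const (indep p) a)).trans (p i).bind_pure

end Indep

section PrTrue

variable {α : Type}

theorem prTrue_nonneg (p : PMF Bool) : 0 ≤ prTrue p := ENNReal.toReal_nonneg

theorem toReal_apply_le_one (p : PMF α) (a : α) : (p a).toReal ≤ 1 :=
  ENNReal.toReal_le_of_le_ofReal zero_le_one (by simpa using p.coe_le_one a)

theorem prTrue_le_one (p : PMF Bool) : prTrue p ≤ 1 := toReal_apply_le_one p true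

theorem abs_prTrue_sub_le_one (p q : PMF Bool) : |prTrue p - prTrue q| ≤ 1 :=
  abs_sub_le_of_nonneg_of_le (prTrue_nonneg p) (prTrue_le_one p) (prTrue_nonneg q)
    (prTrue_le_one q)

theorem prTrue_pure (b : Bool) : prTrue (PMF.pure b) = if b = true then 1 else 0 := by
  cases b <;> simp [prTrue, PMF.pure_apply]

theorem summable_mul_prTrue (p : PMF α) (f : α → PMF Bool) :
    Summable fun a => (p a).toReal * prTrue (f a) :=
  (ENNReal.summable_toReal p.tsum_coe_ne_top).of_nonneg_of_le
    (fun _ => mul_nonneg ENNReal.toReal_nonneg (prTrue_nonneg _))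
    fun _ => mul_le_of_le_one_right ENNReal.toReal_nonneg (prTrue_le_one _)

theorem prTrue_bind (p : PMF α) (f : α → PMF Bool) :
    prTrue (p.bind f) = ∑' a, (p a).toReal * prTrue (f a) := by
  rw [prTrue, PMF.bind_apply, ENNReal.tsum_toReal_eq]
  · simp only [ENNReal.toReal_mul, prTrue]
  · exact fun a => ENNReal.mul_ne_top (p.apply_ne_top a) ((f a).apply_ne_top true)

theorem prTrue_bind_sub_le_sum {ι : Type} (S : Finset ι) (p : PMF α) {f g : α → PMF Bool}
    {h : ι → α → PMF Bool} (hfg : ∀ a, prTrue (f a) - prTrue (g a) ≤ ∑ i ∈ S, prTrue (h i a)) :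
    prTrue (p.bind f) - prTrue (p.bind g) ≤ ∑ i ∈ S, prTrue (p.bind (h i)) := by
  have hh i (_ : i ∈ S) := summable_mul_prTrue p (h i)
  have hg := summable_mul_prTrue p g
  simp only [prTrue_bind]
  rw [sub_le_iff_le_add, ← Summable.tsum_finsetSum hh, ← (summable_sum hh).tsum_add hg]
  refine (summable_mul_prTrue p f).tsum_le_tsum (fun a => ?_) ((summable_sum hh).add hg)
  rw [← Finset.mul_sum, ← mul_add]
  exact mul_le_mul_of_nonneg_left (sub_le_iff_le_add.1 (hfg a)) ENNReal.toReal_nonneg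

theorem abs_prTrue_bind_sub_le_sum {ι : Type} (S : Finset ι) (p : PMF α) {f g : α → PMF Bool}
    {h : ι → α → PMF Bool} (hfg : ∀ a, |prTrue (f a) - prTrue (g a)| ≤ ∑ i ∈ S, prTrue (h i a)) :
    |prTrue (p.bind f) - prTrue (p.bind g)| ≤ ∑ i ∈ S, prTrue (p.bind (h i)) :=
  abs_sub_le_iff.2 ⟨prTrue_bind_sub_le_sum S p fun a => (abs_sub_le_iff.1 (hfg a)).1,
    prTrue_bind_sub_le_sum S p fun a => (abs_sub_le_iff.1 (hfg a)).2⟩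

end PrTrue

namespace Negligible

variable {f g : ℕ → ℝ}

theorem add (hf : Negligible f) (hg : Negligible g) : Negligible fun n => f n + g n :=
  Asymptotics.SuperpolynomialDecay.add hf hg

theorem of_abs_le (hg : Negligible g) (h : ∀ n, |f n| ≤ g n) : Negligible f :=
  Asymptotics.SuperpolynomialDecay.trans_abs_le hg fun n => (h n).trans (le_abs_self _)

theorem zero : Negligible fun _ => 0 := Asymptotics.superpolynomialDecay_zero _ _

theorem sum {ι : Type} (s : Finset ι) {f : ι → ℕ → ℝ} (h : ∀ i ∈ s, Negligible (f i)) :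
    Negligible fun n => ∑ i ∈ s, f i n := by
  induction s using Finset.induction_on with
  | empty => simpa using zero
  | insert a s ha ih =>
    simp only [Finset.sum_insert ha]
    exact (h a (Finset.mem_insert_self _ _)).add
      (ih fun i hi => h i (Finset.mem_insert_of_mem hi))

theorem geometric {r : ℝ} (h0 : 0 ≤ r) (h1 : r < 1) : Negligible fun n => r ^ n := fun k =>
  tendsto_pow_const_mul_const_pow_of_abs_lt_one k (by rwa [abs_of_nonneg h0])

end Negligible

/-! ### Probabilistic polynomial time and computational indistinguishability -/

/-- `f` is sampled, on encodings, by a circuit with at most `s` gates and exactly `r` random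
bits. -/
def SamplableInSize {α β : Type} [BitCode α] [BitCode β] (f : α → PMF β) (r s : ℕ) : Prop :=
  ∃ g : α × Bits r → β, ComputableInSize g s ∧
    ∀ a, f a = (PMF.uniformOfFintype (Bits r)).map fun ω => g (a, ω)

namespace SamplableInSize

variable {α β γ : Type} [BitCode α] [BitCode β] [BitCode γ] {f : α → PMF β} {r r' s s' : ℕ}

theorem mono (h : SamplableInSize f r s) (hs : s ≤ s') : SamplableInSize f r s' := by
  obtain ⟨g, hg, hf⟩ := h
  exact ⟨g, hg.mono hs, hf⟩

theorem pure {g : α → β} (hg : ComputableInSize g s) :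
    SamplableInSize (fun a => PMF.pure (g a)) r s :=
  ⟨fun x => g x.1, (hg.comp (.of_wires Sum.inl fun _ _ => rfl)).mono (by omega),
    fun a => (PMF.map_const _ (g a)).symm⟩

theorem comp {g : γ → α} (hf : SamplableInSize f r s) (hg : ComputableInSize g s') :
    SamplableInSize (fun c => f (g c)) r (s' + s) := by
  obtain ⟨G, hG, hfG⟩ := hf
  have hfst : ComputableInSize (fun x : γ × Bits r => x.1) 0 := .of_wires Sum.inl fun _ _ => rfl
  have hsnd : ComputableInSize (fun x : γ × Bits r => x.2) 0 := .of_wires Sum.inr fun _ _ => rfl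
  exact ⟨fun x => G (g x.1, x.2), (hG.comp ((hg.comp hfst).pair hsnd)).mono (by omega),
    fun c => hfG (g c)⟩

theorem uniform_bits : SamplableInSize (fun _ : α => PMF.uniformOfFintype (Bits r)) r 0 :=
  ⟨Prod.snd, .of_wires Sum.inr fun _ _ => rfl, fun _ => (PMF.map_id _).symm⟩

theorem bind {h : α × β → PMF γ} (hf : SamplableInSize f r s) (hh : SamplableInSize h r' s') :
    SamplableInSize (fun a => (f a).bind fun b => h (a, b)) (r + r') (s + s') := by
  obtain ⟨g, hg, hf⟩ := hf
  obtain ⟨g', hg', hh⟩ := hh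
  refine ⟨fun x => g' ((x.1, g (x.1, fun i => x.2 (Fin.castAdd r' i))),
    fun i => x.2 (Fin.natAdd r i)), ?_, fun a => ?_⟩
  · have hinput : ComputableInSize (fun x : α × Bits (r + r') => x.1) 0 :=
      .of_wires Sum.inl fun _ _ => rfl
    have hcoins : ComputableInSize (fun x : α × Bits (r + r') =>
        (x.1, (fun i => x.2 (Fin.castAdd r' i) : Bits r))) 0 :=
      .of_wires (Sum.map id fun w : Fin r × Unit => (Fin.castAdd r' w.1, w.2)) fun a w => by
        cases w <;> rfl
    have hcoins' : ComputableInSize (fun x : α × Bits (r + r') =>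
        (fun i => x.2 (Fin.natAdd r i) : Bits r')) 0 :=
      .of_wires (fun w : Fin r' × Unit => Sum.inr (Fin.natAdd r w.1, w.2)) fun _ _ => rfl
    exact (hg'.comp ((hinput.pair (hg.comp hcoins)).pair hcoins')).mono (by omega)
  · have hsplit := congrArg (PMF.map fun x : Bits r × Bits r' => g' ((a, g (a, x.1)), x.2))
      (map_uniformOfFintype_bits_add r r')
    simp only [PMF.map_comp, PMF.map_bind] at hsplit
    simp only [hf, hh, PMF.bind_map]
    exact hsplit.symm

theorem elim {d : γ → Option β}
    (hd : ComputableInSize (fun x : γ × β => (d x.1).elim x.2 id) s')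
    (hf : SamplableInSize f r s) :
    SamplableInSize (fun x : α × γ => (d x.2).elim (f x.1) PMF.pure) r (s + s') := by
  obtain ⟨g, hg, hf⟩ := hf
  refine ⟨fun x => (d x.1.2).elim (g (x.1.1, x.2)) id, ?_, fun ⟨a, c⟩ => ?_⟩
  · have hinput : ComputableInSize (fun x : (α × γ) × Bits r => (x.1.1, x.2)) 0 :=
      .of_wires (Sum.map Sum.inl id) fun _ w => by cases w <;> rfl
    have hcase : ComputableInSize (fun x : (α × γ) × Bits r => x.1.2) 0 :=
      .of_wires (fun w => Sum.inl (Sum.inr w)) fun _ _ => rfl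
    exact (hd.comp (hcase.pair (hg.comp hinput))).mono (by omega)
  · cases hdc : d c with
    | none => simpa [hdc] using hf a
    | some b => simp only [hdc, Option.elim_some]; exact (PMF.map_const _ b).symm

end SamplableInSize

namespace PPT

variable {α β γ : ℕ → Type} [∀ n, BitCode (α n)] [∀ n, BitCode (β n)] [∀ n, BitCode (γ n)]

theorem iff_samplableInSize {f : ∀ n, α n → PMF (β n)} :
    PPT f ↔ ∃ r s : ℕ → ℕ, PolyBounded r ∧ PolyBounded s ∧
      ∀ n, SamplableInSize (f n) (r n) (s n) := by
  constructor
  · rintro ⟨p, hp⟩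
    choose r g hr hg hf using hp
    exact ⟨r, fun n => p.eval n, ⟨p, hr⟩, ⟨p, fun _ => le_rfl⟩, fun n => ⟨g n, hg n, hf n⟩⟩
  · rintro ⟨r, s, ⟨p, hp⟩, ⟨q, hq⟩, h⟩
    refine ⟨p + q, fun n => ?_⟩
    obtain ⟨g, hg, hf⟩ := h n
    exact ⟨r n, g, (hp n).trans (by simp), hg.mono ((hq n).trans (by simp)), hf⟩

protected theorem pure {f : ∀ n, α n → β n} (hf : PolyTime f) :
    PPT fun n a => PMF.pure (f n a) := by
  obtain ⟨s, hs, h⟩ := PolyTime.iff_polyBounded.1 hf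
  exact iff_samplableInSize.2 ⟨fun _ => 0, s, .const 0, hs, fun n => .pure (h n)⟩

theorem comp {f : ∀ n, β n → PMF (γ n)} {g : ∀ n, α n → β n} (hf : PPT f) (hg : PolyTime g) :
    PPT fun n a => f n (g n a) := by
  obtain ⟨r, s, hr, hs, h⟩ := iff_samplableInSize.1 hf
  obtain ⟨t, ht, h'⟩ := PolyTime.iff_polyBounded.1 hg
  exact iff_samplableInSize.2 ⟨r, _, hr, ht.add hs, fun n => (h n).comp (h' n)⟩

theorem bind {f : ∀ n, α n → PMF (β n)} {h : ∀ n, α n → β n → PMF (γ n)} (hf : PPT f)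
    (hh : PPT fun n (x : α n × β n) => h n x.1 x.2) :
    PPT fun n a => (f n a).bind fun b => h n a b := by
  obtain ⟨r, s, hr, hs, H⟩ := iff_samplableInSize.1 hf
  obtain ⟨r', s', hr', hs', H'⟩ := iff_samplableInSize.1 hh
  exact iff_samplableInSize.2 ⟨_, _, hr.add hr', hs.add hs', fun n => (H n).bind (H' n)⟩

theorem map {f : ∀ n, α n → PMF (β n)} {g : ∀ n, α n → β n → γ n} (hf : PPT f)
    (hg : PolyTime fun n (x : α n × β n) => g n x.1 x.2) :
    PPT fun n a => (f n a).map fun b => g n a b :=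
  hf.bind (.pure hg)

protected theorem indep {k : ℕ} {f : Fin k → ∀ n, α n → PMF (β n)} (hf : ∀ i, PPT (f i)) :
    PPT fun n a => indep fun i => f i n a := by
  induction k with
  | zero => exact .pure (.const (β := fun n => Fin 0 → β n) fun _ => Fin.elim0)
  | succ k ih =>
    exact (hf 0).bind (((ih fun i => hf i.succ).comp PolyTime.id.fst).map
      (PolyTime.id.fst.snd.cons PolyTime.id.snd))

theorem uniform_bits {k : ℕ → ℕ} (hk : PolyBounded k) :
    PPT fun n (_ : α n) => PMF.uniformOfFintype (Bits (k n)) :=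
  iff_samplableInSize.2 ⟨k, _, hk, .const 0, fun _ => .uniform_bits⟩

theorem of_sampler {f : ∀ n, PMF (β n)} (hf : PPTSampler f) : PPT fun n (_ : α n) => f n :=
  PPT.comp (β := fun _ => Fin 0 → Bool) (f := fun n _ => f n) hf
    (PolyTime.const (β := fun _ => Fin 0 → Bool) fun _ => Fin.elim0)

end PPT

namespace CompIndist

variable {α β : ℕ → Type} [∀ n, BitCode (α n)] [∀ n, BitCode (β n)] {p q r : ∀ n, PMF (α n)}

theorem refl (p : ∀ n, PMF (α n)) : CompIndist p p := fun D _ => by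
  simpa using Negligible.zero

theorem symm (h : CompIndist p q) : CompIndist q p := fun D hD =>
  (h D hD).of_abs_le fun n => by rw [abs_abs, abs_sub_comm]

theorem trans (h : CompIndist p q) (h' : CompIndist q r) : CompIndist p r := fun D hD =>
  ((h D hD).add (h' D hD)).of_abs_le fun n => by
    rw [abs_abs]
    exact abs_sub_le _ _ _

theorem bind (h : CompIndist p q) {f : ∀ n, α n → PMF (β n)} (hf : PPT f) :
    CompIndist (fun n => (p n).bind (f n)) (fun n => (q n).bind (f n)) := fun D hD => by
  simpa only [PMF.bind_bind] using
    h (fun n a => (f n a).bind (D n)) (hf.bind (hD.comp PolyTime.id.snd))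

theorem iterate {k : ℕ} {H : ℕ → ∀ n, PMF (α n)} (h : ∀ i < k, CompIndist (H i) (H (i + 1))) :
    CompIndist (H 0) (H k) := by
  induction k with
  | zero => exact refl _
  | succ k ih => exact (ih fun i hi => h i (by omega)).trans (h k (by omega))

theorem mixture {κ : Type} [Finite κ] (μ : ℕ → PMF κ) {p q : κ → ∀ n, PMF (α n)}
    (h : ∀ a, CompIndist (p a) (q a)) :
    CompIndist (fun n => (μ n).bind fun a => p a n) (fun n => (μ n).bind fun a => q a n) := by
  intro D hD
  have := Fintype.ofFinite κ
  refine (Negligible.sum Finset.univ fun a _ => h a D hD).of_abs_le fun n => ?_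
  rw [abs_abs]
  simp only [PMF.bind_bind]
  rw [prTrue_bind, prTrue_bind, tsum_fintype, tsum_fintype, ← Finset.sum_sub_distrib]
  refine (Finset.abs_sum_le_sum_abs _ _).trans (Finset.sum_le_sum fun a _ => ?_)
  rw [← mul_sub, abs_mul, abs_of_nonneg ENNReal.toReal_nonneg]
  exact mul_le_of_le_one_left (abs_nonneg _) (toReal_apply_le_one _ _)

protected theorem indep {k : ℕ} {p q : Fin k → ∀ n, PMF (α n)} (hp : ∀ i, PPTSampler (p i))
    (hq : ∀ i, PPTSampler (q i)) (h : ∀ i, CompIndist (p i) (q i)) :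
    CompIndist (fun n => indep fun i => p i n) (fun n => indep fun i => q i n) := by
  induction k with
  | zero => exact refl _
  | succ k ih =>
    have head := (h 0).bind ((PPT.indep (α := α) fun i => .of_sampler (hp i.succ)).map
      (PolyTime.id.fst.cons PolyTime.id.snd))
    have tail := (ih (fun i => hp i.succ) (fun i => hq i.succ) fun i => h i.succ).bind
      ((PPT.of_sampler (α := fun n => Fin k → α n) (hq 0)).map
        (g := fun n f a => Fin.cons (α := fun _ => α n) a f)
        (PolyTime.id.snd.cons PolyTime.id.fst))
    refine head.trans ?_
    convert tail using 2 <;> exact PMF.bind_comm _ _ _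

end CompIndist

section AlmostUniform

variable (κ : Type) [Fintype κ]

/-- The encoding of the elements of `κ` as indicator vectors. -/
def indicatorBits (a : κ) : Bits (Fintype.card κ) := fun i => decide (i = Fintype.equivFin κ a)

/-- Rejection sampling of an element of `κ` with at most `l` trials; each trial draws a uniform bit
string and succeeds if the string is an indicator vector. Coins are bits, so the uniform
distribution on `κ` can only be approximated in polynomial time. -/
def almostUniform [Nonempty κ] : ℕ → PMF κ
  | 0 => PMF.pure (Classical.arbitrary κ)
  | l + 1 => (PMF.uniformOfFintype (Bits (Fintype.card κ))).bind fun x =>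
    (Function.partialInv (indicatorBits κ) x).elim (almostUniform l) PMF.pure

variable {κ}

theorem indicatorBits_injective : Function.Injective (indicatorBits κ) := fun a b h => by
  simpa [indicatorBits] using congrFun h (Fintype.equivFin κ a)

theorem sum_partialInv_elim {β : Type} [Fintype β] {e : κ → β} (he : Function.Injective e)
    (c : ℝ) (f : κ → ℝ) :
    ∑ x, (Function.partialInv e x).elim c f =
      ∑ a, f a + (Fintype.card β - Fintype.card κ) * c := by
  have helim x : (Function.partialInv e x).elim c f =
      c + ∑ a, if Function.partialInv e x = some a then f a - c else 0 := by
    cases Function.partialInv e x <;> simp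
  simp only [helim, Finset.sum_add_distrib]
  rw [Finset.sum_comm]
  simp only [he.isPartialInv _ _, Finset.sum_ite_eq, Finset.mem_univ, if_true,
    Finset.sum_sub_distrib, Finset.sum_const, Finset.card_univ, nsmul_eq_mul]
  ring

theorem card_div_two_pow_card_mem_Ioc [Nonempty κ] :
    (Fintype.card κ / 2 ^ Fintype.card κ : ℝ) ∈ Set.Ioc 0 1 :=
  ⟨div_pos (by exact_mod_cast Fintype.card_pos) (by positivity),
    div_le_one_of_le₀ (by exact_mod_cast Nat.lt_two_pow_self.le) (by positivity)⟩

theorem prTrue_almostUniform_succ_sub [Nonempty κ] (D : κ → PMF Bool) (l : ℕ) :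
    prTrue ((almostUniform κ (l + 1)).bind D) - prTrue ((PMF.uniformOfFintype κ).bind D) =
      (1 - Fintype.card κ / 2 ^ Fintype.card κ) *
        (prTrue ((almostUniform κ l).bind D) - prTrue ((PMF.uniformOfFintype κ).bind D)) := by
  have hcard : (Fintype.card κ : ℝ) ≠ 0 := by simp
  have huniform : prTrue ((PMF.uniformOfFintype κ).bind D) =
      (Fintype.card κ : ℝ)⁻¹ * ∑ a, prTrue (D a) := by
    rw [prTrue_bind, tsum_fintype, Finset.mul_sum]
    simp
  have halmost : prTrue ((almostUniform κ (l + 1)).bind D) = (2 ^ Fintype.card κ : ℝ)⁻¹ *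
      (∑ a, prTrue (D a) + (2 ^ Fintype.card κ - Fintype.card κ) *
        prTrue ((almostUniform κ l).bind D)) := by
    have hsum := sum_partialInv_elim (indicatorBits_injective (κ := κ))
      (prTrue ((almostUniform κ l).bind D)) fun a => prTrue (D a)
    rw [show (Fintype.card (Bits (Fintype.card κ)) : ℝ) = 2 ^ Fintype.card κ by simp] at hsum
    rw [← hsum, almostUniform, PMF.bind_bind, prTrue_bind, tsum_fintype, Finset.mul_sum]
    refine Finset.sum_congr rfl fun x _ => ?_
    congr 1
    · simp
    · cases Function.partialInv (indicatorBits κ) x <;> simp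
  rw [halmost, huniform]
  field_simp
  ring

theorem abs_prTrue_almostUniform_sub_le [Nonempty κ] (D : κ → PMF Bool) (l : ℕ) :
    |prTrue ((almostUniform κ l).bind D) - prTrue ((PMF.uniformOfFintype κ).bind D)| ≤
      (1 - Fintype.card κ / 2 ^ Fintype.card κ) ^ l := by
  have hr : (0 : ℝ) ≤ 1 - Fintype.card κ / 2 ^ Fintype.card κ :=
    sub_nonneg.2 card_div_two_pow_card_mem_Ioc.2
  induction l with
  | zero => simpa using abs_prTrue_sub_le_one _ _
  | succ l ih =>
    rw [prTrue_almostUniform_succ_sub, abs_mul, abs_of_nonneg hr, pow_succ']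
    exact mul_le_mul_of_nonneg_left ih hr

variable [Nonempty κ] [BitCode κ]

theorem compIndist_almostUniform_uniform :
    CompIndist (α := fun _ => κ) (fun n => almostUniform κ n)
      (fun _ => PMF.uniformOfFintype κ) := by
  intro D _
  refine (Negligible.geometric (sub_nonneg.2 (card_div_two_pow_card_mem_Ioc (κ := κ)).2)
    (sub_lt_self _ card_div_two_pow_card_mem_Ioc.1)).of_abs_le fun n => ?_
  rw [abs_abs]
  exact abs_prTrue_almostUniform_sub_le (D n) n

theorem ppt_almostUniform {α : ℕ → Type} [∀ n, BitCode (α n)] :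
    PPT fun n (_ : α n) => almostUniform κ n := by
  refine PPT.of_sampler (f := fun n => almostUniform κ n) (PPT.iff_samplableInSize.2 ?_)
  obtain ⟨c, hc⟩ := ComputableInSize.exists_forall (Bits (Fintype.card κ) × κ) κ
  refine ⟨fun n => n * Fintype.card κ, fun n => n * c + 2, PolyBounded.id.mul (.const _),
    (PolyBounded.id.mul (.const _)).add (.const _), fun n => ?_⟩
  beta_reduce
  induction n with
  | zero =>
    exact .pure (ComputableInSize.iff_hasCircuit.2 ⟨_, (HasCircuit.const _).mono (by omega),
      fun _ => rfl⟩)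
  | succ l ih =>
    have htrial := SamplableInSize.uniform_bits.bind
      (ih.elim (d := Function.partialInv (indicatorBits κ)) (hc _))
    rw [show (l + 1) * Fintype.card κ = Fintype.card κ + l * Fintype.card κ by ring]
    exact htrial.mono (by ring_nf; omega)

end AlmostUniform

/-! ### Shamir secret sharing -/

section Shamir

variable {F : Type} [Field F] {m t : ℕ}

/-- The Shamir shares of `s`, the values at the points `pt j` of the polynomial with constant term
`s` and higher coefficients `a`. -/
def shareOf (pt : Fin m → F) (s : F) (a : Fin (t - 1) → F) (j : Fin m) : F :=
  s + ∑ k : Fin (t - 1), a k * pt j ^ (k.val + 1)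

theorem isSharing_shareOf (ht : 1 ≤ t) (pt : Fin m → F) (s : F) (a : Fin (t - 1) → F) :
    IsSharing t pt s (shareOf pt s a) := by
  refine ⟨Polynomial.C s + ∑ k : Fin (t - 1), Polynomial.C (a k) * Polynomial.X ^ (k.val + 1),
    ?_, ?_, fun j => ?_⟩
  · refine (Polynomial.degree_add_le _ _).trans_lt (max_lt ?_ ?_)
    · exact Polynomial.degree_C_le.trans_lt (by exact_mod_cast ht)
    · refine (Polynomial.degree_sum_le _ _).trans_lt
        ((Finset.sup_lt_iff (WithBot.bot_lt_coe t)).2 fun k _ => ?_)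
      exact (Polynomial.degree_C_mul_X_pow_le _ _).trans_lt
        (Nat.cast_lt.2 (Nat.add_lt_of_lt_sub k.isLt))
  · simp [Polynomial.eval_finsetSum]
  · simp [Polynomial.eval_finsetSum, shareOf]

theorem reconstruct_eq_some {pt : Fin m → F} (hpt : Function.Injective pt) {s : F}
    {X Y : Fin m → F} (h : IsSharing t pt s X) {I : Finset (Fin m)} (hI : t ≤ I.card)
    (hY : ∀ j ∈ I, Y j = X j) : reconstruct t pt I Y = some s := by
  obtain ⟨p, hp, h0, hX⟩ := h
  have hlt : p.degree < I.card := hp.trans_le (by exact_mod_cast hI)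
  have hinterp : p = Lagrange.interpolate I pt Y :=
    Lagrange.eq_interpolate_of_eval_eq _ hpt.injOn hlt fun j hj => by rw [hX, hY j hj]
  rw [reconstruct, ← hinterp, if_pos ⟨hI, hp⟩, h0]

theorem exists_coefficient_shift {pt : Fin m → F} (hpt : ∀ j, pt j ≠ 0) {K : Finset (Fin m)}
    (hK : K.card < t) (s : F) :
    ∃ d : Fin (t - 1) → F, ∀ j ∈ K, ∑ k : Fin (t - 1), d k * pt j ^ (k.val + 1) = s := by
  -- `q` vanishes at `0` and is equal to `s` at the points of `K`
  let q : Polynomial F :=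
    Polynomial.C s * (1 - ∏ j ∈ K, (1 - Polynomial.C (pt j)⁻¹ * Polynomial.X))
  have hlin : ∀ j, (1 - Polynomial.C (pt j)⁻¹ * Polynomial.X : Polynomial F).natDegree ≤ 1 := by
    intro j
    refine (Polynomial.natDegree_sub_le _ _).trans (max_le (by simp) ?_)
    exact (Polynomial.natDegree_C_mul_le _ _).trans Polynomial.natDegree_X_le
  have hdeg : q.natDegree < t := by
    refine (Polynomial.natDegree_C_mul_le _ _).trans_lt (lt_of_le_of_lt ?_ hK)
    refine (Polynomial.natDegree_sub_le _ _).trans (max_le (by simp) ?_)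
    exact (Polynomial.natDegree_prod_le _ _).trans
      ((Finset.sum_le_sum fun j _ => hlin j).trans (by simp))
  refine ⟨fun k => q.coeff (k.val + 1), fun j hj => ?_⟩
  have hzero : q.coeff 0 = 0 := by
    rw [Polynomial.coeff_zero_eq_eval_zero]
    simp [q, Polynomial.eval_prod]
  have heval : q.eval (pt j) = s := by
    have hprod : ∏ i ∈ K, (1 - (pt i)⁻¹ * pt j) = 0 :=
      Finset.prod_eq_zero hj (by rw [inv_mul_cancel₀ (hpt j), sub_self])
    simp [q, Polynomial.eval_prod, hprod]
  obtain ⟨u, rfl⟩ : ∃ u, t = u + 1 := ⟨t - 1, by omega⟩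
  rw [Polynomial.eval_eq_sum_range' hdeg, Finset.sum_range_succ', hzero, zero_mul, add_zero,
    Finset.sum_range] at heval
  exact heval

theorem map_shareOf_masked_eq_zero_secret [Fintype F] {N : ℕ} {pt : Fin m → F} (hpt : ∀ j, pt j ≠ 0)
    {K : Finset (Fin m)} (hK : K.card < t) (b : Fin N → F) :
    (PMF.uniformOfFintype (Fin N → Fin (t - 1) → F)).map
        (fun a i j => if j ∈ K then shareOf pt (b i) (a i) j else 0) =
      (PMF.uniformOfFintype (Fin N → Fin (t - 1) → F)).map
        (fun a i j => if j ∈ K then shareOf pt 0 (a i) j else 0) := by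
  choose d hd using exists_coefficient_shift hpt hK
  conv_rhs => rw [← map_uniformOfFintype_equiv
    (Equiv.addRight (fun i => d (b i) : Fin N → Fin (t - 1) → F)), PMF.map_comp]
  congr 1
  funext a i j
  simp only [Function.comp_apply, Equiv.coe_addRight]
  split_ifs with hj
  · simp only [shareOf, Pi.add_apply, add_mul, Finset.sum_add_distrib, hd _ j hj]
    ring
  · rfl

theorem indep_share [Fintype F] {N : ℕ} (pt : Fin m → F) (b : Fin N → F) :
    indep (fun i => share t pt (b i)) =
      (PMF.uniformOfFintype (Fin N → Fin (t - 1) → F)).map fun a i => shareOf pt (b i) (a i) := by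
  rw [uniformOfFintype_eq_indep]
  exact indep_map _ fun i a => shareOf pt (b i) a

end Shamir

/-! ### Executions -/

namespace Protocol

theorem polyLength_opening {F : Type} [BitCode F] : PolyLength fun n => Opening F n :=
  (PolyLength.const F).prod (PolyLength.bits PolyBounded.id)

section Opening

variable {F : Type} [Field F] [BitCode F] {m N : ℕ} (T : Protocol F m N)

theorem opens_iff {n : ℕ} (c : Option (Fin m → T.Com n)) (j : Fin m)
    (o : Option (Opening F n)) : T.Opens c j o ↔ c.isSome = true ∧ o.isSome = true ∧
      T.commitTo n (o.getD (0, zeroBits _)) = c.getD (fun _ => zeroBits _) j := by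
  unfold Opens
  cases c <;> cases o <;> simp

theorem polyLength_com : PolyLength T.Com := PolyLength.bits T.cs.comLen_poly

theorem polyLength_crs : PolyLength T.CRS := PolyLength.bits T.nizk.crsLen_poly

theorem polyLength_proof : PolyLength T.Proof := PolyLength.bits T.nizk.proofLen_poly

theorem polyLength_trap : PolyLength T.nizk.Trap := PolyLength.bits T.nizk.trapLen_poly

/-- For every identity and every miner a commitment and the opening that may be shown to the
miner. -/
abbrev CommittedShares (T : Protocol F m N) (n : ℕ) : Type :=
  Fin N → Fin m → T.Com n × Opening F n

theorem polyLength_committedShares : PolyLength T.CommittedShares :=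
  ((T.polyLength_com.prod polyLength_opening).pi m).pi N

variable [Finite F] {α : ℕ → Type} [∀ n, BitCode (α n)]

theorem polyTime_commitTo {f : ∀ n, α n → Opening F n} (hf : PolyTime f) :
    PolyTime fun n a => T.commitTo n (f n a) :=
  T.cs.commit_poly.comp ((PolyTime.of_finite (PolyLength.bits T.cs.msgLen_poly) T.enc
    hf.fst).pair hf.snd)

theorem polyPred_opens {c : ∀ n, α n → Option (Fin m → T.Com n)}
    {o : ∀ n, α n → Option (Opening F n)} (j : Fin m) (hc : PolyTime c) (ho : PolyTime o) :
    PolyPred fun n a => T.Opens (c n a) j (o n a) := by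
  simp only [opens_iff]
  refine (PolyPred.of_finite (· = true) hc.isSome).and
    ((PolyPred.of_finite (· = true) ho.isSome).and (PolyPred.eq T.polyLength_com
      (T.polyTime_commitTo (ho.getD polyLength_opening (PolyTime.const fun _ => _))) ?_))
  exact (hc.getD (T.polyLength_com.pi m) (PolyTime.const (β := fun n => Fin m → T.Com n)
    fun _ => _)).apply j

theorem polyTime_reconstructBid {c : ∀ n, α n → Option (Fin m → T.Com n)}
    {o : Fin m → ∀ n, α n → Option (Opening F n)} (hc : PolyTime c) (ho : ∀ j, PolyTime (o j)) :
    PolyTime (β := fun _ => F) fun n a => T.reconstructBid n (c n a) fun j => o j n a := by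
  have hcorrect := PolyTime.pi fun j => T.polyPred_opens j hc (ho j)
  have hshare : PolyTime (β := fun _ => Fin m → F) fun n a j =>
      ((o j n a).getD (0, zeroBits _)).1 :=
    PolyTime.pi (β := fun _ => F) fun j =>
      ((ho j).getD polyLength_opening (PolyTime.const fun _ => _)).fst
  -- once the shares and the correctness bits are known, only finitely many inputs remain
  refine (PolyTime.of_finite (PolyLength.const F) (fun _ (x : (Fin m → Bool) × (Fin m → F)) =>
      (reconstruct (threshold m) T.pt (Finset.univ.filter fun j => x.1 j = true) x.2).getD 0)
    (hcorrect.pair hshare)).of_eq fun n a => ?_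
  simp only [reconstructBid, decide_eq_true_eq]
  congr 2
  funext j
  cases o j n a <;> rfl

end Opening

namespace Adversary

variable {F : Type} [Field F] [BitCode F] {m N : ℕ} {T : Protocol F m N} {aux : ℕ → ℕ}
  (A : T.Adversary aux) (Km : Finset (Fin m)) (Ki : Finset (Fin N)) {n : ℕ}

/-- Auxiliary input, coins of the adversary, and CRSes. -/
abbrev Base (n : ℕ) : Type := Bits (aux n) × Bits (A.coins n) × (Fin m → T.CRS n)

/-- What determines an execution up to the outcome: auxiliary input, coins and CRSes, the
commitments with their openings, and the honest proofs. -/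
abbrev Seed (n : ℕ) : Type :=
  A.Base n × T.CommittedShares n × (Fin N → T.Proof n)

/-- The view of the adversary when it chooses the CRSes of the corrupted miners. -/
def view₁ (x : A.Base n) : T.View₁ aux A.coins n := ((x.1, x.2.1), restrict Kmᶜ x.2.2)

/-- The CRS vector of the execution; a missing CRS is replaced by 0. -/
def crsVector (x : A.Base n) : Fin m → T.CRS n := fun j =>
  if j ∈ Km then (A.crs n (A.view₁ Km x) j).getD (zeroBits _) else x.2.2 j

/-- The view of the adversary when it chooses the commitments of the corrupted identities. -/
def view₂ (e : A.Seed n) : T.View₂ aux A.coins n :=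
  (A.view₁ Km e.1, restrict Kiᶜ fun i j => (e.2.1 i j).1)

/-- The commitments broadcast by identity `i`. -/
def coms (e : A.Seed n) (i : Fin N) : Option (Fin m → T.Com n) :=
  if i ∈ Ki then A.com n (A.view₂ Km Ki e) i else some fun j => (e.2.1 i j).1

/-- The view of the adversary when it chooses the proofs of the corrupted identities. -/
def view₃ (e : A.Seed n) : T.View₃ aux A.coins n := (A.view₂ Km Ki e, restrict Kiᶜ e.2.2)

/-- The proof broadcast by identity `i`. -/
def proofs (e : A.Seed n) (i : Fin N) : Option (T.Proof n) :=
  if i ∈ Ki then A.proof n (A.view₃ Km Ki e) i else some (e.2.2 i)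

/-- The statement that identity `i` proves; missing commitments are replaced by 0. -/
def stmt (e : A.Seed n) (i : Fin N) : ShareStmt N m T.cs n :=
  (i, (A.coms Km Ki e i).getD fun _ => zeroBits _)

/-- The proof of identity `i`; a missing one is replaced by 0. -/
def proofD (e : A.Seed n) (i : Fin N) : T.Proof n := (A.proofs Km Ki e i).getD (zeroBits _)

/-- Identity `i` is excluded in step (4). Honest identities are never excluded, by completeness
of the proof system. -/
def unproved (e : A.Seed n) (i : Fin N) : Prop :=
  i ∈ Ki ∧ ¬ ((A.coms Km Ki e i).isSome = true ∧ (A.proofs Km Ki e i).isSome = true ∧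
    T.nizk.V n (A.crsVector Km e.1, A.stmt Km Ki e i, A.proofD Km Ki e i) = true)

/-- The view of the adversary when it chooses the openings sent by the corrupted identities. Only
the openings for corrupted miners are read off the seed. -/
def view₄ (e : A.Seed n) : T.View₄ aux A.coins n :=
  (A.view₃ Km Ki e, fun i j => if i ∉ Ki ∧ j ∈ Km then some (e.2.1 i j).2 else none)

/-- What an honest miner `j` broadcasts about identity `i` in step (6): nothing if `i` is already
excluded, and otherwise whether it complains. -/
def honestVote (e : A.Seed n) (j : Fin m) (i : Fin N) : Option Bool :=
  if A.unproved Km Ki e i then none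
  else some (decide (i ∈ Ki ∧
    ¬ T.Opens (A.coms Km Ki e i) j (A.opening n (A.view₄ Km Ki e) i j)))

/-- The view of the adversary when it chooses the votes of the corrupted miners. -/
def view₅ (e : A.Seed n) : T.View₅ aux A.coins n :=
  (A.view₄ Km Ki e, fun j i => if j ∈ Km then none else A.honestVote Km Ki e j i)

/-- What miner `j` broadcasts about identity `i` in step (6). -/
def votes (e : A.Seed n) (j : Fin m) (i : Fin N) : Option Bool :=
  if j ∈ Km then A.vote n (A.view₅ Km Ki e) j i else A.honestVote Km Ki e j i

/-- The view of the adversary when it chooses the replies of the corrupted identities. Honest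
identities have answered the complaints, which come only from corrupted miners. -/
def view₆ (e : A.Seed n) : T.View₆ aux A.coins n :=
  (A.view₅ Km Ki e, fun i j => if i ∈ Ki then none
    else if j ∈ Km ∧ A.votes Km Ki e j i = some true then some (e.2.1 i j).2 else none)

/-- Identity `i` is excluded in step (4) or step (8). -/
def excluded (e : A.Seed n) (i : Fin N) : Prop :=
  A.unproved Km Ki e i ∨ ∃ j, A.votes Km Ki e j i = some true ∧
    ¬ T.Opens (A.coms Km Ki e i) j (A.reply n (A.view₆ Km Ki e) i j)

/-- The opening for the corrupted identity `i` that miner `j` sends to the hybrid functionality. -/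
def inputs (e : A.Seed n) (j : Fin m) (i : Fin N) : Option (Opening F n) :=
  if j ∈ Km then A.input n (A.view₆ Km Ki e) j i
  else if T.Opens (A.coms Km Ki e i) j (A.opening n (A.view₄ Km Ki e) i j) then
    A.opening n (A.view₄ Km Ki e) i j
  else if T.Opens (A.coms Km Ki e i) j (A.reply n (A.view₆ Km Ki e) i j) then
    A.reply n (A.view₆ Km Ki e) i j
  else none

/-- The bids of the corrupted identities, `f i` for the ones that are not excluded. -/
def corruptBids (e : A.Seed n) (f : Fin N → F) (i : Fin N) : F :=
  if i ∈ Ki then if A.excluded Km Ki e i then 0 else f i else 0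

/-- The bids of the corrupted identities, as the hybrid functionality reconstructs them. -/
def reconstructedBids (e : A.Seed n) : Fin N → F :=
  A.corruptBids Km Ki e fun i =>
    T.reconstructBid n (A.coms Km Ki e i) fun j => A.inputs Km Ki e j i

section PolyTime

theorem polyLength_base (haux : PolyBounded aux) : PolyLength A.Base :=
  (PolyLength.bits haux).prod ((PolyLength.bits A.coins_poly).prod (T.polyLength_crs.pi m))

theorem polyLength_seed (haux : PolyBounded aux) : PolyLength A.Seed :=
  (A.polyLength_base haux).prod (T.polyLength_committedShares.prod (T.polyLength_proof.pi N))

theorem polyTime_view₁ : PolyTime fun n (x : A.Base n) => A.view₁ Km x :=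
  (PolyTime.id.fst.pair PolyTime.id.snd.fst).pair
    (PolyTime.restrict _ fun j => PolyTime.id.snd.snd.apply j)

theorem polyTime_crsVector : PolyTime (β := fun n => Fin m → T.CRS n)
    fun n (x : A.Base n) => A.crsVector Km x := by
  refine PolyTime.pi (f := fun j n (x : A.Base n) => A.crsVector Km x j) fun j => ?_
  unfold crsVector
  by_cases h : j ∈ Km
  · simpa only [if_pos h] using ((A.crs_poly.comp (A.polyTime_view₁ Km)).apply j).getD
      T.polyLength_crs (PolyTime.const fun _ => _)
  · simpa only [if_neg h] using PolyTime.id.snd.snd.apply j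

theorem polyTime_view₂ : PolyTime fun n (e : A.Seed n) => A.view₂ Km Ki e :=
  ((A.polyTime_view₁ Km).comp PolyTime.id.fst).pair
    (PolyTime.restrict (β := fun n => Fin m → T.Com n) _ fun i =>
      PolyTime.pi fun j => ((PolyTime.id.snd.fst.apply i).apply j).fst)

theorem polyTime_coms (i : Fin N) : PolyTime (β := fun n => Option (Fin m → T.Com n))
    fun n (e : A.Seed n) => A.coms Km Ki e i := by
  unfold coms
  by_cases h : i ∈ Ki
  · simpa only [if_pos h] using (A.com_poly.comp (A.polyTime_view₂ Km Ki)).apply i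
  · simpa only [if_neg h] using PolyTime.some (β := fun n => Fin m → T.Com n)
      (PolyTime.pi fun j => ((PolyTime.id.snd.fst.apply i).apply j).fst)

theorem polyTime_view₃ : PolyTime fun n (e : A.Seed n) => A.view₃ Km Ki e :=
  (A.polyTime_view₂ Km Ki).pair (PolyTime.restrict _ fun i => PolyTime.id.snd.snd.apply i)

theorem polyTime_proofs (i : Fin N) : PolyTime (β := fun n => Option (T.Proof n))
    fun n (e : A.Seed n) => A.proofs Km Ki e i := by
  unfold proofs
  by_cases h : i ∈ Ki
  · simpa only [if_pos h] using (A.proof_poly.comp (A.polyTime_view₃ Km Ki)).apply i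
  · simpa only [if_neg h] using (PolyTime.id.snd.snd.apply i).some

theorem polyTime_stmt (i : Fin N) : PolyTime fun n (e : A.Seed n) => A.stmt Km Ki e i :=
  (PolyTime.const (β := fun _ => Fin N) fun _ => i).pair
    ((A.polyTime_coms Km Ki i).getD (T.polyLength_com.pi m) (PolyTime.const fun _ => _))

theorem polyTime_proofD (i : Fin N) : PolyTime fun n (e : A.Seed n) => A.proofD Km Ki e i :=
  (A.polyTime_proofs Km Ki i).getD T.polyLength_proof (PolyTime.const fun _ => _)

theorem polyPred_unproved (i : Fin N) :
    PolyPred fun n (e : A.Seed n) => A.unproved Km Ki e i :=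
  (PolyPred.const _).and ((PolyPred.of_finite (· = true) (A.polyTime_coms Km Ki i).isSome).and
    ((PolyPred.of_finite (· = true) (A.polyTime_proofs Km Ki i).isSome).and
      (PolyPred.of_finite (· = true) (T.nizk.V_poly.comp (((A.polyTime_crsVector Km).comp
        PolyTime.id.fst).pair ((A.polyTime_stmt Km Ki i).pair (A.polyTime_proofD Km Ki i))))))).not

theorem polyTime_view₄ : PolyTime fun n (e : A.Seed n) => A.view₄ Km Ki e := by
  refine (A.polyTime_view₃ Km Ki).pair (PolyTime.pi (β := fun n => Fin m → Option (Opening F n))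
    fun i => PolyTime.pi (β := fun n => Option (Opening F n)) fun j => ?_)
  by_cases h : i ∉ Ki ∧ j ∈ Km
  · simpa only [if_pos h] using ((PolyTime.id.snd.fst.apply i).apply j).snd.some
  · simpa only [if_neg h] using PolyTime.const fun _ => none

variable [Finite F]

theorem polyTime_honestVote (j : Fin m) (i : Fin N) : PolyTime (β := fun _ => Option Bool)
    fun n (e : A.Seed n) => A.honestVote Km Ki e j i :=
  (A.polyPred_unproved Km Ki i).polyTime_ite (PolyLength.const _) (PolyTime.const fun _ => none)
    (PolyTime.some (((PolyPred.const _).and (T.polyPred_opens j (A.polyTime_coms Km Ki i)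
      (((A.opening_poly.comp (A.polyTime_view₄ Km Ki)).apply i).apply j)).not).decide))

theorem polyTime_view₅ : PolyTime fun n (e : A.Seed n) => A.view₅ Km Ki e := by
  refine (A.polyTime_view₄ Km Ki).pair (PolyTime.pi (β := fun _ => Fin N → Option Bool)
    fun j => PolyTime.pi (β := fun _ => Option Bool) fun i => ?_)
  by_cases h : j ∈ Km
  · simpa only [if_pos h] using PolyTime.const fun _ => none
  · simpa only [if_neg h] using A.polyTime_honestVote Km Ki j i

theorem polyTime_votes (j : Fin m) (i : Fin N) : PolyTime (β := fun _ => Option Bool)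
    fun n (e : A.Seed n) => A.votes Km Ki e j i := by
  unfold votes
  by_cases h : j ∈ Km
  · simpa only [if_pos h] using
      ((A.vote_poly.comp (A.polyTime_view₅ Km Ki)).apply j).apply i
  · simpa only [if_neg h] using A.polyTime_honestVote Km Ki j i

theorem polyPred_votes (j : Fin m) (i : Fin N) :
    PolyPred fun n (e : A.Seed n) => A.votes Km Ki e j i = some true :=
  PolyPred.eq (β := fun _ => Option Bool) (PolyLength.const _) (A.polyTime_votes Km Ki j i)
    (PolyTime.const fun _ => some true)

theorem polyTime_view₆ : PolyTime fun n (e : A.Seed n) => A.view₆ Km Ki e := by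
  refine (A.polyTime_view₅ Km Ki).pair (PolyTime.pi (β := fun n => Fin m → Option (Opening F n))
    fun i => PolyTime.pi (β := fun n => Option (Opening F n)) fun j => ?_)
  by_cases h : i ∈ Ki
  · simpa only [if_pos h] using PolyTime.const fun _ => none
  · simp only [if_neg h]
    exact ((PolyPred.const _).and (A.polyPred_votes Km Ki j i)).polyTime_ite
      polyLength_opening.option ((PolyTime.id.snd.fst.apply i).apply j).snd.some
      (PolyTime.const fun _ => none)

theorem polyPred_opens_reply (i : Fin N) (j : Fin m) : PolyPred fun n (e : A.Seed n) =>
    T.Opens (A.coms Km Ki e i) j (A.reply n (A.view₆ Km Ki e) i j) :=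
  T.polyPred_opens j (A.polyTime_coms Km Ki i)
    (((A.reply_poly.comp (A.polyTime_view₆ Km Ki)).apply i).apply j)

theorem polyPred_excluded (i : Fin N) :
    PolyPred fun n (e : A.Seed n) => A.excluded Km Ki e i :=
  (A.polyPred_unproved Km Ki i).or (PolyPred.exists_fin fun j =>
    (A.polyPred_votes Km Ki j i).and (A.polyPred_opens_reply Km Ki i j).not)

theorem polyTime_inputs (j : Fin m) (i : Fin N) : PolyTime (β := fun n => Option (Opening F n))
    fun n (e : A.Seed n) => A.inputs Km Ki e j i := by
  unfold inputs
  by_cases h : j ∈ Km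
  · simpa only [if_pos h] using
      ((A.input_poly.comp (A.polyTime_view₆ Km Ki)).apply j).apply i
  · simp only [if_neg h]
    have ho : PolyTime fun n (e : A.Seed n) => A.opening n (A.view₄ Km Ki e) i j :=
      ((A.opening_poly.comp (A.polyTime_view₄ Km Ki)).apply i).apply j
    exact (T.polyPred_opens j (A.polyTime_coms Km Ki i) ho).polyTime_ite
      polyLength_opening.option ho
      ((A.polyPred_opens_reply Km Ki i j).polyTime_ite polyLength_opening.option
        (((A.reply_poly.comp (A.polyTime_view₆ Km Ki)).apply i).apply j)
        (PolyTime.const fun _ => none))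

theorem polyTime_corruptBids {α : ℕ → Type} [∀ n, BitCode (α n)] {e : ∀ n, α n → A.Seed n}
    {f : Fin N → ∀ n, α n → F} (he : PolyTime e) (hf : ∀ i, PolyTime (β := fun _ => F) (f i)) :
    PolyTime (β := fun _ => Fin N → F)
      fun n a => A.corruptBids Km Ki (e n a) fun i => f i n a := by
  refine PolyTime.pi (β := fun _ => F)
    (f := fun i n a => A.corruptBids Km Ki (e n a) (fun i => f i n a) i) fun i => ?_
  unfold corruptBids
  by_cases h : i ∈ Ki
  · simp only [if_pos h]
    exact PolyPred.polyTime_ite (PolyTime.comp (A.polyPred_excluded Km Ki i) he)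
      (PolyLength.const F) (PolyTime.const fun _ => 0) (hf i)
  · simpa only [if_neg h] using PolyTime.const (β := fun _ => F) fun _ => 0

theorem polyTime_reconstructedBids : PolyTime (β := fun _ => Fin N → F)
    fun n (e : A.Seed n) => A.reconstructedBids Km Ki e :=
  A.polyTime_corruptBids Km Ki PolyTime.id fun i =>
    T.polyTime_reconstructBid (A.polyTime_coms Km Ki i) fun j => A.polyTime_inputs Km Ki j i

end PolyTime

end Adversary

end Protocol

theorem majorityValue_eq_some {m : ℕ} {α : Type} {a : Fin m → Option α} {v : α}
    (h : m < 2 * (Finset.univ.filter fun j => a j = some v).card) : majorityValue a = some v := by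
  have hex : ∃ v, m < 2 * (Finset.univ.filter fun j => a j = some v).card := ⟨v, h⟩
  unfold majorityValue
  rw [dif_pos hex, Option.some_inj]
  by_contra hne
  have hdisj : Disjoint (Finset.univ.filter fun j => a j = some hex.choose)
      (Finset.univ.filter fun j => a j = some v) := by
    rw [Finset.disjoint_filter]
    exact fun j _ hchosen hv => hne (Option.some_inj.1 (hchosen.symm.trans hv))
  have hunion := Finset.card_le_univ ((Finset.univ.filter fun j => a j = some hex.choose) ∪
    (Finset.univ.filter fun j => a j = some v))
  rw [Finset.card_union_of_disjoint hdisj, Fintype.card_fin] at hunion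
  have := hex.choose_spec
  omega

theorem div_two_add_one_le_card_compl {m : ℕ} {Km : Finset (Fin m)} (hKm : 2 * Km.card < m) :
    m / 2 + 1 ≤ Kmᶜ.card := by
  rw [Finset.card_compl, Fintype.card_fin]
  omega

theorem majorityValue_of_mem_compl {m : ℕ} {Km : Finset (Fin m)} (hKm : 2 * Km.card < m)
    {α : Type} (a : Fin m → Option α) (v : α) :
    majorityValue (fun j => if j ∈ Km then a j else some v) = some v := by
  have hmajority := div_two_add_one_le_card_compl hKm
  refine majorityValue_eq_some (lt_of_lt_of_le (b := 2 * Kmᶜ.card) (by omega)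
    (Nat.mul_le_mul_left 2 (Finset.card_le_card fun j hj => ?_)))
  simp [Finset.mem_compl.1 hj]

namespace Protocol

variable {F : Type} [Field F] [BitCode F] {m N : ℕ} (T : Protocol F m N)

theorem reconstructBid_eq (hbinding : T.cs.PerfectlyBinding) {Km : Finset (Fin m)}
    (hKm : 2 * Km.card < m) {n : ℕ} {x : ShareStmt N m T.cs n} {w : ShareWit F m n}
    (hR : T.Rel n x w) {o : Fin m → Option (Opening F n)}
    (ho : ∀ j ∉ Km, T.Opens (some x.2) j (o j)) : T.reconstructBid n (some x.2) o = w.1 := by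
  obtain ⟨hopens, hsharing⟩ := hR
  unfold reconstructBid
  rw [reconstruct_eq_some T.pt_injective hsharing, Option.getD_some]
  · have hsub : Kmᶜ ⊆ Finset.univ.filter fun j => T.Opens (some x.2) j (o j) := by
      intro j hj
      simpa using ho j (Finset.mem_compl.1 hj)
    have := Finset.card_le_card hsub
    have := div_two_add_one_le_card_compl hKm
    unfold threshold
    omega
  · intro j hj
    simp only [Finset.mem_filter, Finset.mem_univ, true_and] at hj
    obtain ⟨c, o', hc, ho', hcommit⟩ := hj
    obtain rfl := Option.some_inj.1 hc
    rw [ho', Option.elim_some]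
    refine T.enc_injective n ?_
    by_contra hne
    exact hbinding n _ _ o'.2 (w.2 j).2 hne (hcommit.trans (hopens j).symm)

/-- Commitments to `hop`, and the openings that are shown to corrupted miners. -/
def shown (Km : Finset (Fin m)) {n : ℕ} (hop : Fin N → Fin m → Opening F n) :
    T.CommittedShares n :=
  fun i j => (T.commitTo n (hop i j), if j ∈ Km then hop i j else (0, zeroBits n))

namespace Adversary

variable {T} {aux : ℕ → ℕ} (A : T.Adversary aux) (Km : Finset (Fin m)) (Ki : Finset (Fin N))
  {n : ℕ}

theorem reconstructedBids_eq_corruptBids (hbinding : T.cs.PerfectlyBinding)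
    (hKm : 2 * Km.card < m) (e : A.Seed n) (w : Fin N → ShareWit F m n)
    (hw : ∀ i ∈ Ki, T.nizk.V n (A.crsVector Km e.1, A.stmt Km Ki e i, A.proofD Km Ki e i) = true →
      T.Rel n (A.stmt Km Ki e i) (w i)) :
    A.reconstructedBids Km Ki e = A.corruptBids Km Ki e fun i => (w i).1 := by
  funext i
  unfold reconstructedBids corruptBids
  split_ifs with hi hex
  · rfl
  · simp only [excluded, not_or, not_exists, not_and, not_not] at hex
    obtain ⟨hproved, hanswered⟩ := hex
    obtain ⟨hcom, -, hV⟩ := by simpa only [unproved, hi, true_and, not_not] using hproved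
    have hcom : A.coms Km Ki e i = some (A.stmt Km Ki e i).2 := by
      obtain ⟨c, hc⟩ := Option.isSome_iff_exists.1 hcom
      simp [stmt, hc]
    beta_reduce
    rw [hcom]
    refine T.reconstructBid_eq hbinding hKm (hw i hi hV) fun j hj => ?_
    rw [← hcom]
    simp only [inputs, if_neg hj]
    by_cases hopening : T.Opens (A.coms Km Ki e i) j (A.opening n (A.view₄ Km Ki e) i j)
    · rwa [if_pos hopening]
    · have hreply : T.Opens (A.coms Km Ki e i) j (A.reply n (A.view₆ Km Ki e) i j) := by
        refine hanswered j ?_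
        simp only [votes, if_neg hj, honestVote, if_neg hproved, hi, hopening, not_false_eq_true,
          and_self, decide_true]
      rwa [if_neg hopening, if_pos hreply]
  · rfl

/-- The bids of the corrupted identities, and the view of the adversary before the outcome. -/
abbrev PreOutcome (n : ℕ) : Type := (Fin N → F) × T.View₆ aux A.coins n

/-- What the first steps of the execution determine for its last step. -/
def preOutcome (e : A.Seed n) : A.PreOutcome n :=
  (A.reconstructedBids Km Ki e, A.view₆ Km Ki e)

/-- The last step of the ideal execution. -/
def finalize (b : Fin N → F) (x : A.PreOutcome n) :
    PMF (T.HonestOut n × T.View aux A.coins n) :=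
  (T.FMPC n fun i => if i ∈ Ki then x.1 i else b i).bind fun out =>
    PMF.pure ((restrict Kmᶜ fun _ => some out, restrict Kiᶜ fun _ => some out), (x.2, out))

section Execution

variable (x : A.Base n) (hop : Fin N → Fin m → Opening F n) (hproof : Fin N → T.Proof n)

/-- The execution after all sampling, except for that of the outcome. -/
def execution : PMF (T.HonestOut n × T.View aux A.coins n) := do
  let e : A.Seed n := (x, T.shown Km hop, hproof)
  let bad₁ : Finset (Fin N) := Finset.univ.filter fun i => ¬ ∃ c π,
    A.coms Km Ki e i = some c ∧ A.proofs Km Ki e i = some π ∧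
      T.nizk.V n (A.crsVector Km x, (i, c), π) = true
  let v₄ : T.View₄ aux A.coins n :=
    (A.view₃ Km Ki e, fun i j => if i ∉ Ki ∧ j ∈ Km then some (hop i j) else none)
  let opening : Fin N → Fin m → Option (Opening F n) := fun i j =>
    if i ∈ Ki then A.opening n v₄ i j else some (hop i j)
  let hvote : Fin m → Fin N → Option Bool := fun j i =>
    if i ∈ bad₁ then none else some (decide (¬ T.Opens (A.coms Km Ki e i) j (opening i j)))
  let v₅ : T.View₅ aux A.coins n := (v₄, fun j i => if j ∈ Km then none else hvote j i)
  let vote : Fin m → Fin N → Option Bool := fun j i =>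
    if j ∈ Km then A.vote n v₅ j i else hvote j i
  let hreply : Fin N → Fin m → Option (Opening F n) := fun i j =>
    if vote j i = some true then some (hop i j) else none
  let v₆ : T.View₆ aux A.coins n := (v₅, fun i j => if i ∈ Ki then none else hreply i j)
  let reply : Fin N → Fin m → Option (Opening F n) := fun i j =>
    if i ∈ Ki then A.reply n v₆ i j else hreply i j
  let bad₂ : Finset (Fin N) := bad₁ ∪ Finset.univ.filter fun i =>
    ∃ j, vote j i = some true ∧ ¬ T.Opens (A.coms Km Ki e i) j (reply i j)
  let input : Fin m → Fin N → Option (Opening F n) := fun j i =>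
    if j ∈ Km then A.input n v₆ j i
    else if T.Opens (A.coms Km Ki e i) j (opening i j) then opening i j
    else if T.Opens (A.coms Km Ki e i) j (reply i j) then reply i j
    else none
  let out ← T.FTFM n bad₂ (A.coms Km Ki e) input
  let v : T.View aux A.coins n := (v₆, out)
  let ann : Fin m → Option (T.Out n) := fun j => if j ∈ Km then A.announce n v j else some out
  return ((restrict Kmᶜ fun _ => some out, restrict Kiᶜ fun _ => majorityValue ann), v)

theorem real_eq_execution [Fintype F] (b : Fin N → F)
    (z : Bits (aux n)) : T.real Km Ki A n b z =
      (PMF.uniformOfFintype (Bits (A.coins n))).bind fun ω =>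
      (indep fun _ : Fin m => T.nizk.K n).bind fun h =>
      (indep fun i : Fin N => share (threshold m) T.pt (b i)).bind fun s =>
      (PMF.uniformOfFintype (Fin N → Fin m → Bits n)).bind fun r =>
      (indep fun i : Fin N => T.nizk.P n (A.crsVector Km (z, ω, h),
        (i, fun j => T.commitTo n (s i j, r i j)), (b i, fun j => (s i j, r i j)))).bind fun π =>
      A.execution Km Ki (z, ω, h) (fun i j => (s i j, r i j)) π := rfl

/-- The opening of the share of identity `i` for miner `j` that is sent in step (5). -/
def sentOpening (e : A.Seed n) (i : Fin N) (j : Fin m) : Option (Opening F n) :=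
  if i ∈ Ki then A.opening n (A.view₄ Km Ki e) i j else some (hop i j)

/-- The opening of the share of identity `i` for miner `j` that is broadcast in step (7). -/
def sentReply (e : A.Seed n) (i : Fin N) (j : Fin m) : Option (Opening F n) :=
  if i ∈ Ki then A.reply n (A.view₆ Km Ki e) i j
  else if A.votes Km Ki e j i = some true then some (hop i j) else none

variable {x hop hproof} {e : A.Seed n} {i : Fin N} {j : Fin m}

theorem coms_of_notMem (hshown : e.2.1 = T.shown Km hop) (hi : i ∉ Ki) :
    A.coms Km Ki e i = some fun j => T.commitTo n (hop i j) := by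
  simp only [coms, if_neg hi, hshown, shown]

theorem opens_of_notMem (hshown : e.2.1 = T.shown Km hop) (hi : i ∉ Ki) :
    T.Opens (A.coms Km Ki e i) j (some (hop i j)) :=
  ⟨_, _, A.coms_of_notMem Km Ki hshown hi, rfl, rfl⟩

theorem unproved_iff
    (hV : ∀ i ∉ Ki, T.nizk.V n (A.crsVector Km e.1, A.stmt Km Ki e i, e.2.2 i) = true) :
    A.unproved Km Ki e i ↔ ¬ ∃ c π, A.coms Km Ki e i = some c ∧ A.proofs Km Ki e i = some π ∧
      T.nizk.V n (A.crsVector Km e.1, (i, c), π) = true := by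
  by_cases hi : i ∈ Ki
  · simp only [unproved, hi, true_and, not_iff_not, stmt, proofD, Option.isSome_iff_exists]
    constructor
    · rintro ⟨⟨c, hc⟩, ⟨π, hπ⟩, hv⟩
      exact ⟨c, π, hc, hπ, by simpa only [hc, hπ, Option.getD_some] using hv⟩
    · rintro ⟨c, π, hc, hπ, hv⟩
      exact ⟨⟨c, hc⟩, ⟨π, hπ⟩, by simpa only [hc, hπ, Option.getD_some] using hv⟩
  · simp only [unproved, hi, false_and, false_iff, not_not]
    have hv := hV i hi
    simp only [stmt, coms, if_neg hi, Option.getD_some] at hv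
    exact ⟨_, _, if_neg hi, if_neg hi, hv⟩

theorem view₄_eq (hshown : e.2.1 = T.shown Km hop) : A.view₄ Km Ki e =
    (A.view₃ Km Ki e, fun i j => if i ∉ Ki ∧ j ∈ Km then some (hop i j) else none) := by
  refine Prod.ext rfl (funext₂ fun i j => if_ctx_congr Iff.rfl (fun h => ?_) fun _ => rfl)
  simp only [hshown, shown, if_pos h.2]

theorem honestVote_eq (hshown : e.2.1 = T.shown Km hop) :
    A.honestVote Km Ki e j i = if A.unproved Km Ki e i then none
      else some (decide (¬ T.Opens (A.coms Km Ki e i) j (A.sentOpening Km Ki hop e i j))) := by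
  by_cases hi : i ∈ Ki
  · simp only [honestVote, sentOpening, hi, true_and, if_true]
  · simp only [honestVote, sentOpening, hi, false_and, if_false,
      A.opens_of_notMem Km Ki hshown hi, not_true_eq_false]

theorem votes_ne_some_true (hi : i ∉ Ki) (hj : j ∉ Km) : A.votes Km Ki e j i ≠ some true := by
  simp [votes, hj, honestVote, hi]

theorem view₆_eq (hshown : e.2.1 = T.shown Km hop) : A.view₆ Km Ki e =
    (A.view₅ Km Ki e, fun i j => if i ∈ Ki then none
      else if A.votes Km Ki e j i = some true then some (hop i j) else none) := by
  refine Prod.ext rfl (funext₂ fun i j => if_ctx_congr Iff.rfl (fun _ => rfl) fun hi => ?_)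
  by_cases hj : j ∈ Km
  · simp only [hshown, shown, hj, true_and, if_true]
  · simp only [hj, false_and, if_false, if_neg (A.votes_ne_some_true Km Ki hi hj)]

theorem mem_and_excluded_iff (hshown : e.2.1 = T.shown Km hop) :
    i ∈ Ki ∧ A.excluded Km Ki e i ↔ A.unproved Km Ki e i ∨
      ∃ j, A.votes Km Ki e j i = some true ∧
        ¬ T.Opens (A.coms Km Ki e i) j (A.sentReply Km Ki hop e i j) := by
  by_cases hi : i ∈ Ki
  · simp only [hi, true_and, excluded, sentReply, if_true]
  · simp only [hi, false_and, false_iff, not_or, not_exists, not_and, not_not]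
    refine ⟨fun h => hi h.1, fun j hj => ?_⟩
    rw [sentReply, if_neg hi, if_pos hj]
    exact A.opens_of_notMem Km Ki hshown hi

/-- The inputs to the hybrid functionality, those for honest identities included. -/
def sentInputs (hop : Fin N → Fin m → Opening F n) (e : A.Seed n) (j : Fin m) (i : Fin N) :
    Option (Opening F n) :=
  if j ∈ Km then A.input n (A.view₆ Km Ki e) j i
  else if T.Opens (A.coms Km Ki e i) j (A.sentOpening Km Ki hop e i j) then
    A.sentOpening Km Ki hop e i j
  else if T.Opens (A.coms Km Ki e i) j (A.sentReply Km Ki hop e i j) then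
    A.sentReply Km Ki hop e i j
  else none

theorem reconstructBid_sentInputs (hbinding : T.cs.PerfectlyBinding) (hKm : 2 * Km.card < m)
    {b : F} (hshare : IsSharing (threshold m) T.pt b fun j => (hop i j).1)
    (hshown : e.2.1 = T.shown Km hop) (hi : i ∉ Ki) :
    (T.reconstructBid n (A.coms Km Ki e i) fun j => A.sentInputs Km Ki hop e j i) = b := by
  rw [A.coms_of_notMem Km Ki hshown hi]
  refine T.reconstructBid_eq hbinding hKm (x := (i, fun j => T.commitTo n (hop i j)))
    (w := (b, hop i)) ⟨fun _ => rfl, hshare⟩ fun j hj => ?_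
  have hopens := A.opens_of_notMem Km Ki (j := j) hshown hi
  rw [sentInputs, if_neg hj, sentOpening, if_neg hi, if_pos hopens]
  exact ⟨_, _, rfl, rfl, rfl⟩

theorem reconstructed_sentInputs (hbinding : T.cs.PerfectlyBinding) (hKm : 2 * Km.card < m)
    {b : Fin N → F} (hshare : ∀ i, IsSharing (threshold m) T.pt (b i) fun j => (hop i j).1)
    (hshown : e.2.1 = T.shown Km hop) :
    (fun i => if i ∈ Ki ∧ A.excluded Km Ki e i then 0
      else T.reconstructBid n (A.coms Km Ki e i) fun j => A.sentInputs Km Ki hop e j i) =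
      fun i => if i ∈ Ki then A.reconstructedBids Km Ki e i else b i := by
  funext i
  by_cases hi : i ∈ Ki
  · simp only [hi, true_and, if_true, reconstructedBids, corruptBids, sentInputs, inputs,
      sentOpening, sentReply]
  · simp only [hi, false_and, if_false,
      A.reconstructBid_sentInputs Km Ki hbinding hKm (hshare i) hshown hi]

theorem execution_eq_finalize (hbinding : T.cs.PerfectlyBinding) (hKm : 2 * Km.card < m)
    (b : Fin N → F) (hshare : ∀ i, IsSharing (threshold m) T.pt (b i) fun j => (hop i j).1)
    (hV : ∀ i, T.nizk.V n (A.crsVector Km x, (i, fun j => T.commitTo n (hop i j)), hproof i)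
      = true) :
    A.execution Km Ki x hop hproof =
      A.finalize Km Ki b (A.preOutcome Km Ki (x, T.shown Km hop, hproof)) := by
  unfold execution
  extract_lets e bad₁ v₄ opening hvote v₅ vote hreply v₆ reply bad₂ input
  have hshown : e.2.1 = T.shown Km hop := rfl
  have hbad₁ (i) : i ∈ bad₁ ↔ A.unproved Km Ki e i := by
    rw [A.unproved_iff Km Ki fun i hi => ?_, Finset.mem_filter_univ]
    rw [stmt, A.coms_of_notMem Km Ki hshown hi]
    exact hV i
  have hv₄ : v₄ = A.view₄ Km Ki e := (A.view₄_eq Km Ki hshown).symm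
  have hopening : opening = A.sentOpening Km Ki hop e := by
    funext i j
    simp only [opening, sentOpening, hv₄]
  have hhvote : hvote = A.honestVote Km Ki e := by
    funext j i
    simp only [hvote, hbad₁, hopening, A.honestVote_eq Km Ki hshown]
  have hv₅ : v₅ = A.view₅ Km Ki e := by simp only [v₅, view₅, hv₄, hhvote]
  have hvotes : vote = A.votes Km Ki e := by
    funext j i
    simp only [vote, votes, hhvote, hv₅]
  have hv₆ : v₆ = A.view₆ Km Ki e := by
    simp only [v₆, hv₅, hreply, hvotes, A.view₆_eq Km Ki hshown]
  have hreplies : reply = A.sentReply Km Ki hop e := by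
    funext i j
    simp only [reply, hreply, sentReply, hv₆, hvotes]
  have hbad₂ (i) : i ∈ bad₂ ↔ i ∈ Ki ∧ A.excluded Km Ki e i := by
    rw [A.mem_and_excluded_iff Km Ki hshown, Finset.mem_union, hbad₁, Finset.mem_filter_univ,
      hvotes, hreplies]
  have hinput : input = A.sentInputs Km Ki hop e := by
    funext j i
    simp only [input, sentInputs, hv₆, hopening, hreplies]
  unfold FTFM finalize FMPC
  simp only [hbad₂, hinput, A.reconstructed_sentInputs Km Ki hbinding hKm hshare hshown,
    majorityValue_of_mem_compl hKm, hv₆]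
  rfl

end Execution

end Adversary

end Protocol

theorem uniformOfFintype_coins_eq_indep (k l n : ℕ) :
    PMF.uniformOfFintype (Fin k → Fin l → Bits n) =
      indep fun _ => indep fun _ => PMF.uniformOfFintype (Bits n) := by
  rw [uniformOfFintype_eq_indep (α := Fin l → Bits n), uniformOfFintype_eq_indep (α := Bits n)]

theorem PPT.uniform_coins {α : ℕ → Type} [∀ n, BitCode (α n)] (k l : ℕ) :
    PPT fun n (_ : α n) => PMF.uniformOfFintype (Fin k → Fin l → Bits n) := by
  simp only [uniformOfFintype_coins_eq_indep]
  exact PPT.indep fun _ => PPT.indep fun _ => PPT.uniform_bits PolyBounded.id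

/-- The openings with given shares and coins. -/
def openings {F : Type} {m N n : ℕ} (s : Fin N → Fin m → F) (r : Fin N → Fin m → Bits n) :
    Fin N → Fin m → Opening F n :=
  fun i j => (s i j, r i j)

theorem polyTime_openings {F : Type} [BitCode F] {m N : ℕ} {α : ℕ → Type} [∀ n, BitCode (α n)]
    (s : ℕ → Fin N → Fin m → F) {r : ∀ n, α n → Fin N → Fin m → Bits n} (hr : PolyTime r) :
    PolyTime (β := fun n => Fin N → Fin m → Opening F n) fun n a => openings (s n) (r n a) :=
  PolyTime.pi (β := fun n => Fin m → Opening F n) fun i => PolyTime.pi fun j =>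
    (PolyTime.const (β := fun _ => F) fun n => s n i j).pair ((hr.apply i).apply j)

namespace Protocol

variable {F : Type} [Field F] [BitCode F] {m N : ℕ} (T : Protocol F m N)

/-- The shares of the bids `b` for given coefficients of the sharing polynomials. -/
def sharesOf (b : Fin N → F) (a : Fin N → Fin (threshold m - 1) → F) : Fin N → Fin m → F :=
  fun i => shareOf T.pt (b i) (a i)

section PolyTime

variable [Finite F] {α : ℕ → Type} [∀ n, BitCode (α n)]
  {o : ∀ n, α n → Fin N → Fin m → Opening F n}

theorem polyTime_commitments (ho : PolyTime o) (i : Fin N) :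
    PolyTime (β := fun n => Fin m → T.Com n) fun n a j => T.commitTo n (o n a i j) :=
  PolyTime.pi (β := T.Com) fun j => T.polyTime_commitTo ((ho.apply i).apply j)

theorem polyTime_shown (Km : Finset (Fin m)) (ho : PolyTime o) :
    PolyTime (β := T.CommittedShares) fun n a => T.shown Km (o n a) := by
  refine PolyTime.pi (β := fun n => Fin m → T.Com n × Opening F n) fun i => PolyTime.pi fun j =>
    (T.polyTime_commitTo ((ho.apply i).apply j)).pair ?_
  by_cases hj : j ∈ Km
  · simpa only [if_pos hj] using (ho.apply i).apply j
  · simpa only [if_neg hj] using PolyTime.const fun _ => _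

end PolyTime

namespace Adversary

variable {T} {aux : ℕ → ℕ} (A : T.Adversary aux) (Km : Finset (Fin m)) (Ki : Finset (Fin N))
  {n : ℕ}

/-- The proof of the honest identity `i`. -/
def honestProof (b : Fin N → F) (hop : Fin N → Fin m → Opening F n) (x : A.Base n) (i : Fin N) :
    PMF (T.Proof n) :=
  T.nizk.P n (A.crsVector Km x, (i, fun j => T.commitTo n (hop i j)), (b i, hop i))

/-- The execution with fixed shares and a given distribution of the CRSes, up to the outcome. -/
def crsExperiment (G : PMF (Fin m → T.CRS n)) (z : Bits (aux n)) (b : Fin N → F)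
    (s : Fin N → Fin m → F) : PMF (A.PreOutcome n) :=
  G.bind fun h => (PMF.uniformOfFintype (Bits (A.coins n))).bind fun ω =>
    (PMF.uniformOfFintype (Fin N → Fin m → Bits n)).bind fun r =>
    (indep (A.honestProof Km b (openings s r) (z, ω, h))).bind fun π =>
    PMF.pure (A.preOutcome Km Ki ((z, ω, h), T.shown Km (openings s r), π))

theorem real_eq [Fintype F] (hbinding : T.cs.PerfectlyBinding)
    (hcomplete : T.nizk.Complete T.Rel) (hKm : 2 * Km.card < m) (b : Fin N → F)
    (z : Bits (aux n)) : T.real Km Ki A n b z =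
      ((PMF.uniformOfFintype (Fin N → Fin (threshold m - 1) → F)).bind fun a =>
        A.crsExperiment Km Ki (indep fun _ => T.nizk.K n) z b (T.sharesOf b a)).bind
        (A.finalize Km Ki b) := by
  rw [real_eq_execution]
  simp only [indep_share, PMF.bind_map, crsExperiment, PMF.bind_bind, PMF.pure_bind]
  rw [PMF.bind_comm]
  conv_rhs => rw [PMF.bind_comm]
  refine bind_congr_of_mem_support fun h hh => ?_
  rw [PMF.bind_comm]
  refine bind_congr_of_mem_support fun a _ => bind_congr_of_mem_support fun ω _ =>
    bind_congr_of_mem_support fun r _ => bind_congr_of_mem_support fun π hπ => ?_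
  have ht : 1 ≤ threshold m := by unfold threshold; omega
  have hshare : ∀ i, IsSharing (threshold m) T.pt (b i) (T.sharesOf b a i) := fun i =>
    isSharing_shareOf ht T.pt (b i) (a i)
  refine A.execution_eq_finalize Km Ki (hop := openings (T.sharesOf b a) r) hbinding hKm b hshare
    fun i => ?_
  refine hcomplete n _ ?_ _ (b i, openings (T.sharesOf b a) r i) ⟨fun j => rfl, hshare i⟩ _
    (mem_support_indep hπ i)
  refine (div_two_add_one_le_card_compl hKm).trans (Finset.card_le_card fun j hj => ?_)
  have : A.crsVector Km (z, ω, h) j = h j := if_neg (Finset.mem_compl.1 hj)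
  simp only [Finset.mem_filter, Finset.mem_univ, true_and, this]
  exact mem_support_indep hh j

theorem ppt_finalize (b : ℕ → Fin N → F) :
    PPT fun n (x : A.PreOutcome n) => A.finalize Km Ki (b n) x := by
  have hbids : PolyTime (β := fun _ => Fin N → F)
      fun n (x : A.PreOutcome n) i => if i ∈ Ki then x.1 i else b n i := by
    refine PolyTime.pi (β := fun _ => F)
      (f := fun i n (x : A.PreOutcome n) => if i ∈ Ki then x.1 i else b n i) fun i => ?_
    by_cases hi : i ∈ Ki
    · simpa only [if_pos hi] using PolyTime.id.fst.apply i
    · simpa only [if_neg hi] using PolyTime.const (β := fun _ => F) fun n => b n i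
  have hout : PolyTime fun n (x : A.PreOutcome n × T.Out n) => some x.2 := PolyTime.id.snd.some
  exact PPT.bind (PPT.comp (β := fun _ => Fin N → F) T.mech.rule_ppt hbids)
    (PPT.pure (((PolyTime.restrict _ fun _ => hout).pair (PolyTime.restrict _ fun _ => hout)).pair
      (PolyTime.id.fst.snd.pair PolyTime.id.snd)))

variable [Finite F]

theorem ppt_honestProof {α : ℕ → Type} [∀ n, BitCode (α n)] (b : ℕ → Fin N → F)
    {o : ∀ n, α n → Fin N → Fin m → Opening F n} {x : ∀ n, α n → A.Base n} (ho : PolyTime o)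
    (hx : PolyTime x) (i : Fin N) :
    PPT fun n a => A.honestProof Km (b n) (o n a) (x n a) i :=
  T.nizk.P_ppt.comp (((A.polyTime_crsVector Km).comp hx).pair
    (((PolyTime.const (β := fun _ => Fin N) fun _ => i).pair (T.polyTime_commitments ho i)).pair
      ((PolyTime.const (β := fun _ => F) fun n => b n i).pair (ho.apply i))))

theorem polyTime_preOutcome : PolyTime fun n (e : A.Seed n) => A.preOutcome Km Ki e :=
  (A.polyTime_reconstructedBids Km Ki).pair (A.polyTime_view₆ Km Ki)

theorem crsExperiment_compIndist {G G' : ∀ n, PMF (Fin m → T.CRS n)} (hG : CompIndist G G')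
    (z : ∀ n, Bits (aux n)) (b : ℕ → Fin N → F) (s : ℕ → Fin N → Fin m → F) :
    CompIndist (fun n => A.crsExperiment Km Ki (G n) (z n) (b n) (s n))
      (fun n => A.crsExperiment Km Ki (G' n) (z n) (b n) (s n)) := by
  refine hG.bind (PPT.bind (PPT.uniform_bits A.coins_poly) (PPT.bind (PPT.uniform_coins N m)
    (PPT.bind (PPT.indep (A.ppt_honestProof Km b (polyTime_openings s PolyTime.id.snd) ?_))
      (PPT.pure ((A.polyTime_preOutcome Km Ki).comp ?_)))))
  · exact (PolyTime.const z).pair (PolyTime.id.fst.snd.pair PolyTime.id.fst.fst)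
  · exact ((PolyTime.const z).pair (PolyTime.id.fst.fst.snd.pair PolyTime.id.fst.fst.fst)).pair
      ((T.polyTime_shown Km (polyTime_openings s PolyTime.id.fst.snd)).pair PolyTime.id.snd)

end Adversary

end Protocol

/-! ### Simulated proofs -/

theorem polyTime_keysOf {α C K : ℕ → Type} [∀ n, BitCode (α n)] [∀ n, BitCode (C n)]
    [∀ n, BitCode (K n)] {m q : ℕ} (hC : PolyLength C) (hK : PolyLength K)
    {gen : ∀ n, α n → Fin q → C n × K n} {crs : ∀ n, α n → Fin m → C n} (hgen : PolyTime gen)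
    (hcrs : PolyTime crs) :
    PolyTime (β := fun n => Fin m → Option (K n)) fun n a => keysOf (gen n a) (crs n a) := by
  refine PolyTime.pi (β := fun n => Option (K n)) (f := fun j n a => keysOf (gen n a) (crs n a) j)
    fun j => ?_
  have hentry := hcrs.apply j
  unfold keysOf
  clear hcrs
  induction q with
  | zero => simpa using PolyTime.const (β := fun n => Option (K n)) fun _ => none
  | succ q ih =>
    have htail : PolyTime (β := fun n => Fin q → C n × K n) fun n a i => gen n a i.succ :=
      PolyTime.pi (β := fun n => C n × K n) fun i => hgen.apply i.succ
    have hhead := hgen.apply 0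
    refine ((PolyPred.eq hC hhead.fst hentry).polyTime_ite hK.option hhead.snd.some
      (ih htail)).of_eq fun n a => ?_
    rw [List.ofFn_succ, List.find?_cons]
    by_cases h : (gen n a 0).1 = crs n a j <;> simp [h]

theorem NIZK.zkGame_eq_bind {m : ℕ} {Stmt Wit : ℕ → Type} [∀ n, BitCode (Stmt n)]
    [∀ n, BitCode (Wit n)] (Z : NIZK m Stmt Wit) (R : ∀ n, Stmt n → Wit n → Prop)
    (A : Z.ZKAdversary) (simulated : Bool) (n : ℕ) : Z.zkGame R A simulated n =
      (indep fun _ : Fin (A.queries n) => Z.simK n).bind fun g => (A.choose n g).bind fun o =>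
      (if simulated = true then Z.simP n (o.1, keysOf g o.1, o.2.1)
        else Z.P n (o.1, o.2.1, o.2.2.1)).bind fun π =>
      (A.guess n (o.2.2.2, π)).bind fun g => PMF.pure (g && decide (R n o.2.1 o.2.2.1)) := by
  cases simulated <;> rfl

namespace Protocol

/-- The statement that identity `i` proves if it commits to its shares by `c`. -/
def honestStmt {F : Type} [Field F] [BitCode F] {m N : ℕ} {T : Protocol F m N} {n : ℕ}
    (c : T.CommittedShares n) (i : Fin N) : ShareStmt N m T.cs n :=
  (i, fun j => (c i j).1)

namespace Adversary

variable {F : Type} [Field F] [BitCode F] {m N : ℕ} {T : Protocol F m N} {aux : ℕ → ℕ}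
  (A : T.Adversary aux) (Km : Finset (Fin m)) (Ki : Finset (Fin N)) {n : ℕ}

/-- The simulated proof of identity `i`. -/
def simulatedProof (keys : Fin m → Option (T.nizk.Trap n)) (c : T.CommittedShares n)
    (x : A.Base n) (i : Fin N) : PMF (T.Proof n) :=
  T.nizk.simP n (A.crsVector Km x, keys, honestStmt c i)

/-- Simulated proofs of the identities before `k`, honest proofs of the others. -/
def hybridProof (k : ℕ) (b : Fin N → F) (hop : Fin N → Fin m → Opening F n)
    (keys : Fin m → Option (T.nizk.Trap n)) (x : A.Base n) (i : Fin N) : PMF (T.Proof n) :=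
  if i.val < k then A.simulatedProof Km keys (T.shown Km hop) x i else A.honestProof Km b hop x i

/-- The seed of the execution with fixed shares, simulated CRSes, and simulated proofs of the
identities before `k`, together with the openings of all commitments. -/
def hybridSeed (k : ℕ) (z : Bits (aux n)) (b : Fin N → F) (s : Fin N → Fin m → F)
    (g : Fin m → T.CRS n × T.nizk.Trap n) : PMF (A.Seed n × (Fin N → Fin m → Opening F n)) :=
  (PMF.uniformOfFintype (Bits (A.coins n))).bind fun ω =>
    (PMF.uniformOfFintype (Fin N → Fin m → Bits n)).bind fun r =>
    (indep (A.hybridProof Km k b (openings s r)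
      (keysOf g (A.crsVector Km (z, ω, fun j => (g j).1))) (z, ω, fun j => (g j).1))).bind fun π =>
    PMF.pure (((z, ω, fun j => (g j).1), T.shown Km (openings s r), π), openings s r)

/-- The execution with fixed shares, simulated CRSes, and simulated proofs of the identities
before `k`, up to the outcome. -/
def proofExperiment (k : ℕ) (z : Bits (aux n)) (b : Fin N → F) (s : Fin N → Fin m → F) :
    PMF (A.PreOutcome n) :=
  (indep fun _ : Fin m => T.nizk.simK n).bind fun g =>
    (A.hybridSeed Km k z b s g).bind fun e => PMF.pure (A.preOutcome Km Ki e.1)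

theorem crsExperiment_simulated (z : Bits (aux n)) (b : Fin N → F) (s : Fin N → Fin m → F) :
    A.crsExperiment Km Ki (indep fun _ => (T.nizk.simK n).map Prod.fst) z b s =
      A.proofExperiment Km Ki 0 z b s := by
  simp only [indep_map, crsExperiment, PMF.bind_map, proofExperiment, hybridSeed, PMF.bind_bind,
    PMF.pure_bind]
  rfl

theorem majorityGenerated_crsVector (hKm : 2 * Km.card < m) (z : Bits (aux n))
    (ω : Bits (A.coins n)) (g : Fin m → T.CRS n) :
    MajorityGenerated g (A.crsVector Km (z, ω, g)) := by
  refine (div_two_add_one_le_card_compl hKm).trans (Finset.card_le_card fun j hj => ?_)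
  simp only [Finset.mem_filter, Finset.mem_univ, true_and]
  exact ⟨j, (if_neg (Finset.mem_compl.1 hj)).symm⟩

theorem hybridProof_eq_update (i : Fin N) (simulated : Bool) (b : Fin N → F)
    (hop : Fin N → Fin m → Opening F n) (keys : Fin m → Option (T.nizk.Trap n)) (x : A.Base n) :
    A.hybridProof Km (if simulated = true then i + 1 else i) b hop keys x =
      Function.update (A.hybridProof Km i b hop keys x) i
        (if simulated = true then A.simulatedProof Km keys (T.shown Km hop) x i
          else A.honestProof Km b hop x i) := by
  funext j
  by_cases hj : j = i
  · subst hj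
    rw [Function.update_self, hybridProof]
    cases simulated <;> simp
  · have hne : j.val ≠ i.val := fun h => hj (Fin.ext h)
    rw [Function.update_of_ne hj, hybridProof, hybridProof]
    cases simulated
    · rfl
    · have : j.val < i.val + 1 ↔ j.val < i.val := by omega
      simp only [if_true, this]

theorem ppt_simulatedProof {α : ℕ → Type} [∀ n, BitCode (α n)]
    {keys : ∀ n, α n → Fin m → Option (T.nizk.Trap n)} {c : ∀ n, α n → T.CommittedShares n}
    {x : ∀ n, α n → A.Base n} (hkeys : PolyTime keys) (hc : PolyTime c) (hx : PolyTime x)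
    (i : Fin N) : PPT fun n a => A.simulatedProof Km (keys n a) (c n a) (x n a) i :=
  T.nizk.simP_ppt.comp (((A.polyTime_crsVector Km).comp hx).pair (hkeys.pair
    ((PolyTime.const (β := fun _ => Fin N) fun _ => i).pair
      (PolyTime.pi (β := T.Com) fun j => ((hc.apply i).apply j).fst))))

variable [Finite F]

theorem ppt_hybridProof {α : ℕ → Type} [∀ n, BitCode (α n)] (k : ℕ) (b : ℕ → Fin N → F)
    {o : ∀ n, α n → Fin N → Fin m → Opening F n}
    {keys : ∀ n, α n → Fin m → Option (T.nizk.Trap n)} {x : ∀ n, α n → A.Base n}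
    (ho : PolyTime o) (hkeys : PolyTime keys) (hx : PolyTime x) (i : Fin N) :
    PPT fun n a => A.hybridProof Km k (b n) (o n a) (keys n a) (x n a) i := by
  unfold hybridProof
  by_cases h : i.val < k
  · simpa only [if_pos h] using A.ppt_simulatedProof Km hkeys (T.polyTime_shown Km ho) hx i
  · simpa only [if_neg h] using A.ppt_honestProof Km b ho hx i

theorem ppt_hybridSeed (k : ℕ) (z : ∀ n, Bits (aux n)) (b : ℕ → Fin N → F)
    (s : ℕ → Fin N → Fin m → F) : PPT fun n g => A.hybridSeed Km k (z n) (b n) (s n) g := by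
  have hx : PolyTime (β := A.Base) fun n (y : ((Fin m → T.CRS n × T.nizk.Trap n) ×
      Bits (A.coins n)) × (Fin N → Fin m → Bits n)) => (z n, y.1.2, fun j => (y.1.1 j).1) :=
    (PolyTime.const z).pair (PolyTime.id.fst.snd.pair
      (PolyTime.pi (β := T.CRS) fun j => (PolyTime.id.fst.fst.apply j).fst))
  have ho : PolyTime (β := fun n => Fin N → Fin m → Opening F n)
      fun n (y : ((Fin m → T.CRS n × T.nizk.Trap n) × Bits (A.coins n)) ×
        (Fin N → Fin m → Bits n)) => openings (s n) y.2 := polyTime_openings s PolyTime.id.snd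
  refine PPT.bind (PPT.uniform_bits A.coins_poly) (PPT.bind (PPT.uniform_coins N m)
    (PPT.bind (PPT.indep (A.ppt_hybridProof Km k b ho (polyTime_keysOf T.polyLength_crs
      T.polyLength_trap PolyTime.id.fst.fst ((A.polyTime_crsVector Km).comp hx)) hx))
      (PPT.pure ?_)))
  have ho' := ho.comp (PolyTime.id (α := fun n => (((Fin m → T.CRS n × T.nizk.Trap n) ×
    Bits (A.coins n)) × (Fin N → Fin m → Bits n)) × (Fin N → T.Proof n))).fst
  exact ((hx.comp PolyTime.id.fst).pair ((T.polyTime_shown Km ho').pair PolyTime.id.snd)).pair ho'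

/-- The adversary against zero knowledge that has the proof of identity `i` as its challenge, in
the hybrid where the proofs of the identities before `i` are simulated. -/
def zkAdversary (haux : PolyBounded aux) (z : ∀ n, Bits (aux n)) (b : ℕ → Fin N → F)
    (s : ℕ → Fin N → Fin m → F) (i : Fin N) {D : ∀ n, A.PreOutcome n → PMF Bool} (hD : PPT D) :
    T.nizk.ZKAdversary where
  State := A.Seed
  state_poly := A.polyLength_seed haux
  queries _ := m
  queries_poly := PolyBounded.const m
  choose n g := (A.hybridSeed Km i (z n) (b n) (s n) g).bind fun e =>
    PMF.pure (A.crsVector Km e.1.1, (i, fun j => T.commitTo n (e.2 i j)), (b n i, e.2 i), e.1)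
  guess n x := D n (A.preOutcome Km Ki (x.1.1, x.1.2.1, Function.update x.1.2.2 i x.2))
  choose_ppt := by
    refine PPT.bind (A.ppt_hybridSeed Km i z b s) (PPT.pure ?_)
    exact ((A.polyTime_crsVector Km).comp PolyTime.id.snd.fst.fst).pair
      (((PolyTime.const (β := fun _ => Fin N) fun _ => i).pair
        (T.polyTime_commitments PolyTime.id.snd.snd i)).pair
      (((PolyTime.const (β := fun _ => F) fun n => b n i).pair (PolyTime.id.snd.snd.apply i)).pair
        PolyTime.id.snd.fst))
  guess_ppt := by
    exact hD.comp ((A.polyTime_preOutcome Km Ki).comp (PolyTime.id.fst.fst.pair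
      (PolyTime.id.fst.snd.fst.pair (PolyTime.update T.polyLength_proof
        (PolyTime.const fun _ => i) PolyTime.id.fst.snd.snd PolyTime.id.snd))))

section ZeroKnowledge

variable (z : ∀ n, Bits (aux n)) (b : ℕ → Fin N → F) (s : ℕ → Fin N → Fin m → F)

theorem minorityConstrained_zkAdversary (hKm : 2 * Km.card < m) (haux : PolyBounded aux) (i : Fin N)
    {D : ∀ n, A.PreOutcome n → PMF Bool} (hD : PPT D) :
    (A.zkAdversary Km Ki haux z b s i hD).MinorityConstrained := by
  intro n gen o ho
  obtain ⟨e, he, ho⟩ := (PMF.mem_support_bind_iff _ _ _).1 ho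
  obtain ⟨ω, -, he⟩ := (PMF.mem_support_bind_iff _ _ _).1 he
  obtain ⟨r, -, he⟩ := (PMF.mem_support_bind_iff _ _ _).1 he
  obtain ⟨π, -, he⟩ := (PMF.mem_support_bind_iff _ _ _).1 he
  rw [(PMF.mem_support_pure_iff _ _).1 ho, (PMF.mem_support_pure_iff _ _).1 he]
  exact A.majorityGenerated_crsVector Km hKm (z n) ω fun j => (gen j).1

theorem zkGame_zkAdversary (haux : PolyBounded aux)
    (hs : ∀ n i, IsSharing (threshold m) T.pt (b n i) (s n i)) (i : Fin N)
    {D : ∀ n, A.PreOutcome n → PMF Bool} (hD : PPT D) (simulated : Bool) (n : ℕ) :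
    T.nizk.zkGame T.Rel (A.zkAdversary Km Ki haux z b s i hD) simulated n =
      (A.proofExperiment Km Ki (if simulated = true then i + 1 else i) (z n) (b n) (s n)).bind
        (D n) := by
  have hR : ∀ r : Fin N → Fin m → Bits n,
      T.Rel n (i, fun j => T.commitTo n (openings (s n) r i j)) (b n i, openings (s n) r i) :=
    fun r => ⟨fun j => rfl, hs n i⟩
  rw [NIZK.zkGame_eq_bind]
  simp only [zkAdversary, proofExperiment, hybridSeed, PMF.bind_bind, PMF.pure_bind, hR,
    decide_true, Bool.and_true, PMF.bind_pure]
  refine congrArg _ (funext fun g => congrArg _ (funext fun ω => congrArg _ (funext fun r => ?_)))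
  rw [hybridProof_eq_update, indep_update, PMF.bind_bind]
  simp only [PMF.bind_map]
  rw [PMF.bind_comm]
  rfl

theorem proofExperiment_compIndist (hzk : T.nizk.ZeroKnowledge T.Rel) (hKm : 2 * Km.card < m)
    (haux : PolyBounded aux) (hs : ∀ n i, IsSharing (threshold m) T.pt (b n i) (s n i)) :
    CompIndist (fun n => A.proofExperiment Km Ki 0 (z n) (b n) (s n))
      (fun n => A.proofExperiment Km Ki N (z n) (b n) (s n)) := by
  refine CompIndist.iterate (H := fun k n => A.proofExperiment Km Ki k (z n) (b n) (s n))
    fun k hk D hD => ?_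
  have h := hzk.2 (A.zkAdversary Km Ki haux z b s ⟨k, hk⟩ hD)
    (A.minorityConstrained_zkAdversary Km Ki z b s hKm haux ⟨k, hk⟩ hD)
  simpa only [A.zkGame_zkAdversary Km Ki z b s haux hs ⟨k, hk⟩ hD, if_true, Bool.false_eq_true,
    if_false] using h

theorem crsExperiment_compIndist_proofExperiment (hzk : T.nizk.ZeroKnowledge T.Rel)
    (hKm : 2 * Km.card < m) (haux : PolyBounded aux)
    (hs : ∀ n i, IsSharing (threshold m) T.pt (b n i) (s n i)) :
    CompIndist (fun n => A.crsExperiment Km Ki (indep fun _ => T.nizk.K n) (z n) (b n) (s n))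
      (fun n => A.proofExperiment Km Ki N (z n) (b n) (s n)) := by
  have hsim : PPTSampler fun n => (T.nizk.simK n).map Prod.fst :=
    PPT.map (α := fun _ => Fin 0 → Bool) (f := fun n _ => T.nizk.simK n)
      (g := fun _ _ x => x.1) T.nizk.simK_ppt PolyTime.id.snd.fst
  have hcrs := A.crsExperiment_compIndist Km Ki (CompIndist.indep
    (fun _ : Fin m => T.nizk.K_ppt) (fun _ => hsim) fun _ => hzk.1) z b s
  simp only [crsExperiment_simulated] at hcrs
  exact hcrs.trans (A.proofExperiment_compIndist Km Ki z b s hzk hKm haux hs)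

end ZeroKnowledge

end Adversary

end Protocol

/-! ### Knowledge extraction -/

namespace NIZK

variable {m : ℕ} {Stmt Wit : ℕ → Type} [∀ n, BitCode (Stmt n)] [∀ n, BitCode (Wit n)]
  (Z : NIZK m Stmt Wit) {ekLen : ℕ → ℕ} (A : Z.SSEAdversary ekLen) (n : ℕ)

theorem proveLoop_succ (crs : Fin m → Z.CRS n) (trap : Fin m → Option (Z.Trap n)) (k : ℕ)
    (st : A.State n) (log : List (Stmt n × Z.Proof n)) :
    Z.proveLoop A n crs trap (k + 1) st log =
      (A.ask n st).bind fun o => (Z.simP n (crs, trap, o.1)).bind fun π =>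
      (A.receive n (o.2, π)).bind fun st => Z.proveLoop A n crs trap k st ((o.1, π) :: log) :=
  rfl

/-- The simulation sound extractability game from the state `st` on, when the CRS vector has been
fixed; `keys` and `ek` are the trapdoors and the extraction keys of its generated entries. -/
def sseGameFrom (R : ∀ n, Stmt n → Wit n → Prop)
    (E : ∀ n, (Fin m → Z.CRS n) × (Fin m → Option (Bits (ekLen n))) × Stmt n × Z.Proof n →
      PMF (Wit n)) (crs : Fin m → Z.CRS n) (keys : Fin m → Option (Z.Trap n))
    (ek : Fin m → Option (Bits (ekLen n))) (st : A.State n) : PMF Bool :=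
  (Z.proveLoop A n crs keys (A.proofs n) st []).bind fun o => (A.finish n o.1).bind fun y =>
    (E n (crs, ek, y.1, y.2)).bind fun w =>
      PMF.pure (decide ((y.1, y.2) ∉ o.2 ∧ ¬ R n y.1 w ∧ Z.V n (crs, y.1, y.2) = true))

theorem sseGame_eq_bind (R : ∀ n, Stmt n → Wit n → Prop)
    (K₀ : ∀ n, PMF (Z.CRS n × Z.Trap n × Bits (ekLen n)))
    (E : ∀ n, (Fin m → Z.CRS n) × (Fin m → Option (Bits (ekLen n))) × Stmt n × Z.Proof n →
      PMF (Wit n)) : Z.sseGame R K₀ E A n =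
      (indep fun _ : Fin (A.queries n) => K₀ n).bind fun g =>
        (A.choose n fun k => ((g k).1, (g k).2.2)).bind fun c =>
          Z.sseGameFrom A n R E c.1 (keysOf (fun k => ((g k).1, (g k).2.1)) c.1)
            (keysOf (fun k => ((g k).1, (g k).2.2)) c.1) c.2 :=
  rfl

end NIZK

section Missing

variable {N : ℕ} {P : Type} (S : Finset (Fin N)) (i₀ : Fin N) {p : Fin N → Option P}

/-- The indices outside `S` at which the partial tuple `p` has no entry. -/
def missing (p : Fin N → Option P) : Finset (Fin N) :=
  Finset.univ.filter fun i => i ∉ S ∧ (p i).isSome = false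

/-- The first missing index, or `i₀` if nothing is missing. -/
def firstMissing (p : Fin N → Option P) : Fin N :=
  (missing S p).min.untopD i₀

/-- The partial tuple `p` with its missing entries taken from `π`. -/
def fillMissing (p : Fin N → Option P) (π : Fin N → P) (i : Fin N) : Option P :=
  if i ∈ missing S p then some (π i) else p i

theorem firstMissing_mem (h : (missing S p).Nonempty) : firstMissing S i₀ p ∈ missing S p := by
  obtain ⟨i, hi⟩ := Finset.min_of_nonempty h
  rw [firstMissing, hi]
  exact Finset.mem_of_min hi

theorem missing_update (i : Fin N) (x : P) :
    missing S (Function.update p i (some x)) = (missing S p).erase i := by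
  ext j
  by_cases hj : j = i
  · simp [missing, hj]
  · simp [missing, hj]

theorem fillMissing_update {i : Fin N} (hi : i ∈ missing S p) (x : P) (π : Fin N → P) :
    fillMissing S (Function.update p i (some x)) π = fillMissing S p (Function.update π i x) := by
  funext j
  by_cases hj : j = i
  · subst hj
    simp [fillMissing, missing_update, hi]
  · simp [fillMissing, missing_update, hj]

theorem polyTime_firstMissing {α P : ℕ → Type} [∀ n, BitCode (α n)] [∀ n, BitCode (P n)]
    {p : ∀ n, α n → Fin N → Option (P n)} (hp : PolyTime p) :
    PolyTime (β := fun _ => Fin N) fun n a => firstMissing S i₀ (p n a) := by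
  refine (PolyTime.of_finite (PolyLength.const (Fin N))
    (fun _ (present : Fin N → Bool) =>
      (Finset.univ.filter fun i => i ∉ S ∧ present i = false).min.untopD i₀)
    (PolyTime.pi (β := fun _ => Bool) fun i => (hp.apply i).isSome)).of_eq fun n a => ?_
  simp [firstMissing, missing]

end Missing

namespace Protocol

/-- The type of knowledge extractors for the proofs of the identities. -/
abbrev Extractor {F : Type} [Field F] [BitCode F] {m N : ℕ} (T : Protocol F m N)
    (ekLen : ℕ → ℕ) : Type :=
  ∀ n, (Fin m → T.CRS n) × (Fin m → Option (Bits (ekLen n))) × ShareStmt N m T.cs n × T.Proof n →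
    PMF (ShareWit F m n)

namespace Adversary

variable {F : Type} [Field F] [BitCode F] {m N : ℕ} {T : Protocol F m N} {aux : ℕ → ℕ}
  (A : T.Adversary aux) (Km : Finset (Fin m)) (Ki : Finset (Fin N)) {n : ℕ} {ekLen : ℕ → ℕ}

/-- Executions with CRSes from `K₀`, commitments and openings from `C`, and simulated proofs; `Q`
maps the extraction keys and the seed to the result. -/
def simulation {α : Type} (K₀ : PMF (T.CRS n × T.nizk.Trap n × Bits (ekLen n)))
    (C : PMF (T.CommittedShares n)) (z : Bits (aux n))
    (Q : (Fin m → Option (Bits (ekLen n))) → A.Seed n → PMF α) : PMF α :=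
  (indep fun _ : Fin m => K₀).bind fun g =>
    (PMF.uniformOfFintype (Bits (A.coins n))).bind fun ω => C.bind fun c =>
    (indep (A.simulatedProof Km (keysOf (fun k => ((g k).1, (g k).2.1))
      (A.crsVector Km (z, ω, fun j => (g j).1))) c (z, ω, fun j => (g j).1))).bind fun π =>
    Q (keysOf (fun k => ((g k).1, (g k).2.2)) (A.crsVector Km (z, ω, fun j => (g j).1)))
      ((z, ω, fun j => (g j).1), c, π)

/-- The witness extracted from the proof of identity `i`. -/
def extracted (E : T.Extractor ekLen) (ek : Fin m → Option (Bits (ekLen n))) (e : A.Seed n)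
    (i : Fin N) : PMF (ShareWit F m n) :=
  E n (A.crsVector Km e.1, ek, A.stmt Km Ki e i, A.proofD Km Ki e i)

/-- The proof of identity `i` is accepted, but `w` is not a witness. -/
def extractionFails (e : A.Seed n) (i : Fin N) (w : ShareWit F m n) : Prop :=
  ¬ T.Rel n (A.stmt Km Ki e i) w ∧
    T.nizk.V n (A.crsVector Km e.1, A.stmt Km Ki e i, A.proofD Km Ki e i) = true

/-- The random bit that tells whether extraction from the proof of identity `i` fails. -/
def extractionFailure (E : T.Extractor ekLen) (ek : Fin m → Option (Bits (ekLen n)))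
    (e : A.Seed n) (i : Fin N) : PMF Bool :=
  (A.extracted Km Ki E ek e i).bind fun w => PMF.pure (decide (A.extractionFails Km Ki e i w))

/-- The view and the bids before the outcome, where the bids of the corrupted identities are
extracted from their proofs. -/
def extractedPreOutcome (E : T.Extractor ekLen) (ek : Fin m → Option (Bits (ekLen n)))
    (e : A.Seed n) : PMF (A.PreOutcome n) :=
  (indep (A.extracted Km Ki E ek e)).bind fun w =>
    PMF.pure (A.corruptBids Km Ki e fun i => (w i).1, A.view₆ Km Ki e)

theorem proofExperiment_eq_simulation {K₀ : PMF (T.CRS n × T.nizk.Trap n × Bits (ekLen n))}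
    (hK₀ : K₀.map (fun s => (s.1, s.2.1)) = T.nizk.simK n) (z : Bits (aux n)) (b : Fin N → F)
    (s : Fin N → Fin m → F) : A.proofExperiment Km Ki N z b s =
      A.simulation Km K₀ ((PMF.uniformOfFintype (Fin N → Fin m → Bits n)).map
        fun r => T.shown Km (openings s r)) z fun _ e => PMF.pure (A.preOutcome Km Ki e) := by
  have hproofs : ∀ hop (keys : Fin m → Option (T.nizk.Trap n)) (x : A.Base n),
      A.hybridProof Km N b hop keys x = A.simulatedProof Km keys (T.shown Km hop) x :=
    fun hop keys x => funext fun i => if_pos i.isLt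
  simp only [proofExperiment, hybridSeed, simulation, ← hK₀, indep_map, PMF.bind_map, hproofs,
    PMF.bind_bind, PMF.pure_bind]
  rfl

theorem preOutcome_eq_of_not_extractionFails (hbinding : T.cs.PerfectlyBinding)
    (hKm : 2 * Km.card < m) (e : A.Seed n) (w : Fin N → ShareWit F m n)
    (hw : ∀ i ∈ Ki, ¬ A.extractionFails Km Ki e i (w i)) :
    A.preOutcome Km Ki e = (A.corruptBids Km Ki e fun i => (w i).1, A.view₆ Km Ki e) :=
  Prod.ext (A.reconstructedBids_eq_corruptBids Km Ki hbinding hKm e w fun i hi hV =>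
    by_contra fun hR => hw i hi ⟨hR, hV⟩) rfl

theorem abs_prTrue_extractedPreOutcome_sub_le (hbinding : T.cs.PerfectlyBinding)
    (hKm : 2 * Km.card < m) (E : T.Extractor ekLen) (ek : Fin m → Option (Bits (ekLen n)))
    (e : A.Seed n) (D : A.PreOutcome n → PMF Bool) :
    |prTrue (D (A.preOutcome Km Ki e)) -
        prTrue ((A.extractedPreOutcome Km Ki E ek e).bind D)| ≤
      ∑ i ∈ Ki, prTrue (A.extractionFailure Km Ki E ek e i) := by
  have hfailure : ∀ i, A.extractionFailure Km Ki E ek e i =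
      (indep (A.extracted Km Ki E ek e)).bind fun w =>
        PMF.pure (decide (A.extractionFails Km Ki e i (w i))) := by
    intro i
    rw [extractionFailure, ← indep_map_apply (A.extracted Km Ki E ek e) i, PMF.bind_map]
    rfl
  simp only [extractedPreOutcome, PMF.bind_bind, PMF.pure_bind, hfailure]
  rw [← PMF.bind_const (indep (A.extracted Km Ki E ek e)) (D (A.preOutcome Km Ki e))]
  refine abs_prTrue_bind_sub_le_sum Ki _ fun w => ?_
  have hnonneg : ∀ i ∈ Ki, 0 ≤ prTrue (PMF.pure (decide (A.extractionFails Km Ki e i (w i)))) :=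
    fun i _ => prTrue_nonneg _
  by_cases h : ∃ i ∈ Ki, A.extractionFails Km Ki e i (w i)
  · obtain ⟨i, hi, hfails⟩ := h
    refine (abs_prTrue_sub_le_one _ _).trans (le_trans ?_ (Finset.single_le_sum hnonneg hi))
    simp [prTrue_pure, hfails]
  · push Not at h
    rw [A.preOutcome_eq_of_not_extractionFails Km Ki hbinding hKm e w h, sub_self, abs_zero]
    exact Finset.sum_nonneg hnonneg

theorem abs_prTrue_simulation_sub_le (hbinding : T.cs.PerfectlyBinding) (hKm : 2 * Km.card < m)
    (K₀ : PMF (T.CRS n × T.nizk.Trap n × Bits (ekLen n))) (E : T.Extractor ekLen)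
    (C : PMF (T.CommittedShares n)) (z : Bits (aux n)) (D : A.PreOutcome n → PMF Bool) :
    |prTrue ((A.simulation Km K₀ C z fun _ e => PMF.pure (A.preOutcome Km Ki e)).bind D) -
        prTrue ((A.simulation Km K₀ C z (A.extractedPreOutcome Km Ki E)).bind D)| ≤
      ∑ i ∈ Ki, prTrue (A.simulation Km K₀ C z
        fun ek e => A.extractionFailure Km Ki E ek e i) := by
  simp only [simulation, PMF.bind_bind, PMF.pure_bind]
  exact abs_prTrue_bind_sub_le_sum Ki _ fun g => abs_prTrue_bind_sub_le_sum Ki _ fun ω =>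
    abs_prTrue_bind_sub_le_sum Ki _ fun c => abs_prTrue_bind_sub_le_sum Ki _ fun π =>
    A.abs_prTrue_extractedPreOutcome_sub_le Km Ki hbinding hKm E _ _ D

theorem proofD_congr {i : Fin N} (hi : i ∈ Ki) (x : A.Base n) (c : T.CommittedShares n)
    {π π' : Fin N → T.Proof n} (h : ∀ j ∉ Ki, π j = π' j) :
    A.proofD Km Ki (x, c, π) i = A.proofD Km Ki (x, c, π') i := by
  have hview : A.view₃ Km Ki (x, c, π) = A.view₃ Km Ki (x, c, π') := by
    refine Prod.ext rfl (funext fun j => ?_)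
    simp only [view₃, restrict, Finset.mem_compl]
    split_ifs with hj
    · rfl
    · exact congrArg some (h j hj)
  simp only [proofD, proofs, if_pos hi, hview]

/-- The state of the adversary against extraction: base, commitments and openings, and the
simulated proofs received so far. -/
abbrev ProofState (n : ℕ) : Type :=
  A.Base n × T.CommittedShares n × (Fin N → Option (T.Proof n))

/-- The seed with the proofs of a state. -/
def seedOf (st : A.ProofState n) : A.Seed n :=
  (st.1, st.2.1, fun i => (st.2.2 i).getD (zeroBits _))

theorem polyTime_seedOf : PolyTime fun n (st : A.ProofState n) => A.seedOf st :=
  PolyTime.id.fst.pair (PolyTime.id.snd.fst.pair (PolyTime.pi (β := T.Proof) fun i =>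
    (PolyTime.id.snd.snd.apply i).getD T.polyLength_proof (PolyTime.const fun _ => _)))

theorem polyTime_nextStmt (i₀ : Fin N) : PolyTime (β := ShareStmt N m T.cs)
    fun _ (st : A.ProofState _) => honestStmt st.2.1 (firstMissing Ki i₀ st.2.2) := by
  have hnext := polyTime_firstMissing Ki i₀ (PolyTime.id (α := A.ProofState)).snd.snd
  exact hnext.pair (PolyTime.pi (β := T.Com) fun j => ((PolyTime.select
    ((T.polyLength_com.prod polyLength_opening).pi m) hnext PolyTime.id.snd.fst).apply j).fst)

theorem extractionFailure_seedOf_fillMissing {i₀ : Fin N} (hi₀ : i₀ ∈ Ki) (E : T.Extractor ekLen)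
    (ek : Fin m → Option (Bits (ekLen n))) (x : A.Base n) (c : T.CommittedShares n)
    (π : Fin N → T.Proof n) :
    A.extractionFailure Km Ki E ek (A.seedOf (x, c, fillMissing Ki (fun _ => none) π)) i₀ =
      A.extractionFailure Km Ki E ek (x, c, π) i₀ := by
  have hproof : A.proofD Km Ki (A.seedOf (x, c, fillMissing Ki (fun _ => none) π)) i₀ =
      A.proofD Km Ki (x, c, π) i₀ :=
    A.proofD_congr Km Ki hi₀ x c fun i hi => by simp [fillMissing, missing, hi]
  unfold extractionFailure extracted extractionFails
  rw [hproof]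
  rfl

/-- The adversary against extraction that asks for simulated proofs of all honest identities, and
then outputs the statement and the proof of the corrupted identity `i₀`. -/
def sseAdversary (haux : PolyBounded aux) (ekLen : ℕ → ℕ) {C : ∀ n, PMF (T.CommittedShares n)}
    (hC : PPTSampler C) (z : ∀ n, Bits (aux n)) (i₀ : Fin N) : T.nizk.SSEAdversary ekLen where
  State := A.ProofState
  state_poly := (A.polyLength_base haux).prod
    (T.polyLength_committedShares.prod (T.polyLength_proof.option.pi N))
  queries _ := m
  queries_poly := PolyBounded.const m
  proofs _ := Kiᶜ.card
  proofs_poly := PolyBounded.const _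
  choose n g := (PMF.uniformOfFintype (Bits (A.coins n))).bind fun ω => (C n).bind fun c =>
    PMF.pure (A.crsVector Km (z n, ω, fun j => (g j).1),
      ((z n, ω, fun j => (g j).1), c, fun _ => none))
  ask n st := PMF.pure (honestStmt st.2.1 (firstMissing Ki i₀ st.2.2), st)
  receive n x := PMF.pure (x.1.1, x.1.2.1,
    Function.update x.1.2.2 (firstMissing Ki i₀ x.1.2.2) (some x.2))
  finish n st := PMF.pure (A.stmt Km Ki (A.seedOf st) i₀, A.proofD Km Ki (A.seedOf st) i₀)
  choose_ppt := by
    refine PPT.bind (PPT.uniform_bits A.coins_poly) (PPT.bind (PPT.of_sampler hC) (PPT.pure ?_))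
    have hx : PolyTime (α := fun n => ((Fin m → T.CRS n × Bits (ekLen n)) × Bits (A.coins n)) ×
        T.CommittedShares n) (β := A.Base) fun n x => (z n, x.1.2, fun j => (x.1.1 j).1) :=
      (PolyTime.const z).pair (PolyTime.id.fst.snd.pair
        (PolyTime.pi (β := T.CRS) fun j => (PolyTime.id.fst.fst.apply j).fst))
    exact ((A.polyTime_crsVector Km).comp hx).pair (hx.pair (PolyTime.id.snd.pair
      (PolyTime.const (β := fun n => Fin N → Option (T.Proof n)) fun _ _ => none)))
  ask_ppt := PPT.pure ((A.polyTime_nextStmt Ki i₀).pair PolyTime.id)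
  receive_ppt := PPT.pure (PolyTime.id.fst.fst.pair (PolyTime.id.fst.snd.fst.pair
    (PolyTime.update T.polyLength_proof.option
      (polyTime_firstMissing Ki i₀ PolyTime.id.fst.snd.snd) PolyTime.id.fst.snd.snd
      PolyTime.id.snd.some)))
  finish_ppt := PPT.pure (((A.polyTime_stmt Km Ki i₀).comp A.polyTime_seedOf).pair
    ((A.polyTime_proofD Km Ki i₀).comp A.polyTime_seedOf))

section ProveLoop

variable {Km Ki} {haux : PolyBounded aux} {C : ∀ n, PMF (T.CommittedShares n)} {hC : PPTSampler C}
  {z : ∀ n, Bits (aux n)} {i₀ : Fin N} (keys : Fin m → Option (T.nizk.Trap n)) (x : A.Base n)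
  (c : T.CommittedShares n)

theorem proveLoop_sseAdversary_succ (k : ℕ) (p : Fin N → Option (T.Proof n))
    (log : List (ShareStmt N m T.cs n × T.Proof n)) :
    T.nizk.proveLoop (A.sseAdversary Km Ki haux ekLen hC z i₀) n (A.crsVector Km x) keys (k + 1)
        (x, c, p) log =
      (A.simulatedProof Km keys c x (firstMissing Ki i₀ p)).bind fun π =>
        T.nizk.proveLoop (A.sseAdversary Km Ki haux ekLen hC z i₀) n (A.crsVector Km x) keys k
          (x, c, Function.update p (firstMissing Ki i₀ p) (some π))
          ((honestStmt c (firstMissing Ki i₀ p), π) :: log) := by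
  refine (NIZK.proveLoop_succ T.nizk (A.sseAdversary Km Ki haux ekLen hC z i₀) n _ keys k
    (x, c, p) log).trans ((PMF.pure_bind _ _).trans (congrArg _ (funext fun π => ?_)))
  exact PMF.pure_bind _ _

theorem map_fst_proveLoop_sseAdversary {k : ℕ} {p : Fin N → Option (T.Proof n)}
    (hk : (missing Ki p).card = k) (log : List (ShareStmt N m T.cs n × T.Proof n)) :
    (T.nizk.proveLoop (A.sseAdversary Km Ki haux ekLen hC z i₀) n (A.crsVector Km x) keys k
        (x, c, p) log).map Prod.fst =
      (indep (A.simulatedProof Km keys c x)).map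
        fun π => ((x, c, fillMissing Ki p π) : A.ProofState n) := by
  induction k generalizing p log with
  | zero =>
    have hfill : fillMissing Ki p = fun _ => p := by
      funext π i
      simp [fillMissing, Finset.card_eq_zero.1 hk]
    rw [hfill]
    exact (PMF.pure_map _ _).trans (PMF.map_const _ _).symm
  | succ k ih =>
    have hmem : firstMissing Ki i₀ p ∈ missing Ki p :=
      firstMissing_mem Ki i₀ (Finset.card_pos.1 (hk ▸ k.succ_pos))
    rw [A.proveLoop_sseAdversary_succ, PMF.map_bind, indep_eq_bind _ (firstMissing Ki i₀ p),
      PMF.map_bind]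
    refine congrArg _ (funext fun π => ?_)
    rw [ih (by rw [missing_update, Finset.card_erase_of_mem hmem, hk]; rfl), PMF.map_comp]
    simp only [fillMissing_update Ki hmem]
    rfl

theorem notMem_of_mem_log_proveLoop_sseAdversary {k : ℕ} {p : Fin N → Option (T.Proof n)}
    (hk : (missing Ki p).card = k) {log : List (ShareStmt N m T.cs n × T.Proof n)}
    (hlog : ∀ y ∈ log, y.1.1 ∉ Ki) :
    ∀ o ∈ (T.nizk.proveLoop (A.sseAdversary Km Ki haux ekLen hC z i₀) n (A.crsVector Km x) keys k
      (x, c, p) log).support, ∀ y ∈ o.2, y.1.1 ∉ Ki := by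
  induction k generalizing p log with
  | zero =>
    intro o ho
    rw [(PMF.mem_support_pure_iff _ _).1 ho]
    exact hlog
  | succ k ih =>
    intro o ho
    have hmem : firstMissing Ki i₀ p ∈ missing Ki p :=
      firstMissing_mem Ki i₀ (Finset.card_pos.1 (hk ▸ k.succ_pos))
    rw [A.proveLoop_sseAdversary_succ] at ho
    obtain ⟨π, -, ho⟩ := (PMF.mem_support_bind_iff _ _ _).1 ho
    refine ih (by rw [missing_update, Finset.card_erase_of_mem hmem, hk]; rfl)
      (List.forall_mem_cons.2 ⟨?_, hlog⟩) o ho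
    exact (Finset.mem_filter.1 hmem).2.1

end ProveLoop

theorem sseGameFrom_sseAdversary {haux : PolyBounded aux} {C : ∀ n, PMF (T.CommittedShares n)}
    {hC : PPTSampler C} {z : ∀ n, Bits (aux n)} {i₀ : Fin N} (hi₀ : i₀ ∈ Ki)
    (keys : Fin m → Option (T.nizk.Trap n)) (ek : Fin m → Option (Bits (ekLen n)))
    (E : T.Extractor ekLen) (x : A.Base n) (c : T.CommittedShares n) :
    T.nizk.sseGameFrom (A.sseAdversary Km Ki haux ekLen hC z i₀) n T.Rel E (A.crsVector Km x)
        keys ek (x, c, fun _ => none) =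
      (indep (A.simulatedProof Km keys c x)).bind fun π =>
        A.extractionFailure Km Ki E ek (x, c, π) i₀ := by
  have hcard : (missing Ki fun _ : Fin N => (none : Option (T.Proof n))).card = Kiᶜ.card := by
    congr 1
    ext i
    simp [missing]
  let failure (st : A.ProofState n) : PMF Bool :=
    (E n (A.crsVector Km x, ek, A.stmt Km Ki (A.seedOf st) i₀,
      A.proofD Km Ki (A.seedOf st) i₀)).bind fun w =>
        PMF.pure (decide (¬ T.Rel n (A.stmt Km Ki (A.seedOf st) i₀) w ∧
          T.nizk.V n (A.crsVector Km x, A.stmt Km Ki (A.seedOf st) i₀,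
            A.proofD Km Ki (A.seedOf st) i₀) = true))
  have hloop := A.map_fst_proveLoop_sseAdversary (haux := haux) (hC := hC) (z := z) (i₀ := i₀)
    (ekLen := ekLen) (Km := Km) keys x c hcard []
  -- A pair with the name of `i₀` is fresh: the recorded statements have names outside `Ki`.
  have hfresh := A.notMem_of_mem_log_proveLoop_sseAdversary (haux := haux) (hC := hC) (z := z)
    (i₀ := i₀) (ekLen := ekLen) (Km := Km) keys x c hcard (List.forall_mem_nil _)
  calc T.nizk.sseGameFrom (A.sseAdversary Km Ki haux ekLen hC z i₀) n T.Rel E (A.crsVector Km x)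
        keys ek (x, c, fun _ => none)
    _ = (T.nizk.proveLoop (A.sseAdversary Km Ki haux ekLen hC z i₀) n (A.crsVector Km x) keys
          Kiᶜ.card (x, c, fun _ => none) []).bind fun o => failure o.1 := by
        refine bind_congr_of_mem_support fun o ho => (PMF.pure_bind _ _).trans ?_
        refine congrArg (PMF.bind _) (funext fun w => congrArg PMF.pure (decide_eq_decide.2 ?_))
        exact and_iff_right fun hmem => hfresh o ho _ hmem hi₀
    _ = ((indep (A.simulatedProof Km keys c x)).map
          fun π => ((x, c, fillMissing Ki (fun _ => none) π) : A.ProofState n)).bind failure :=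
        (PMF.bind_map _ Prod.fst failure).symm.trans (congrArg (fun q => PMF.bind q failure) hloop)
    _ = (indep (A.simulatedProof Km keys c x)).bind fun π => A.extractionFailure Km Ki E ek
          (A.seedOf (x, c, fillMissing Ki (fun _ => none) π)) i₀ := by
        refine (PMF.bind_map _ _ failure).trans (congrArg _ (funext fun π => ?_))
        exact congrArg (PMF.bind _) (funext fun w => congrArg PMF.pure (decide_eq_decide.2 Iff.rfl))
    _ = _ := by simp only [A.extractionFailure_seedOf_fillMissing Km Ki hi₀]

theorem sseGame_sseAdversary {haux : PolyBounded aux} {C : ∀ n, PMF (T.CommittedShares n)}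
    {hC : PPTSampler C} {z : ∀ n, Bits (aux n)} {i₀ : Fin N} (hi₀ : i₀ ∈ Ki)
    (K₀ : ∀ n, PMF (T.CRS n × T.nizk.Trap n × Bits (ekLen n))) (E : T.Extractor ekLen) (n : ℕ) :
    T.nizk.sseGame T.Rel K₀ E (A.sseAdversary Km Ki haux ekLen hC z i₀) n =
      A.simulation Km (K₀ n) (C n) (z n) fun ek e => A.extractionFailure Km Ki E ek e i₀ := by
  rw [NIZK.sseGame_eq_bind]
  refine congrArg _ (funext fun g => ?_)
  change PMF.bind (PMF.bind _ fun ω => PMF.bind _ fun c => PMF.pure _) _ = _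
  simp only [PMF.bind_bind]
  refine congrArg _ (funext fun ω => congrArg _ (funext fun c => (PMF.pure_bind _ _).trans ?_))
  exact A.sseGameFrom_sseAdversary Km Ki hi₀ _ _ E _ c

theorem minorityConstrained_sseAdversary (hKm : 2 * Km.card < m) (haux : PolyBounded aux)
    (ekLen : ℕ → ℕ) {C : ∀ n, PMF (T.CommittedShares n)} (hC : PPTSampler C)
    (z : ∀ n, Bits (aux n)) (i₀ : Fin N) :
    (A.sseAdversary Km Ki haux ekLen hC z i₀).MinorityConstrained := by
  intro n gen o ho
  obtain ⟨ω, -, ho⟩ := (PMF.mem_support_bind_iff _ _ _).1 ho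
  obtain ⟨c, -, ho⟩ := (PMF.mem_support_bind_iff _ _ _).1 ho
  rw [(PMF.mem_support_pure_iff _ _).1 ho]
  exact A.majorityGenerated_crsVector Km hKm (z n) ω fun j => (gen j).1

theorem simulation_compIndist_extracted (hbinding : T.cs.PerfectlyBinding)
    (hKm : 2 * Km.card < m) (haux : PolyBounded aux)
    {K₀ : ∀ n, PMF (T.CRS n × T.nizk.Trap n × Bits (ekLen n))} {E : T.Extractor ekLen}
    (hwin : ∀ B : T.nizk.SSEAdversary ekLen, B.MinorityConstrained →
      Negligible fun n => prTrue (T.nizk.sseGame T.Rel K₀ E B n))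
    {C : ∀ n, PMF (T.CommittedShares n)} (hC : PPTSampler C) (z : ∀ n, Bits (aux n)) :
    CompIndist
      (fun n => A.simulation Km (K₀ n) (C n) (z n) fun _ e => PMF.pure (A.preOutcome Km Ki e))
      (fun n => A.simulation Km (K₀ n) (C n) (z n) (A.extractedPreOutcome Km Ki E)) := by
  intro D _
  refine Negligible.of_abs_le (Negligible.sum Ki fun i _ =>
    hwin (A.sseAdversary Km Ki haux ekLen hC z i)
      (A.minorityConstrained_sseAdversary Km Ki hKm haux ekLen hC z i)) fun n => ?_
  rw [abs_abs]
  refine (A.abs_prTrue_simulation_sub_le Km Ki hbinding hKm (K₀ n) E (C n) (z n) (D n)).trans_eq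
    (Finset.sum_congr rfl fun i hi => ?_)
  rw [A.sseGame_sseAdversary Km Ki hi K₀ E n]

end Adversary

end Protocol

/-! ### Hiding and the simulator -/

namespace Protocol

variable {F : Type} [Field F] [BitCode F] {m N : ℕ} (T : Protocol F m N) (Km : Finset (Fin m))
  {n : ℕ}

/-- A fresh commitment to the share `s`, together with its opening if `v` holds, and with the dummy
opening `(0, 0)` otherwise. -/
def freshCommitment (n : ℕ) (v : Prop) (s : F) : PMF (T.Com n × Opening F n) :=
  (PMF.uniformOfFintype (Bits n)).map fun r =>
    (T.commitTo n (s, r), if v then (s, r) else (0, zeroBits n))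

/-- Fresh commitments to the shares `s` of the miners in `Km`, with their openings, and to the
shares `s'` of the other miners. -/
def freshCommitments (n : ℕ) (s s' : Fin N → Fin m → F) : PMF (T.CommittedShares n) :=
  indep fun i => indep fun j => T.freshCommitment n (j ∈ Km) (if j ∈ Km then s i j else s' i j)

theorem map_shown_openings (s : Fin N → Fin m → F) :
    (PMF.uniformOfFintype (Fin N → Fin m → Bits n)).map (fun r => T.shown Km (openings s r)) =
      T.freshCommitments Km n s s := by
  let shownOpening (i : Fin N) (j : Fin m) (r : Bits n) : T.Com n × Opening F n :=
    (T.commitTo n (s i j, r), if j ∈ Km then (s i j, r) else (0, zeroBits n))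
  rw [uniformOfFintype_coins_eq_indep]
  refine (indep_map (fun _ : Fin N => indep fun _ : Fin m => PMF.uniformOfFintype (Bits n))
    fun i r j => shownOpening i j (r j)).symm.trans (congrArg indep (funext fun i => ?_))
  refine (indep_map (fun _ : Fin m => PMF.uniformOfFintype (Bits n))
    (shownOpening i)).symm.trans (congrArg indep (funext fun j => ?_))
  by_cases hj : j ∈ Km <;> simp only [shownOpening, freshCommitment, hj, if_true, if_false]

theorem freshCommitments_congr {s₁ s₂ : Fin N → Fin m → F} (s' : Fin N → Fin m → F)
    (h : ∀ i, ∀ j ∈ Km, s₁ i j = s₂ i j) :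
    T.freshCommitments Km n s₁ s' = T.freshCommitments Km n s₂ s' := by
  refine congrArg indep (funext fun i => congrArg indep (funext fun j => ?_))
  by_cases hj : j ∈ Km
  · rw [if_pos hj, if_pos hj, h i j hj]
  · rw [if_neg hj, if_neg hj]

theorem freshCommitment_compIndist (hhiding : T.cs.ComputationallyHiding) (s s' : ℕ → F) :
    CompIndist (fun n => T.freshCommitment n False (s n))
      (fun n => T.freshCommitment n False (s' n)) := by
  have h := CompIndist.bind (hhiding (fun n => T.enc n (s n)) fun n => T.enc n (s' n))
    (f := fun n c => PMF.pure ((c, (0, zeroBits n)) : T.Com n × Opening F n))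
    (PPT.pure (PolyTime.id.pair (PolyTime.const fun _ => _)))
  simp only [PMF.bind_map] at h
  simp only [freshCommitment, if_false]
  exact h

theorem bind_freshCommitments_sharesOf [Fintype F] {α : Type} (hKm : 2 * Km.card < m)
    (b : Fin N → F) (f : PMF (T.CommittedShares n) → PMF α) :
    ((PMF.uniformOfFintype (Fin N → Fin (threshold m - 1) → F)).bind fun a =>
      f (T.freshCommitments Km n (T.sharesOf b a) 0)) =
    (PMF.uniformOfFintype (Fin N → Fin (threshold m - 1) → F)).bind fun a =>
      f (T.freshCommitments Km n (T.sharesOf 0 a) 0) := by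
  have hthreshold : Km.card < threshold m := by unfold threshold; omega
  have hmasked : ∀ (b : Fin N → F) a, T.freshCommitments Km n (T.sharesOf b a) 0 =
      T.freshCommitments Km n
        (fun i j => if j ∈ Km then shareOf T.pt (b i) (a i) j else 0) 0 :=
    fun b a => T.freshCommitments_congr Km 0 fun i j hj => (if_pos hj).symm
  have hprivacy := congrArg (fun p => p.bind fun s => f (T.freshCommitments Km n s 0))
    (map_shareOf_masked_eq_zero_secret T.pt_ne_zero hthreshold b)
  simp only [PMF.bind_map] at hprivacy
  simp only [hmasked]
  exact hprivacy

section PPT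

variable [Finite F] {α : ℕ → Type} [∀ n, BitCode (α n)]

theorem ppt_freshCommitment (v : Prop) {s : ∀ n, α n → F} (hs : PolyTime (β := fun _ => F) s) :
    PPT fun n a => T.freshCommitment n v (s n a) := by
  refine PPT.map (PPT.uniform_bits PolyBounded.id) ?_
  have hopening : PolyTime (α := fun n => α n × Bits n) (β := fun n => Opening F n)
      fun n x => (s n x.1, x.2) :=
    (hs.comp PolyTime.id.fst).pair PolyTime.id.snd
  refine (T.polyTime_commitTo hopening).pair ?_
  by_cases hv : v
  · simpa only [if_pos hv] using hopening
  · simpa only [if_neg hv] using PolyTime.const fun _ => _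

theorem ppt_freshCommitments {s s' : ∀ n, α n → Fin N → Fin m → F}
    (hs : PolyTime (β := fun _ => Fin N → Fin m → F) s)
    (hs' : PolyTime (β := fun _ => Fin N → Fin m → F) s') :
    PPT fun n a => T.freshCommitments Km n (s n a) (s' n a) := by
  refine PPT.indep fun i => PPT.indep fun j => ?_
  by_cases hj : j ∈ Km
  · simpa only [if_pos hj] using T.ppt_freshCommitment (j ∈ Km) ((hs.apply i).apply j)
  · simpa only [if_neg hj] using T.ppt_freshCommitment (j ∈ Km) ((hs'.apply i).apply j)

theorem freshCommitments_compIndist (hhiding : T.cs.ComputationallyHiding)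
    (s s' : ℕ → Fin N → Fin m → F) :
    CompIndist (fun n => T.freshCommitments Km n (s n) (s n))
      (fun n => T.freshCommitments Km n (s n) (s' n)) := by
  have hsampler : ∀ (v : Prop) (s : ℕ → F), PPTSampler fun n => T.freshCommitment n v (s n) :=
    fun v s => T.ppt_freshCommitment v (PolyTime.const (β := fun _ => F) s)
  refine CompIndist.indep (α := fun n => Fin m → T.Com n × Opening F n)
    (fun i => PPT.indep (α := fun _ => Fin 0 → Bool) fun j => hsampler _ fun n => _)
    (fun i => PPT.indep (α := fun _ => Fin 0 → Bool) fun j => hsampler _ fun n => _) fun i => ?_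
  refine CompIndist.indep (fun j => hsampler _ fun n => _) (fun j => hsampler _ fun n => _)
    fun j => ?_
  by_cases hj : j ∈ Km
  · simp only [hj, if_true]
    exact CompIndist.refl _
  · simp only [hj, if_false]
    exact T.freshCommitment_compIndist hhiding _ _

end PPT

namespace Adversary

variable {T} {aux : ℕ → ℕ} (A : T.Adversary aux) (Ki : Finset (Fin N)) {ekLen : ℕ → ℕ}

theorem polyLength_view₆ (haux : PolyBounded aux) : PolyLength fun n => T.View₆ aux A.coins n := by
  have hopening := ((polyLength_opening (F := F)).option.pi m).pi N
  exact ((((((((PolyLength.bits haux).prod (PolyLength.bits A.coins_poly)).prod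
    (T.polyLength_crs.option.pi m)).prod ((T.polyLength_com.pi m).option.pi N)).prod
    (T.polyLength_proof.option.pi N)).prod hopening).prod
    (((PolyLength.const Bool).option.pi N).pi m)).prod hopening)

theorem simulation_eq_bind {α : Type} (K₀ : PMF (T.CRS n × T.nizk.Trap n × Bits (ekLen n)))
    (C : PMF (T.CommittedShares n)) (z : Bits (aux n))
    (Q : (Fin m → Option (Bits (ekLen n))) → A.Seed n → PMF α) :
    A.simulation Km K₀ C z Q = C.bind fun c => A.simulation Km K₀ (PMF.pure c) z Q := by
  unfold simulation
  simp only [PMF.pure_bind]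
  exact (congrArg _ (funext fun g => PMF.bind_comm _ _ _)).trans (PMF.bind_comm _ _ _)

theorem ppt_simulation {α β : ℕ → Type} [∀ n, BitCode (α n)] [∀ n, BitCode (β n)]
    (hek : PolyBounded ekLen) {K₀ : ∀ n, PMF (T.CRS n × T.nizk.Trap n × Bits (ekLen n))}
    (hK₀ : PPTSampler K₀) {C : ∀ n, α n → PMF (T.CommittedShares n)} (hC : PPT C)
    {z : ∀ n, α n → Bits (aux n)} (hz : PolyTime z)
    {Q : ∀ n, (Fin m → Option (Bits (ekLen n))) → A.Seed n → PMF (β n)}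
    (hQ : PPT fun n (x : (Fin m → Option (Bits (ekLen n))) × A.Seed n) => Q n x.1 x.2) :
    PPT fun n a => A.simulation Km (K₀ n) (C n a) (z n a) (Q n) := by
  let Drawn : ℕ → Type := fun n =>
    (α n × (Fin m → T.CRS n × T.nizk.Trap n × Bits (ekLen n))) × Bits (A.coins n)
  have hkeys : PolyTime (α := Drawn) fun n x => x.1.2 := PolyTime.id.fst.snd
  have hbase : PolyTime (α := Drawn) (β := A.Base)
      fun n x => (z n x.1.1, x.2, fun j => (x.1.2 j).1) :=
    (hz.comp PolyTime.id.fst.fst).pair (PolyTime.id.snd.pair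
      (PolyTime.pi (β := T.CRS) fun j => (hkeys.apply j).fst))
  have hcrs := (A.polyTime_crsVector Km).comp hbase
  have htrap := polyTime_keysOf T.polyLength_crs T.polyLength_trap (PolyTime.pi
    (β := fun n => T.CRS n × T.nizk.Trap n) fun k =>
      (hkeys.apply k).fst.pair (hkeys.apply k).snd.fst) hcrs
  have hek := polyTime_keysOf T.polyLength_crs (PolyLength.bits hek) (PolyTime.pi
    (β := fun n => T.CRS n × Bits (ekLen n)) fun k =>
      (hkeys.apply k).fst.pair (hkeys.apply k).snd.snd) hcrs
  refine PPT.bind (PPT.indep fun _ => PPT.of_sampler hK₀) (PPT.bind (PPT.uniform_bits A.coins_poly)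
    (PPT.bind (hC.comp PolyTime.id.fst.fst) (PPT.bind (PPT.indep (A.ppt_simulatedProof Km
      (htrap.comp PolyTime.id.fst) PolyTime.id.snd (hbase.comp PolyTime.id.fst))) ?_)))
  exact hQ.comp ((hek.comp PolyTime.id.fst.fst).pair ((hbase.comp PolyTime.id.fst.fst).pair
    (PolyTime.id.fst.snd.pair PolyTime.id.snd)))

/-- What the simulator submits and remembers when its commitments hide sharings of zero with
coefficients `a`: the extracted bids of the corrupted identities, and the simulated view. -/
def idealPreOutcome (K₀ : PMF (T.CRS n × T.nizk.Trap n × Bits (ekLen n))) (E : T.Extractor ekLen)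
    (z : Bits (aux n)) (a : Fin N → Fin (threshold m - 1) → F) : PMF (A.PreOutcome n) :=
  A.simulation Km K₀ (T.freshCommitments Km n (T.sharesOf 0 a) 0) z
    (A.extractedPreOutcome Km Ki E)

section PPT

variable [Finite F] {K₀ : ∀ n, PMF (T.CRS n × T.nizk.Trap n × Bits (ekLen n))}
  {E : T.Extractor ekLen}

theorem ppt_extractedPreOutcome (hE : PPT E) :
    PPT fun n (x : (Fin m → Option (Bits (ekLen n))) × A.Seed n) =>
      A.extractedPreOutcome Km Ki E x.1 x.2 := by
  refine PPT.bind (PPT.indep fun i => hE.comp ?_) (PPT.pure ?_)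
  · exact ((A.polyTime_crsVector Km).comp PolyTime.id.snd.fst).pair (PolyTime.id.fst.pair
      (((A.polyTime_stmt Km Ki i).comp PolyTime.id.snd).pair
        ((A.polyTime_proofD Km Ki i).comp PolyTime.id.snd)))
  · have hseed : PolyTime (α := fun n => ((Fin m → Option (Bits (ekLen n))) × A.Seed n) ×
        (Fin N → ShareWit F m n)) fun n x => x.1.2 := PolyTime.id.fst.snd
    exact (A.polyTime_corruptBids Km Ki hseed fun i =>
      PolyTime.fst (β := fun _ => F) (PolyTime.id.snd.apply i)).pair
        ((A.polyTime_view₆ Km Ki).comp hseed)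

theorem ppt_idealPreOutcome {α : ℕ → Type} [∀ n, BitCode (α n)] (hek : PolyBounded ekLen)
    (hK₀ : PPTSampler K₀) (hE : PPT E) {z : ∀ n, α n → Bits (aux n)} (hz : PolyTime z)
    {a : ∀ n, α n → Fin N → Fin (threshold m - 1) → F}
    (ha : PolyTime (β := fun _ => Fin N → Fin (threshold m - 1) → F) a) :
    PPT fun n x => A.idealPreOutcome Km Ki (K₀ n) E (z n x) (a n x) :=
  A.ppt_simulation Km hek hK₀ (T.ppt_freshCommitments Km
    (PolyTime.of_finite (PolyLength.const (Fin N → Fin m → F)) (fun _ a => T.sharesOf 0 a) ha)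
    (PolyTime.const (β := fun _ => Fin N → Fin m → F) fun _ => 0)) hz
    (A.ppt_extractedPreOutcome Km Ki hE)

theorem crsExperiment_compIndist_simulation (haux : PolyBounded aux) (hek : PolyBounded ekLen)
    (hK₀ : PPTSampler K₀) (hE : PPT E) (hbinding : T.cs.PerfectlyBinding)
    (hhiding : T.cs.ComputationallyHiding) (hzk : T.nizk.ZeroKnowledge T.Rel)
    (hKm : 2 * Km.card < m) (hsim : ∀ n, (K₀ n).map (fun k => (k.1, k.2.1)) = T.nizk.simK n)
    (hwin : ∀ B : T.nizk.SSEAdversary ekLen, B.MinorityConstrained →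
      Negligible fun n => prTrue (T.nizk.sseGame T.Rel K₀ E B n))
    (b : ℕ → Fin N → F) (z : ∀ n, Bits (aux n)) (a : Fin N → Fin (threshold m - 1) → F) :
    CompIndist (fun n => A.crsExperiment Km Ki (indep fun _ => T.nizk.K n) (z n) (b n)
        (T.sharesOf (b n) a))
      (fun n => A.simulation Km (K₀ n) (T.freshCommitments Km n (T.sharesOf (b n) a) 0) (z n)
        (A.extractedPreOutcome Km Ki E)) := by
  have hthreshold : 1 ≤ threshold m := by unfold threshold; omega
  have hsampler : ∀ s : ℕ → Fin N → Fin m → F,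
      PPTSampler fun n => T.freshCommitments Km n (s n) (s n) := fun s =>
    T.ppt_freshCommitments Km (PolyTime.const (β := fun _ => Fin N → Fin m → F) s)
      (PolyTime.const (β := fun _ => Fin N → Fin m → F) s)
  have hproofs := A.crsExperiment_compIndist_proofExperiment Km Ki z b
    (fun n => T.sharesOf (b n) a) hzk hKm haux
    fun n i => isSharing_shareOf hthreshold T.pt (b n i) (a i)
  simp only [A.proofExperiment_eq_simulation Km Ki (hsim _), T.map_shown_openings] at hproofs
  have hextraction := A.simulation_compIndist_extracted Km Ki hbinding hKm haux hwin
    (hsampler fun n => T.sharesOf (b n) a) z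
  have hcommitments := (T.freshCommitments_compIndist Km hhiding (fun n => T.sharesOf (b n) a)
    fun _ => 0).bind (A.ppt_simulation Km hek hK₀ (PPT.pure PolyTime.id) (PolyTime.const z)
      (A.ppt_extractedPreOutcome Km Ki hE))
  simp only [← simulation_eq_bind] at hcommitments
  exact (hproofs.trans hextraction).trans hcommitments

end PPT

variable [Fintype F] (haux : PolyBounded aux) (hek : PolyBounded ekLen)
  {K₀ : ∀ n, PMF (T.CRS n × T.nizk.Trap n × Bits (ekLen n))} (hK₀ : PPTSampler K₀)
  {E : T.Extractor ekLen} (hE : PPT E)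

/-- The simulator: it commits to shares of zero bids, simulates the proofs of the honest identities,
and extracts the bids of the corrupted ones from their proofs. The coefficients of the sharings are
only almost uniform, since a uniform element of `F` need not be a function of finitely many random
bits. -/
def simulator : T.Simulator aux A.coins where
  State n := T.View₆ aux A.coins n
  state_poly := A.polyLength_view₆ haux
  bids n z := (almostUniform (Fin N → Fin (threshold m - 1) → F) n).bind
    (A.idealPreOutcome Km Ki (K₀ n) E z)
  view _ x := PMF.pure x
  bids_ppt := PPT.bind (β := fun _ => Fin N → Fin (threshold m - 1) → F) ppt_almostUniform
    (A.ppt_idealPreOutcome Km Ki hek hK₀ hE PolyTime.id.fst PolyTime.id.snd)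
  view_ppt := PPT.pure PolyTime.id

theorem ideal_simulator (b : Fin N → F) (z : Bits (aux n)) :
    T.ideal Km Ki (A.simulator Km Ki haux hek hK₀ hE) n b z =
      ((almostUniform (Fin N → Fin (threshold m - 1) → F) n).bind
        (A.idealPreOutcome Km Ki (K₀ n) E z)).bind (A.finalize Km Ki b) :=
  congrArg (PMF.bind _) (funext fun _ => congrArg (PMF.bind _) (funext fun _ => PMF.pure_bind _ _))

theorem real_compIndist_ideal (hbinding : T.cs.PerfectlyBinding)
    (hhiding : T.cs.ComputationallyHiding) (hcomplete : T.nizk.Complete T.Rel)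
    (hzk : T.nizk.ZeroKnowledge T.Rel) (hKm : 2 * Km.card < m)
    (hsim : ∀ n, (K₀ n).map (fun k => (k.1, k.2.1)) = T.nizk.simK n)
    (hwin : ∀ B : T.nizk.SSEAdversary ekLen, B.MinorityConstrained →
      Negligible fun n => prTrue (T.nizk.sseGame T.Rel K₀ E B n))
    (b : ℕ → Fin N → F) (z : ∀ n, Bits (aux n)) :
    CompIndist (fun n => T.real Km Ki A n (b n) (z n))
      (fun n => T.ideal Km Ki (A.simulator Km Ki haux hek hK₀ hE) n (b n) (z n)) := by
  simp only [A.real_eq Km Ki hbinding hcomplete hKm, ideal_simulator]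
  refine CompIndist.bind ?_ (A.ppt_finalize Km Ki b)
  have hsimulation := CompIndist.mixture
    (fun _ => PMF.uniformOfFintype (Fin N → Fin (threshold m - 1) → F))
    (A.crsExperiment_compIndist_simulation Km Ki haux hek hK₀ hE hbinding hhiding hzk hKm hsim
      hwin b z)
  have hprivacy := fun n => T.bind_freshCommitments_sharesOf (n := n) Km hKm (b n) fun C =>
    A.simulation Km (K₀ n) C (z n) (A.extractedPreOutcome Km Ki E)
  simp only [hprivacy] at hsimulation
  exact hsimulation.trans (CompIndist.bind compIndist_almostUniform_uniform.symm
    (A.ppt_idealPreOutcome Km Ki hek hK₀ hE (PolyTime.const z) PolyTime.id))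

end Adversary

end Protocol

end MPCAuction

end

theorem mainTheorem9 {F : Type} [Field F] [Fintype F] [MPCAuction.BitCode F] {m N : ℕ}
    (T : MPCAuction.Protocol F m N)
    (hbinding : T.cs.PerfectlyBinding)
    (hhiding : T.cs.ComputationallyHiding)
    (hcomplete : T.nizk.Complete T.Rel)
    (hzk : T.nizk.ZeroKnowledge T.Rel)
    (hsse : T.nizk.SimulationSoundExtractable T.Rel)
    (Km : Finset (Fin m)) (Ki : Finset (Fin N)) (hminority : 2 * Km.card < m) :
    T.SecurelyRealizes Km Ki := by
  intro aux haux A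
  obtain ⟨ekLen, K₀, E, hek, hK₀, hE, hsim, hwin⟩ := hsse
  exact ⟨A.simulator Km Ki haux hek hK₀ hE, fun b z =>
    A.real_compIndist_ideal Km Ki haux hek hK₀ hE hbinding hhiding hcomplete hzk hminority hsim
      hwin b z⟩
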